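/- **Definitions.** A function $G:(0,\infty)^n\to\mathbb R$ is *completely monotone* (CM) if it is $C^\infty$ and $(-1)^{|\alpha|}D^\alpha G\ge 0$ on $(0,\infty)^n$ for all multi-indices $\alpha$. A function $f:(0,\infty)\to[0,\infty)$ is *HCM* if for every $u>0$ there is a CM function $G$ on $(0,\infty)$ with $f(uv)f(u/v)=G(v+1/v)$ for all $v>0$. A function $f:(0,\infty)^2\to[0,\infty)$ is *BVHCM* if for all $u_1,u_2>0$ there is a CM function $G$ on $(0,\infty)^3$ such that, for all $v_1,v_2>0$, $$f(u_1v_1,u_2v_2)\,f\!\left(\tfrac{u_1}{v_1},\tfrac{u_2}{v_2}\right)=G\!\left(v_1+\tfrac1{v_1},\;v_2+\tfrac1{v_2},\;\tfrac{v_1}{v_2}+\tfrac{v_2}{v_1}\right).$$ A random vector $(X,Y)$, almost surely with values in $(0,\infty)^2$, satisfies $(X,Y)\sim BVHCM$ if its law has a density with respect to Lebesgue measure on $(0,\infty)^2$ that is BVHCM. **Proposition.** (a) Let $(X,Y)\sim BVHCM$ with BVHCM density $f$. Then: - for every $y>0$ the conditional density $f_{X|Y=y}(x)=f(x,y)\big/\int_0^\infty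 f(t,y)\,dt$ is a probability density on $(0,\infty)$ and is HCM, and for almost every $y$ with respect to the law of $Y$ it is the density of the conditional law of $X$ given $Y=y$; - $X$ has the density $f_X(x)=\int_0^\infty f(x,y)\,dy$ on $(0,\infty)$, and $f_X$ is HCM; - $X/Y$ has the density $f_{X/Y}(z)=\int_0^\infty y\,f(zy,y)\,dy$ on $(0,\infty)$, and $f_{X/Y}$ is HCM. (b) If $(X_1,X_2)\sim BVHCM$, then $(X_1^{-1},X_2^{-1})\sim BVHCM$. (c) If $(X_1,X_2)\sim BVHCM$, then $(X_1^{q},X_2^{q})\sim BVHCM$ for every real $q$ with $|q|\ge 1$. -/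

import Mathlib

open Set MeasureTheory ProbabilityTheory

noncomputable section

namespace Hyperbolic

/-- A real function of one variable is completely monotone on `(0, ∞)`: it is smooth there and
`(-1) ^ k * g^(k) ≥ 0` for every `k`. -/
def IsCM (g : ℝ → ℝ) : Prop :=
  ContDiffOn ℝ (⊤ : ℕ∞) g (Ioi 0) ∧
    ∀ (k : ℕ) (x : ℝ), 0 < x → 0 ≤ (-1 : ℝ) ^ k * iteratedDeriv k g x

/-- A real function of `n` variables is completely monotone on the open cone `(0, ∞)ⁿ`: it is
smooth there and `(-1) ^ |α| * D^α G ≥ 0` for all multi-indices `α`.  A derivative `D^α` with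
`|α| = k` is written as the iterated derivative along the `k` coordinate directions
`e (i 0), …, e (i (k - 1))`, the direction `e j` being repeated `α j` times. -/
def IsMultiCM {n : ℕ} (G : (Fin n → ℝ) → ℝ) : Prop :=
  ContDiffOn ℝ (⊤ : ℕ∞) G {x | ∀ j, 0 < x j} ∧
    ∀ (k : ℕ) (i : Fin k → Fin n) (x : Fin n → ℝ), (∀ j, 0 < x j) →
      0 ≤ (-1 : ℝ) ^ k * iteratedFDeriv ℝ k G x (fun l => Pi.single (i l) 1)

/-- Hyperbolically completely monotone functions on `(0, ∞)` (values elsewhere are ignored):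
for each `u > 0`, the product `f (u v) f (u / v)` is a completely monotone function of
`w = v + 1 / v`. -/
def IsHCM (f : ℝ → ℝ) : Prop :=
  (∀ x, 0 < x → 0 ≤ f x) ∧
    ∀ u, 0 < u → ∃ G : ℝ → ℝ, IsCM G ∧
      ∀ v, 0 < v → f (u * v) * f (u / v) = G (v + 1 / v)

/-- Bivariate hyperbolically completely monotone functions on `(0, ∞)²` (values elsewhere are
ignored): for all `u₁, u₂ > 0`, the product `f (u₁ v₁, u₂ v₂) f (u₁ / v₁, u₂ / v₂)` is a completely
monotone function of `w₁ = v₁ + 1 / v₁`, `w₂ = v₂ + 1 / v₂` and `w₃ = v₁ / v₂ + v₂ / v₁`. -/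
def IsBVHCM (f : ℝ × ℝ → ℝ) : Prop :=
  (∀ x y, 0 < x → 0 < y → 0 ≤ f (x, y)) ∧
    ∀ u₁ u₂, 0 < u₁ → 0 < u₂ → ∃ G : (Fin 3 → ℝ) → ℝ, IsMultiCM G ∧
      ∀ v₁ v₂, 0 < v₁ → 0 < v₂ →
        f (u₁ * v₁, u₂ * v₂) * f (u₁ / v₁, u₂ / v₂)
          = G ![v₁ + 1 / v₁, v₂ + 1 / v₂, v₁ / v₂ + v₂ / v₁]

/-- The measure on the line with density `g` on `(0, ∞)`, with respect to Lebesgue measure. -/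
def densityMeasure (g : ℝ → ℝ) : Measure ℝ :=
  (volume.restrict (Ioi 0)).withDensity (fun x => ENNReal.ofReal (g x))

/-- The measure on the plane with density `f` on `(0, ∞)²`, with respect to Lebesgue measure. -/
def densityMeasure₂ (f : ℝ × ℝ → ℝ) : Measure (ℝ × ℝ) :=
  (volume.restrict (Ioi 0 ×ˢ Ioi 0)).withDensity (fun p => ENNReal.ofReal (f p))

variable {Ω : Type*} [MeasurableSpace Ω]

/-- The (almost surely positive) random variable `X` has density `g` on `(0, ∞)`. -/
def HasDensity (μ : Measure Ω) (X : Ω → ℝ) (g : ℝ → ℝ) : Prop :=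
  AEMeasurable X μ ∧ Measurable g ∧ (∀ x, 0 < x → 0 ≤ g x) ∧ μ.map X = densityMeasure g

/-- The (almost surely positive) random vector `(X, Y)` has density `f` on `(0, ∞)²`. -/
def HasDensity₂ (μ : Measure Ω) (X Y : Ω → ℝ) (f : ℝ × ℝ → ℝ) : Prop :=
  AEMeasurable X μ ∧ AEMeasurable Y μ ∧ Measurable f ∧ (∀ x y, 0 < x → 0 < y → 0 ≤ f (x, y)) ∧
    μ.map (fun ω => (X ω, Y ω)) = densityMeasure₂ f

/-- `(X, Y) ∼ BVHCM`: the random vector `(X, Y)` has a BVHCM density. -/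
def IsBVHCMVector (μ : Measure Ω) (X Y : Ω → ℝ) : Prop :=
  ∃ f : ℝ × ℝ → ℝ, HasDensity₂ μ X Y f ∧ IsBVHCM f

/-- The density `f_X` of the first coordinate. -/
def marginalDensity (f : ℝ × ℝ → ℝ) (x : ℝ) : ℝ :=
  ∫ y in Ioi 0, f (x, y)

/-- The conditional density `f_{X | Y = y}` of the first coordinate given the second one. -/
def condDensity (f : ℝ × ℝ → ℝ) (y x : ℝ) : ℝ :=
  f (x, y) / ∫ t in Ioi 0, f (t, y)

/-- The density `f_{X / Y}` of the quotient of the coordinates. -/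
def quotientDensity (f : ℝ × ℝ → ℝ) (z : ℝ) : ℝ :=
  ∫ y in Ioi 0, y * f (z * y, y)

end Hyperbolic

end

/-! Complete monotonicity is carried by differences: `CMOn` asks that all iterated alternating
differences along nonnegative steps be nonnegative, a condition stable under products, integrals and
pointwise limits. Bernstein's theorem (`CMOn.exists_measure`, via Krein–Milman) turns such functions
into Laplace transforms, and so recovers smoothness and the signs of the derivatives
(`CMOn.isMultiCM`, `CMOn.isCM`).

For the conditional density one puts v₂ = 1. The vector (X/Y, 1/Y) is again BVHCM, because the
change of variables permutes w₁, w₂, w₃; the quotient is therefore a marginal. For powers, with ρ =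
1/q, v^ρ + v^(-ρ) is a Bernstein function of v + 1/v (`exists_bernstein_rpow`), and composing a CM
function with Bernstein functions keeps it CM. Inverses are the case q = -1.

The marginal is the hard point. Log-concavity makes every section integrable, not just almost every
one (`lintegral_section_lt_top`). In f_X(uv) f_X(u/v) the two integration variables are written e^σ
q and e^σ / q with q = e^(τ/2). For fixed σ the integrand is a CM function of w₁, w₂, w₃, hence a
mixture of exponentials, and the τ-integral of exp(-a(q + 1/q) - b(v/q + q/v)) depends on v only
through a² + b² + ab(v + 1/v) (`lintegral_exp_quadratic_eq`). The result is a mixture of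
exponentials in w = v + 1/v, but convergence is known only for w ≥ 2, the actual range of v + 1/v
(`IsWeakBVHCM.marginal`).

Reaching all w > 0 needs complex analysis (`IsWeakHCM.isHCM`). Convolve f multiplicatively with the
powers of t e^(-t). Each convolution is the marginal of a weakly BVHCM function, hence weakly HCM,
and extends holomorphically to the right half-plane. The product is then holomorphic in w for Re w >
0, and a Taylor series centred beyond 2 carries the derivative signs down to 0. Bounds in terms of
the real values of the convolution control these CM functions as the power grows, and an ultrafilter
limit gives the one for f. -/

namespace Hyperbolic

open Filter Topology
open scoped NNReal ENNReal

/-! ### Complete monotonicity by finite differences -/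

section AltDiff

/-- The iterated difference of `F` along a list of steps, with alternating sign:
each step `h` replaces `F` by `x ↦ F x - F (x + h)`. -/
def altDiff {E : Type*} [Add E] : List E → (E → ℝ) → E → ℝ
  | [], F => F
  | h :: l, F => altDiff l (fun x => F x - F (x + h))

/-- `F` is completely monotone on `S` in the sense of differences: all its iterated alternating
differences along nonnegative steps are nonnegative on `S`. -/
def CMOn {E : Type*} [AddCommMonoid E] [Preorder E] (S : Set E) (F : E → ℝ) : Prop :=
  ∀ l : List E, (∀ h ∈ l, 0 ≤ h) → ∀ x ∈ S, 0 ≤ altDiff l F x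

section Algebra

variable {E : Type*} [AddCommMonoid E]

lemma altDiff_add (l : List E) (F G : E → ℝ) (x : E) :
    altDiff l (fun y => F y + G y) x = altDiff l F x + altDiff l G x := by
  induction l generalizing F G with
  | nil => rfl
  | cons h l ih =>
    simp only [altDiff]
    rw [← ih]
    congr 1
    ext y
    ring

lemma altDiff_const_mul (l : List E) (c : ℝ) (F : E → ℝ) (x : E) :
    altDiff l (fun y => c * F y) x = c * altDiff l F x := by
  induction l generalizing F with
  | nil => rfl
  | cons h l ih =>
    simp only [altDiff]
    rw [← ih]
    congr 1
    ext y
    ring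

lemma altDiff_shift (l : List E) (F : E → ℝ) (s x : E) :
    altDiff l (fun y => F (y + s)) x = altDiff l F (x + s) := by
  induction l generalizing F with
  | nil => rfl
  | cons h l ih =>
    simp only [altDiff]
    rw [← ih]
    congr 1
    ext y
    rw [add_right_comm]

lemma altDiff_comp {E' : Type*} [AddCommMonoid E'] (A L : E → E')
    (hA : ∀ x h, A (x + h) = A x + L h) (l : List E) (F : E' → ℝ) (x : E) :
    altDiff l (fun y => F (A y)) x = altDiff (l.map L) F (A x) := by
  induction l generalizing F with
  | nil => rfl
  | cons h l ih =>
    simp only [altDiff, List.map_cons]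
    rw [← ih]
    simp only [hA]

end Algebra

set_option linter.unusedSectionVars false

section Order

variable {E : Type*} [AddCommMonoid E] [Preorder E] [IsOrderedAddMonoid E] {S : Set E}

lemma add_mem_of_isUpperSet {x h : E} (hS : IsUpperSet S) (hx : x ∈ S) (hh : 0 ≤ h) : x + h ∈ S :=
  hS (le_add_of_nonneg_right hh) hx

lemma altDiff_congr (hS : IsUpperSet S) {F G : E → ℝ} (hFG : ∀ x ∈ S, F x = G x)
    (l : List E) (hl : ∀ h ∈ l, 0 ≤ h) {x : E} (hx : x ∈ S) : altDiff l F x = altDiff l G x := by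
  induction l generalizing F G with
  | nil => exact hFG x hx
  | cons h l ih =>
    have hh : 0 ≤ h := hl h (by simp)
    refine ih (fun y hy => ?_) fun k hk => hl k (by simp [hk])
    simp only [hFG y hy, hFG _ (add_mem_of_isUpperSet hS hy hh)]

lemma CMOn.congr (hS : IsUpperSet S) {F G : E → ℝ} (hF : CMOn S F) (h : ∀ x ∈ S, F x = G x) :
    CMOn S G := fun l hl x hx => by
  rw [← altDiff_congr hS h l hl hx]
  exact hF l hl x hx

lemma CMOn.mono {S' : Set E} {F : E → ℝ} (hF : CMOn S F) (h : S' ⊆ S) : CMOn S' F :=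
  fun l hl x hx => hF l hl x (h hx)

lemma CMOn.nonneg {F : E → ℝ} (hF : CMOn S F) {x : E} (hx : x ∈ S) : 0 ≤ F x :=
  hF [] (by simp) x hx

lemma CMOn.diff {F : E → ℝ} (hF : CMOn S F) {h : E} (hh : 0 ≤ h) :
    CMOn S (fun x => F x - F (x + h)) := fun l hl x hx =>
  hF (h :: l) (by simpa [hh] using hl) x hx

lemma CMOn.shift (hS : IsUpperSet S) {F : E → ℝ} (hF : CMOn S F) {h : E} (hh : 0 ≤ h) :
    CMOn S (fun x => F (x + h)) := fun l hl x hx => by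
  rw [altDiff_shift]
  exact hF l hl _ (add_mem_of_isUpperSet hS hx hh)

lemma CMOn.add {F G : E → ℝ} (hF : CMOn S F) (hG : CMOn S G) : CMOn S (fun x => F x + G x) :=
  fun l hl x hx => by
    rw [altDiff_add]
    exact add_nonneg (hF l hl x hx) (hG l hl x hx)

lemma CMOn.const_mul {F : E → ℝ} (hF : CMOn S F) {c : ℝ} (hc : 0 ≤ c) :
    CMOn S (fun x => c * F x) := fun l hl x hx => by
  rw [altDiff_const_mul]
  exact mul_nonneg hc (hF l hl x hx)

lemma CMOn.antitone {F : E → ℝ} (hF : CMOn S F) {x h : E} (hx : x ∈ S) (hh : 0 ≤ h) :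
    F (x + h) ≤ F x := by
  have := (hF.diff hh).nonneg hx
  linarith

lemma cmOn_const (S : Set E) {c : ℝ} (hc : 0 ≤ c) : CMOn S (fun _ => c) := by
  intro l hl x hx
  induction l generalizing c with
  | nil => exact hc
  | cons h l ih =>
    simp only [altDiff, sub_self]
    exact ih le_rfl fun k hk => hl k (by simp [hk])

/-- Discrete Leibniz rule: one difference of F G is (ΔF) G plus (F shifted) (ΔG), and all factors
are again completely monotone. Hence induction on the list of steps. -/
lemma CMOn.mul (hS : IsUpperSet S) {F G : E → ℝ} (hF : CMOn S F) (hG : CMOn S G) :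
    CMOn S (fun x => F x * G x) := by
  intro l
  induction l generalizing F G with
  | nil => exact fun _ x hx => mul_nonneg (hF.nonneg hx) (hG.nonneg hx)
  | cons h l ih =>
    intro hl x hx
    have hh : 0 ≤ h := hl h (by simp)
    have hl' : ∀ k ∈ l, 0 ≤ k := fun k hk => hl k (by simp [hk])
    have e : (fun x => F x * G x - F (x + h) * G (x + h)) =
        fun x => (F x - F (x + h)) * G x + F (x + h) * (G x - G (x + h)) := by
      ext y; ring
    simp only [altDiff]
    rw [e, altDiff_add]
    exact add_nonneg (ih (hF.diff hh) hG hl' x hx) (ih (hF.shift hS hh) (hG.diff hh) hl' x hx)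

lemma CMOn.sum {ι : Type*} (s : Finset ι) {F : ι → E → ℝ} (hF : ∀ i ∈ s, CMOn S (F i)) :
    CMOn S (fun x => ∑ i ∈ s, F i x) := by
  classical
  induction s using Finset.induction_on with
  | empty => simpa using cmOn_const S le_rfl
  | insert a s ha ih =>
    simp only [Finset.sum_insert ha]
    exact (hF a (by simp)).add (ih fun i hi => hF i (by simp [hi]))

lemma CMOn.prod (hS : IsUpperSet S) {ι : Type*} (s : Finset ι) {F : ι → E → ℝ}
    (hF : ∀ i ∈ s, CMOn S (F i)) : CMOn S (fun x => ∏ i ∈ s, F i x) := by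
  classical
  induction s using Finset.induction_on with
  | empty => simpa using cmOn_const S zero_le_one
  | insert a s ha ih =>
    simp only [Finset.prod_insert ha]
    exact (hF a (by simp)).mul hS (ih fun i hi => hF i (by simp [hi]))

lemma CMOn.pow (hS : IsUpperSet S) {F : E → ℝ} (hF : CMOn S F) (n : ℕ) :
    CMOn S (fun x => F x ^ n) := by
  simpa using CMOn.prod hS (Finset.range n) (F := fun _ => F) fun _ _ => hF

/-- Each iterated difference involves finitely many values, so pointwise convergence suffices; no
control of derivatives is needed. -/
lemma CMOn.of_tendsto (hS : IsUpperSet S) {ι : Type*} {u : Filter ι} [u.NeBot]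
    {F : ι → E → ℝ} {G : E → ℝ} (hF : ∀ᶠ i in u, CMOn S (F i))
    (hG : ∀ x ∈ S, Tendsto (fun i => F i x) u (𝓝 (G x))) : CMOn S G := by
  intro l hl x hx
  have key : Tendsto (fun i => altDiff l (F i) x) u (𝓝 (altDiff l G x)) := by
    clear hF
    induction l generalizing F G with
    | nil => exact hG x hx
    | cons h l ih =>
      refine ih (fun y hy => (hG y hy).sub (hG _ (add_mem_of_isUpperSet hS hy ?_))) fun k hk => hl k (by simp [hk])
      exact hl h (by simp)
  exact ge_of_tendsto key (hF.mono fun i hi => hi l hl x hx)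

lemma CMOn.exp (hS : IsUpperSet S) {F : E → ℝ} (hF : CMOn S F) :
    CMOn S (fun x => Real.exp (F x)) := by
  refine CMOn.of_tendsto hS (u := atTop)
    (F := fun N x => ∑ k ∈ Finset.range N, (k.factorial : ℝ)⁻¹ * F x ^ k)
    (Eventually.of_forall fun N => CMOn.sum _ fun k _ => (hF.pow hS k).const_mul (by positivity)) ?_
  intro x _
  have := (NormedSpace.expSeries_div_hasSum_exp (F x)).tendsto_sum_nat
  rw [← Real.exp_eq_exp_ℝ] at this
  simpa [div_eq_inv_mul] using this

lemma CMOn.comp {E' : Type*} [AddCommMonoid E'] [Preorder E'] {T : Set E'}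
    {F : E' → ℝ} (hF : CMOn T F) {A L : E → E'} (hA : ∀ x h, A (x + h) = A x + L h)
    (hL : ∀ h, 0 ≤ h → 0 ≤ L h) (hT : ∀ x ∈ S, A x ∈ T) : CMOn S (fun x => F (A x)) := by
  intro l hl x hx
  rw [altDiff_comp A L hA]
  refine hF _ (fun k hk => ?_) _ (hT x hx)
  obtain ⟨h, hh, rfl⟩ := List.mem_map.1 hk
  exact hL h (hl h hh)

/-- Differences commute with the integral by linearity alone, so integrability at each point
replaces any domination of derivatives. -/
lemma CMOn.integral (hS : IsUpperSet S) {α : Type*} [MeasurableSpace α] {μ : Measure α}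
    {K : α → E → ℝ} (hK : ∀ᵐ a ∂μ, CMOn S (K a)) (hint : ∀ x ∈ S, Integrable (fun a => K a x) μ) :
    CMOn S (fun x => ∫ a, K a x ∂μ) := by
  have key : ∀ (l : List E), (∀ h ∈ l, 0 ≤ h) → ∀ (K : α → E → ℝ),
      (∀ x ∈ S, Integrable (fun a => K a x) μ) → ∀ x ∈ S,
      altDiff l (fun x => ∫ a, K a x ∂μ) x = ∫ a, altDiff l (K a) x ∂μ := by
    intro l
    induction l with
    | nil => exact fun _ K _ x _ => rfl
    | cons h l ih =>
      intro hl K hint x hx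
      have hh : 0 ≤ h := hl h (by simp)
      have hl' : ∀ k ∈ l, 0 ≤ k := fun k hk => hl k (by simp [hk])
      simp only [altDiff]
      rw [← ih hl' (fun a x => K a x - K a (x + h))
        (fun y hy => (hint y hy).sub (hint _ (add_mem_of_isUpperSet hS hy hh))) x hx]
      refine altDiff_congr hS (fun y hy => ?_) l hl' hx
      rw [integral_sub (hint y hy) (hint _ (add_mem_of_isUpperSet hS hy hh))]
  intro l hl x hx
  rw [key l hl K hint x hx]
  exact integral_nonneg_of_ae (hK.mono fun a ha => ha l hl x hx)

end Order

end AltDiff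

/-! ### From alternating derivatives to differences, in one variable -/

section Deriv

/-- A function whose derivatives, as given by a sequence, alternate in sign is completely monotone
in the sense of differences. -/
lemma cmOn_of_hasDerivAt {S : Set ℝ} (hS : IsUpperSet S) (g : ℕ → ℝ → ℝ)
    (hg : ∀ k, ∀ x ∈ S, HasDerivAt (g k) (-g (k + 1) x) x) (h0 : ∀ k, ∀ x ∈ S, 0 ≤ g k x) :
    CMOn S (g 0) := by
  intro l
  induction l generalizing g with
  | nil => exact fun _ x hx => h0 0 x hx
  | cons h l ih =>
    intro hl x hx
    have hh : 0 ≤ h := hl h (by simp)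
    refine ih (fun k x => g k x - g k (x + h)) (fun k y hy => ?_) (fun k y hy => ?_)
      (fun k hk => hl k (by simp [hk])) x hx
    · have h2 : HasDerivAt (fun y => g k (y + h)) (-g (k + 1) (y + h)) y :=
        (hg k (y + h) (add_mem_of_isUpperSet hS hy hh)).comp_add_const y h
      refine ((hg k y hy).sub h2).congr_deriv ?_
      ring
    · have hsub : Icc y (y + h) ⊆ S := fun z hz => hS hz.1 hy
      have : AntitoneOn (g k) (Icc y (y + h)) := by
        refine antitoneOn_of_deriv_nonpos (convex_Icc _ _)
          (fun z hz => (hg k z (hsub hz)).continuousAt.continuousWithinAt)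
          (fun z hz => (hg k z (hsub (interior_subset hz))).differentiableAt.differentiableWithinAt)
          fun z hz => ?_
        rw [(hg k z (hsub (interior_subset hz))).deriv]
        simpa using h0 (k + 1) z (hsub (interior_subset hz))
      have := this (left_mem_Icc.2 (by linarith)) (right_mem_Icc.2 (by linarith)) (by linarith)
      simpa using this

lemma cmOn_exp_neg_mul (S : Set ℝ) {a : ℝ} (ha : 0 ≤ a) : CMOn S (fun x => Real.exp (-(a * x))) := by
  have : CMOn (univ : Set ℝ) (fun x => Real.exp (-(a * x))) := by
    have := cmOn_of_hasDerivAt (S := univ) isUpperSet_univ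
      (fun k x => a ^ k * Real.exp (-(a * x))) (fun k x _ => ?_) (fun k x _ => by positivity)
    · simpa using this
    · have h1 : HasDerivAt (fun x : ℝ => -(a * x)) (-(a * 1)) x :=
        ((hasDerivAt_id x).const_mul a).neg
      refine (h1.exp.const_mul (a ^ k)).congr_deriv ?_
      ring
  exact this.mono (subset_univ S)

lemma cmOn_inv_add {a t : ℝ} (ha : 0 < a) (ht : 0 ≤ t) :
    CMOn (Ioi 0) (fun x : ℝ => (a + t * x)⁻¹) := by
  have := cmOn_of_hasDerivAt (S := Ioi (0 : ℝ)) (isUpperSet_Ioi 0)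
    (fun k x => k.factorial * t ^ k * ((a + t * x) ^ (k + 1))⁻¹) (fun k x hx => ?_)
    (fun k x hx => ?_)
  · simpa using this
  · have hx' : 0 < a + t * x := by have : 0 < x := hx; positivity
    have h1 : HasDerivAt (fun x : ℝ => a + t * x) (t * 1) x :=
      ((hasDerivAt_id x).const_mul t).const_add a
    have h2 := ((h1.fun_pow (k + 1)).fun_inv (by positivity)).const_mul (k.factorial * t ^ k : ℝ)
    refine h2.congr_deriv ?_
    simp only [Nat.factorial_succ, Nat.add_sub_cancel]
    push_cast
    field_simp
    ring
  · have : 0 < x := hx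
    positivity

end Deriv

/-! ### From alternating derivatives to differences, in several variables -/

section MultiCM

variable {n : ℕ}

lemma isUpperSet_pos : IsUpperSet {x : Fin n → ℝ | ∀ j, 0 < x j} :=
  fun _ _ hxy hx j => (hx j).trans_le (hxy j)

lemma isOpen_pos : IsOpen {x : Fin n → ℝ | ∀ j, 0 < x j} := by
  simp only [ofPred_forall]
  exact isOpen_iInter_of_finite fun j => isOpen_lt continuous_const (continuous_apply j)

lemma IsMultiCM.contDiffAt {G : (Fin n → ℝ) → ℝ} (hG : IsMultiCM G) {x : Fin n → ℝ}
    (hx : ∀ j, 0 < x j) : ContDiffAt ℝ (⊤ : ℕ∞) G x :=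
  hG.1.contDiffAt (isOpen_pos.mem_nhds hx)

/-- Along t ↦ x + t h the derivative is a combination of the next-order coordinate derivatives with
coefficients h j ≥ 0, and these all have the opposite sign. -/
lemma IsMultiCM.antitone_deriv {G : (Fin n → ℝ) → ℝ} (hG : IsMultiCM G) (k : ℕ)
    (i : Fin k → Fin n) {x h : Fin n → ℝ} (hx : ∀ j, 0 < x j) (hh : 0 ≤ h) :
    (-1 : ℝ) ^ k * iteratedFDeriv ℝ k G (x + h) (fun l => Pi.single (i l) 1) ≤
      (-1 : ℝ) ^ k * iteratedFDeriv ℝ k G x (fun l => Pi.single (i l) 1) := by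
  set e : Fin k → (Fin n → ℝ) := fun l => Pi.single (i l) 1
  have hpos : ∀ t : ℝ, 0 ≤ t → ∀ j, 0 < (x + t • h) j := fun t ht j => by
    have := hx j
    have := hh j
    simp only [Pi.zero_apply] at this
    simp only [Pi.add_apply, Pi.smul_apply, smul_eq_mul]
    positivity
  have hd : ∀ t : ℝ, 0 ≤ t → HasDerivAt
      (fun t : ℝ => (-1 : ℝ) ^ k * iteratedFDeriv ℝ k G (x + t • h) e)
      ((-1 : ℝ) ^ k * iteratedFDeriv ℝ (k + 1) G (x + t • h) (Fin.cons h e)) t := by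
    intro t ht
    have h1 : DifferentiableAt ℝ (iteratedFDeriv ℝ k G) (x + t • h) :=
      (hG.contDiffAt (hpos t ht)).differentiableAt_iteratedFDeriv
        (by exact_mod_cast WithTop.coe_lt_top _)
    have h2 : HasDerivAt (fun t : ℝ => x + t • h) h t := by
      simpa using ((hasDerivAt_id t).smul_const h).const_add x
    have h3 := h1.hasFDerivAt.comp_hasDerivAt t h2
    have h4 := (ContinuousMultilinearMap.apply ℝ (fun _ : Fin k => (Fin n → ℝ)) ℝ e).hasFDerivAt.comp_hasDerivAt t h3
    refine (h4.const_mul ((-1 : ℝ) ^ k)).congr_deriv ?_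
    rw [iteratedFDeriv_succ_apply_left]
    simp
  have hanti : AntitoneOn (fun t : ℝ => (-1 : ℝ) ^ k * iteratedFDeriv ℝ k G (x + t • h) e)
      (Icc 0 1) := by
    refine antitoneOn_of_deriv_nonpos (convex_Icc _ _)
      (fun z hz => (hd z hz.1).continuousAt.continuousWithinAt)
      (fun z hz => (hd z (interior_subset hz).1).differentiableAt.differentiableWithinAt)
      fun z hz => ?_
    have hz0 : 0 ≤ z := (interior_subset hz).1
    rw [(hd z hz0).deriv]
    have hsum : h = ∑ j, h j • (Pi.single j 1 : Fin n → ℝ) := by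
      ext j
      simp [Finset.sum_apply, Pi.single_apply]
    have : iteratedFDeriv ℝ (k + 1) G (x + z • h) (Fin.cons h e) =
        ∑ j, h j * iteratedFDeriv ℝ (k + 1) G (x + z • h) (Fin.cons (Pi.single j 1) e) := by
      simp only [Fin.cons_zero, Fin.tail_cons, iteratedFDeriv_succ_apply_left]
      generalize fderiv ℝ (iteratedFDeriv ℝ k G) (x + z • h) = T
      conv_lhs => rw [hsum]
      simp
    rw [this, Finset.mul_sum]
    refine Finset.sum_nonpos fun j _ => ?_
    have h5 := hG.2 (k + 1) (Fin.cons j i) (x + z • h) (hpos z hz0)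
    have h6 : (fun l => Pi.single ((Fin.cons j i : Fin (k + 1) → Fin n) l) (1 : ℝ)) =
        (Fin.cons (Pi.single j 1) e : Fin (k + 1) → (Fin n → ℝ)) := by
      ext l : 1
      refine Fin.cases ?_ (fun l => ?_) l <;> simp [e]
    rw [h6, pow_succ] at h5
    have := mul_nonneg (hh j) h5
    nlinarith [this]
  have := hanti (left_mem_Icc.2 zero_le_one) (right_mem_Icc.2 zero_le_one) zero_le_one
  simpa using this

lemma IsMultiCM.sub_shift {G : (Fin n → ℝ) → ℝ} (hG : IsMultiCM G) {h : Fin n → ℝ} (hh : 0 ≤ h) :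
    IsMultiCM (fun x => G x - G (x + h)) := by
  have hsh : ContDiffOn ℝ (⊤ : ℕ∞) (fun x => G (x + h)) {x | ∀ j, 0 < x j} :=
    hG.1.comp (contDiff_id.add contDiff_const).contDiffOn
      fun x hx => add_mem_of_isUpperSet isUpperSet_pos hx hh
  refine ⟨hG.1.sub hsh, fun k i x hx => ?_⟩
  have hx' : ∀ j, 0 < (x + h) j := add_mem_of_isUpperSet isUpperSet_pos hx hh
  have h1 : ContDiffAt ℝ k G x := (hG.contDiffAt hx).of_le (by exact_mod_cast le_top)
  have h2 : ContDiffAt ℝ k (fun x => G (x + h)) x :=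
    (hsh.contDiffAt (isOpen_pos.mem_nhds hx)).of_le (by exact_mod_cast le_top)
  have e : (fun x => G x - G (x + h)) = G - fun x => G (x + h) := rfl
  rw [e, iteratedFDeriv_sub_apply h1 h2, iteratedFDeriv_comp_add_right]
  have := hG.antitone_deriv k i hx hh
  simp only [_root_.sub_apply]
  linarith

/-- A single difference preserves the class (`IsMultiCM.sub_shift`), so iterating reduces to
nonnegativity, the derivative condition of order 0. -/
lemma IsMultiCM.cmOn {G : (Fin n → ℝ) → ℝ} (hG : IsMultiCM G) :
    CMOn {x : Fin n → ℝ | ∀ j, 0 < x j} G := by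
  intro l
  induction l generalizing G with
  | nil =>
    intro _ x hx
    simpa [altDiff] using hG.2 0 Fin.elim0 x hx
  | cons h l ih =>
    exact fun hl x hx => ih (hG.sub_shift (hl h (by simp))) (fun k hk => hl k (by simp [hk])) x hx

end MultiCM

/-! ### Bernstein's theorem by extreme points -/

section Bernstein

open scoped unitInterval

/-- Nonnegativity makes L monotone. Comparing N h with its integer part then bounds N |L h - h L 1|
by L 1 for every N. -/
lemma eq_mul_of_additive_nonneg {L : ℝ≥0 → ℝ} (hadd : ∀ x y, L (x + y) = L x + L y)
    (h0 : ∀ x, 0 ≤ L x) (h : ℝ≥0) : L h = h * L 1 := by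
  have hmono : ∀ x y, x ≤ y → L x ≤ L y := fun x y hxy => by
    obtain ⟨z, rfl⟩ := exists_add_of_le hxy
    rw [hadd]
    linarith [h0 z]
  have hz : L 0 = 0 := by have := hadd 0 0; simp at this; exact this
  have hmul : ∀ (N : ℕ) (x : ℝ≥0), L (N * x) = N * L x := fun N x => by
    induction N with
    | zero => simp [hz]
    | succ N ih =>
      push_cast
      rw [add_mul, one_mul, hadd, ih]
      ring
  have hbound : ∀ N : ℕ, N * |L h - h * L 1| ≤ L 1 := fun N => by
    have h1 : ((⌊(N : ℝ≥0) * h⌋₊ : ℕ) : ℝ≥0) ≤ N * h := Nat.floor_le (by positivity)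
    have h2 : (N : ℝ≥0) * h ≤ (⌊(N : ℝ≥0) * h⌋₊ : ℕ) + 1 := (Nat.lt_floor_add_one _).le
    set m := ⌊(N : ℝ≥0) * h⌋₊
    have h3 := hmono _ _ h1
    have h4 := hmono _ _ h2
    have h5 := hmul m 1
    rw [mul_one] at h5
    rw [h5, hmul] at h3
    rw [hadd, h5, hmul] at h4
    have h1' : (m : ℝ) ≤ N * h := by exact_mod_cast h1
    have h2' : (N : ℝ) * h ≤ m + 1 := by exact_mod_cast h2
    have hL := h0 1
    rw [← abs_of_nonneg (Nat.cast_nonneg' N : (0 : ℝ) ≤ N), ← abs_mul, abs_le]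
    constructor <;> nlinarith
  by_contra hne
  have hpos : 0 < |L h - h * L 1| := abs_pos.2 (sub_ne_zero.2 hne)
  obtain ⟨N, hN⟩ := exists_nat_gt (L 1 / |L h - h * L 1|)
  rw [div_lt_iff₀ hpos] at hN
  linarith [hbound N]

/-- If χ 1 > 0, then -log χ is additive and nonnegative. If χ 1 = 0, some multiple of a given h > 0
exceeds 1, so a power of χ h vanishes; at h = 0 the convention 0 ^ 0 = 1 gives the right value. -/
lemma eq_rpow_of_multiplicative {χ : ℝ≥0 → ℝ} (hz : χ 0 = 1)
    (hmul : ∀ x y, χ (x + y) = χ x * χ y) (h0 : ∀ x, 0 ≤ χ x) (h1 : ∀ x, χ x ≤ 1) (h : ℝ≥0) :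
    χ h = χ 1 ^ (h : ℝ) := by
  have hpow : ∀ (N : ℕ) (x : ℝ≥0), χ (N * x) = χ x ^ N := fun N x => by
    induction N with
    | zero => simp [hz]
    | succ N ih =>
      push_cast
      rw [add_mul, one_mul, hmul, ih, pow_succ]
  have hanti : ∀ x y, x ≤ y → χ y ≤ χ x := fun x y hxy => by
    obtain ⟨z, rfl⟩ := exists_add_of_le hxy
    rw [hmul]
    exact mul_le_of_le_one_right (h0 x) (h1 z)
  rcases (h0 1).eq_or_lt with ht | ht
  · rcases eq_or_ne h 0 with rfl | hh
    · simp [hz]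
    · rw [← ht, Real.zero_rpow (by exact_mod_cast hh)]
      obtain ⟨N, hN⟩ := exists_nat_gt (h⁻¹)
      have : 1 ≤ N * h := by
        have hpos : 0 < h := pos_iff_ne_zero.2 hh
        calc (1 : ℝ≥0) = h⁻¹ * h := (inv_mul_cancel₀ hh).symm
          _ ≤ N * h := by gcongr
      have h2 := hanti _ _ this
      rw [hpow, ← ht] at h2
      exact pow_eq_zero_iff (n := N) (by rintro rfl; simp at hN) |>.1
        (le_antisymm h2 (pow_nonneg (h0 h) N))
  · have hpos : ∀ x, 0 < χ x := fun x => by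
      obtain ⟨N, hN⟩ := exists_nat_gt x
      have := hpow N 1
      rw [mul_one] at this
      calc 0 < χ 1 ^ N := by positivity
        _ = χ N := this.symm
        _ ≤ χ x := hanti _ _ hN.le
    have := eq_mul_of_additive_nonneg (L := fun x => -Real.log (χ x))
      (fun x y => by rw [hmul, Real.log_mul (hpos x).ne' (hpos y).ne']; ring)
      (fun x => by have := Real.log_nonpos (h0 x) (h1 x); linarith) h
    rw [Real.rpow_def_of_pos ht, ← Real.exp_log (hpos h)]
    congr 1
    linarith

variable {n : ℕ}

/-- The characters of the semigroup `[0, ∞)ⁿ` with values in `[0, 1]`, indexed by the cube. -/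
noncomputable def cubeChar (t : Fin n → I) (x : Fin n → ℝ≥0) : ℝ :=
  ∏ j, (t j : ℝ) ^ (x j : ℝ)

lemma continuous_cubeChar (x : Fin n → ℝ≥0) : Continuous fun t : Fin n → I => cubeChar t x := by
  unfold cubeChar
  refine continuous_finsetProd _ fun j _ => ?_
  exact (continuous_subtype_val.comp (continuous_apply j)).rpow_const fun t => Or.inr (x j).2

/-- Normalized completely monotone functions on the semigroup `[0, ∞)ⁿ`. -/
def normalizedCM (n : ℕ) : Set ((Fin n → ℝ≥0) → ℝ) :=
  {a | a 0 = 1 ∧ CMOn univ a}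

/-- Mixtures of characters of the semigroup `[0, ∞)ⁿ`. -/
def charMixtures (n : ℕ) : Set ((Fin n → ℝ≥0) → ℝ) :=
  range fun (m : ProbabilityMeasure (Fin n → I)) x => ∫ t, cubeChar t x ∂(m : Measure (Fin n → I))

/-- The probability measures on the compact cube form a compact space, and each character is a
continuous test function on it. -/
lemma isCompact_charMixtures : IsCompact (charMixtures n) :=
  isCompact_range <| continuous_pi fun x =>
    ProbabilityMeasure.continuous_integral_continuousMap (⟨_, continuous_cubeChar x⟩ : C(Fin n → I, ℝ))

lemma integrable_cubeChar (m : Measure (Fin n → I)) [IsFiniteMeasure m] (x : Fin n → ℝ≥0) :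
    Integrable (fun t => cubeChar t x) m :=
  (continuous_cubeChar x).integrable_of_hasCompactSupport (HasCompactSupport.of_compactSpace _)

lemma convex_charMixtures : Convex ℝ (charMixtures n) := by
  rintro _ ⟨m₁, rfl⟩ _ ⟨m₂, rfl⟩ a b ha hb hab
  have hprob : IsProbabilityMeasure (ENNReal.ofReal a • (m₁ : Measure (Fin n → I)) +
      ENNReal.ofReal b • (m₂ : Measure (Fin n → I))) := ⟨by
    simp [← ENNReal.ofReal_add ha hb, hab]⟩
  refine ⟨⟨_, hprob⟩, ?_⟩
  ext x
  simp only [ProbabilityMeasure.coe_mk, Pi.add_apply, Pi.smul_apply, smul_eq_mul]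
  rw [integral_add_measure, integral_smul_measure, integral_smul_measure]
  · simp [ENNReal.toReal_ofReal, ha, hb]
  · exact (integrable_cubeChar _ x).smul_measure ENNReal.ofReal_ne_top
  · exact (integrable_cubeChar _ x).smul_measure ENNReal.ofReal_ne_top

lemma normalizedCM_mem_Icc {a : (Fin n → ℝ≥0) → ℝ} (ha : a ∈ normalizedCM n)
    (x : Fin n → ℝ≥0) : a x ∈ Icc (0 : ℝ) 1 := by
  refine ⟨ha.2.nonneg (mem_univ x), ?_⟩
  have := ha.2.antitone (mem_univ 0) (zero_le (a := x))
  rwa [zero_add, ha.1] at this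

/-- Tychonoff: values lie in [0, 1], and every defining condition involves finitely many
evaluations, hence is closed for pointwise convergence. -/
lemma isCompact_normalizedCM : IsCompact (normalizedCM n) := by
  have hsub : normalizedCM n ⊆ Set.pi univ fun _ => Icc (0 : ℝ) 1 :=
    fun a ha x _ => normalizedCM_mem_Icc ha x
  refine (isCompact_univ_pi fun _ => isCompact_Icc).of_isClosed_subset ?_ hsub
  have hcont : ∀ (l : List (Fin n → ℝ≥0)) (x : Fin n → ℝ≥0),
      Continuous fun a : (Fin n → ℝ≥0) → ℝ => altDiff l a x := by
    intro l x
    have : ∀ {Y : Type} [TopologicalSpace Y] (F : Y → (Fin n → ℝ≥0) → ℝ),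
        (∀ z, Continuous fun y => F y z) → Continuous fun y => altDiff l (F y) x := by
      induction l with
      | nil => exact fun F hF => hF x
      | cons h l ih => exact fun F hF => ih _ fun z => (hF z).sub (hF _)
    exact this (fun a => a) fun z => continuous_apply z
  have : normalizedCM n = {a | a 0 = 1} ∩
      ⋂ (l : List (Fin n → ℝ≥0)) (x : Fin n → ℝ≥0), {a | 0 ≤ altDiff l a x} := by
    ext a
    simp [normalizedCM, CMOn]
  rw [this]
  exact (isClosed_eq (continuous_apply _) continuous_const).inter
    (isClosed_iInter fun l => isClosed_iInter fun x => isClosed_le continuous_const (hcont l x))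

lemma convex_normalizedCM : Convex ℝ (normalizedCM n) := by
  rintro a ha b hb p q hp hq hpq
  refine ⟨by simp [ha.1, hb.1, hpq], ?_⟩
  exact (ha.2.const_mul hp).add (hb.2.const_mul hq)

/-- When 0 < a s < 1, a is the convex combination, with weights a s and 1 - a s, of its normalized
shift and its normalized difference by s. Extremality makes the shift proportional to a. The cases a
s = 0 and a s = 1 follow from monotonicity. -/
lemma multiplicative_of_mem_extremePoints {a : (Fin n → ℝ≥0) → ℝ}
    (ha : a ∈ (normalizedCM n).extremePoints ℝ) (x s : Fin n → ℝ≥0) :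
    a (x + s) = a x * a s := by
  have haK := ha.1
  have hsn : 0 ≤ s := zero_le
  have hshift : CMOn univ fun x => a (x + s) := haK.2.shift isUpperSet_univ hsn
  have hdiff : CMOn univ fun x => a x - a (x + s) := haK.2.diff hsn
  have hs := normalizedCM_mem_Icc haK s
  rcases hs.1.eq_or_lt with h0 | h0
  · have h1 := hshift.antitone (mem_univ 0) (zero_le (a := x))
    have h2 := hshift.nonneg (mem_univ x)
    simp only [zero_add] at h1
    rw [← h0, mul_zero]
    linarith
  rcases hs.2.eq_or_lt with h1 | h1
  · have h1' := hdiff.antitone (mem_univ 0) (zero_le (a := x))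
    have h2 := hdiff.nonneg (mem_univ x)
    simp only [zero_add, haK.1, h1] at h1'
    rw [h1, mul_one]
    linarith
  have h1' : 0 < 1 - a s := by linarith
  have m1 : (fun x => (a s)⁻¹ * a (x + s)) ∈ normalizedCM n :=
    ⟨by simp [h0.ne'], hshift.const_mul (by positivity)⟩
  have m2 : (fun x => (1 - a s)⁻¹ * (a x - a (x + s))) ∈ normalizedCM n :=
    ⟨by simp [haK.1, h1'.ne'], hdiff.const_mul (by positivity)⟩
  have hseg : a ∈ openSegment ℝ (fun x => (a s)⁻¹ * a (x + s))
      (fun x => (1 - a s)⁻¹ * (a x - a (x + s))) := by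
    refine ⟨a s, 1 - a s, h0, h1', by ring, ?_⟩
    ext y
    simp only [Pi.add_apply, Pi.smul_apply, smul_eq_mul]
    field_simp
    ring
  have := congrFun (ha.2 m1 m2 hseg) x
  rw [← this]
  field_simp

lemma extremePoints_normalizedCM_subset :
    (normalizedCM n).extremePoints ℝ ⊆ charMixtures n := by
  intro a ha
  have hmul := multiplicative_of_mem_extremePoints ha
  have hI := normalizedCM_mem_Icc ha.1
  let t : Fin n → I := fun j => ⟨a (Pi.single j 1), hI _⟩
  have hprod : ∀ x : Fin n → ℝ≥0, a x = cubeChar t x := by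
    intro x
    have h1 : ∀ j (h : ℝ≥0), a (Pi.single j h) = (t j : ℝ) ^ (h : ℝ) := fun j h =>
      eq_rpow_of_multiplicative (χ := fun h => a (Pi.single j h)) (by simp [ha.1.1])
        (fun u v => by rw [Pi.single_add, hmul]) (fun u => (hI _).1) (fun u => (hI _).2) h
    have h2 : ∀ s : Finset (Fin n), a (∑ j ∈ s, Pi.single j (x j)) =
        ∏ j ∈ s, a (Pi.single j (x j)) := by
      intro s
      induction s using Finset.induction_on with
      | empty => simp [ha.1.1]
      | insert j s hj ih => rw [Finset.sum_insert hj, Finset.prod_insert hj, hmul, ih]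
    have h3 := h2 Finset.univ
    rw [Finset.univ_sum_single] at h3
    rw [h3]
    exact Finset.prod_congr rfl fun j _ => h1 j (x j)
  refine ⟨⟨Measure.dirac t, inferInstance⟩, ?_⟩
  ext x
  simp [hprod x]

/-- **Bernstein's theorem** on the semigroup `[0, ∞)ⁿ`. -/
theorem normalizedCM_subset_charMixtures : normalizedCM n ⊆ charMixtures n := by
  rw [← closure_convexHull_extremePoints isCompact_normalizedCM (convex_normalizedCM (n := n))]
  exact closure_minimal (convexHull_min extremePoints_normalizedCM_subset convex_charMixtures)
    isCompact_charMixtures.isClosed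

/-- **Bernstein's theorem** in several variables: a function which is completely monotone on the
cone with vertex `c` is, in the interior of the cone, the Laplace transform of a measure. -/
theorem CMOn.exists_measure {G : (Fin n → ℝ) → ℝ} {c : Fin n → ℝ} (hG : CMOn (Ici c) G) :
    ∃ μ : Measure (Fin n → ℝ), IsFiniteMeasure μ ∧ (∀ᵐ p ∂μ, ∀ j, 0 ≤ p j) ∧
      ∀ x, (∀ j, c j < x j) → G x = ∫ p, Real.exp (-∑ j, p j * (x j - c j)) ∂μ := by
  -- If G c = 0 there is nothing to normalize by, but monotonicity then forces G = 0 on the cone.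
  rcases (hG.nonneg (x := c) self_mem_Ici).eq_or_lt with h0 | h0
  · refine ⟨0, inferInstance, by simp, fun x hx => ?_⟩
    have hcx : c ≤ x := fun j => (hx j).le
    have h1 := hG.nonneg (x := x) hcx
    have h2 := hG.antitone (x := c) (h := x - c) self_mem_Ici (sub_nonneg.2 hcx)
    rw [add_sub_cancel] at h2
    simp only [integral_zero_measure]
    linarith
  let a : (Fin n → ℝ≥0) → ℝ := fun s => (G c)⁻¹ * G (c + fun j => (s j : ℝ))
  have ha : a ∈ normalizedCM n := by
    refine ⟨?_, ?_⟩
    · have : (c + fun j => (((0 : Fin n → ℝ≥0) j : ℝ≥0) : ℝ)) = c := by ext j; simp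
      simp only [a, this]
      exact inv_mul_cancel₀ h0.ne'
    · refine (hG.comp (S := univ) (A := fun s : Fin n → ℝ≥0 => c + fun j => (s j : ℝ))
        (L := fun s j => (s j : ℝ)) (fun x h => ?_) (fun h _ j => (h j).2)
        fun x _ j => by simp).const_mul (by positivity)
      ext j
      simp [add_assoc]
  obtain ⟨m, hm⟩ := normalizedCM_subset_charMixtures ha
  have hmeas : Measurable fun (t : Fin n → I) j => -Real.log (t j : ℝ) := by
    refine measurable_pi_lambda _ fun j => ?_
    exact (Real.measurable_log.comp (measurable_subtype_coe.comp (measurable_pi_apply j))).neg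
  -- A coordinate t j = 0 would mean an infinite exponent -log (t j). Such characters vanish
  -- wherever x j > c j, so dropping them is harmless in the interior of the cone.
  let T : Set (Fin n → I) := {t | ∀ j, 0 < (t j : ℝ)}
  have hT : MeasurableSet T := by
    simp only [T, ofPred_forall]
    exact MeasurableSet.iInter fun j =>
      measurableSet_lt measurable_const (measurable_subtype_coe.comp (measurable_pi_apply j))
  refine ⟨ENNReal.ofReal (G c) • ((m : Measure (Fin n → I)).restrict T).map
    (fun t j => -Real.log (t j : ℝ)), ?_, ?_, fun x hx => ?_⟩
  · have : IsFiniteMeasure (((m : Measure (Fin n → I)).restrict T).map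
      (fun t j => -Real.log (t j : ℝ))) := Measure.isFiniteMeasure_map _ _
    exact Measure.smul_finite _ ENNReal.ofReal_ne_top
  · refine Measure.ae_smul_measure ?_ _
    rw [ae_map_iff hmeas.aemeasurable]
    · exact Eventually.of_forall fun t j => by
        have := Real.log_nonpos (t j).2.1 (t j).2.2
        linarith
    · simp only [ofPred_forall]
      exact MeasurableSet.iInter fun j => measurableSet_le measurable_const (measurable_pi_apply j)
  · rw [integral_smul_measure, integral_map hmeas.aemeasurable]
    swap
    · exact (by fun_prop : Measurable fun p : Fin n → ℝ =>
        Real.exp (-∑ j, p j * (x j - c j))).aestronglyMeasurable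
    have hs := congrFun hm fun j => ⟨x j - c j, (sub_pos.2 (hx j)).le⟩
    have hx' : (c + fun j => x j - c j) = x := by ext j; simp
    simp only [a] at hs
    erw [hx'] at hs
    have h1 : ∫ t in T, Real.exp (-∑ j, -Real.log (t j : ℝ) * (x j - c j)) ∂(m : Measure (Fin n → I))
        = (G c)⁻¹ * G x := by
      have h2 : ∫ t in T, cubeChar t (fun j => ⟨x j - c j, (sub_pos.2 (hx j)).le⟩)
          ∂(m : Measure (Fin n → I)) =
          ∫ t, cubeChar t (fun j => ⟨x j - c j, (sub_pos.2 (hx j)).le⟩) ∂(m : Measure (Fin n → I)) := by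
        refine setIntegral_eq_integral_of_forall_compl_eq_zero fun t ht => ?_
        simp only [T, mem_ofPred_eq, not_forall, not_lt] at ht
        obtain ⟨j, hj⟩ := ht
        refine Finset.prod_eq_zero (Finset.mem_univ j) ?_
        rw [le_antisymm hj (t j).2.1]
        exact Real.zero_rpow (sub_pos.2 (hx j)).ne'
      rw [← hs, ← h2]
      refine setIntegral_congr_fun hT fun t ht => ?_
      simp only [cubeChar]
      rw [← Finset.sum_neg_distrib, Real.exp_sum]
      refine Finset.prod_congr rfl fun j _ => ?_
      rw [Real.rpow_def_of_pos (ht j)]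
      congr 1
      change -(-Real.log (t j : ℝ) * (x j - c j)) = Real.log (t j : ℝ) * (x j - c j)
      ring
    rw [h1, ENNReal.toReal_ofReal h0.le, smul_eq_mul, mul_inv_cancel_left₀ h0.ne']

end Bernstein

/-! ### Smoothness and derivative signs of Laplace transforms -/

section Laplace

variable {n : ℕ}

/-- The kernel of the Laplace transform, with exponent measured from the vertex `c`. -/
noncomputable def laplaceKernel (c p x : Fin n → ℝ) : ℝ :=
  Real.exp (-∑ j, p j * (x j - c j))

/-- The measure `μ` has a Laplace transform in the interior of the cone with vertex `c`. -/
def HasLaplace (c : Fin n → ℝ) (μ : Measure (Fin n → ℝ)) : Prop :=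
  (∀ᵐ p ∂μ, ∀ j, 0 ≤ p j) ∧
    ∀ x, (∀ j, c j < x j) → Integrable (fun p => laplaceKernel c p x) μ

/-- The Laplace transform of `μ`. -/
noncomputable def laplace (c : Fin n → ℝ) (μ : Measure (Fin n → ℝ)) (x : Fin n → ℝ) : ℝ :=
  ∫ p, laplaceKernel c p x ∂μ

/-- The measure `p j • dμ(p)`. -/
noncomputable def coordMeasure (μ : Measure (Fin n → ℝ)) (j : Fin n) : Measure (Fin n → ℝ) :=
  μ.withDensity fun p => ((p j).toNNReal : ℝ≥0∞)

variable {c : Fin n → ℝ} {μ : Measure (Fin n → ℝ)}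

lemma laplaceKernel_pos (c p x : Fin n → ℝ) : 0 < laplaceKernel c p x := Real.exp_pos _

@[fun_prop]
lemma measurable_laplaceKernel (c x : Fin n → ℝ) : Measurable fun p => laplaceKernel c p x := by
  unfold laplaceKernel
  fun_prop

lemma laplaceKernel_anti {p x y : Fin n → ℝ} (hp : ∀ j, 0 ≤ p j) (hxy : x ≤ y) :
    laplaceKernel c p y ≤ laplaceKernel c p x := by
  refine Real.exp_le_exp.2 (neg_le_neg (Finset.sum_le_sum fun j _ => ?_))
  exact mul_le_mul_of_nonneg_left (by linarith [hxy j]) (hp j)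

/-- Moving x back by δ in direction j stays in the open cone and multiplies the kernel by exp (p j
δ) ≥ p j δ. -/
lemma HasLaplace.integrable_coord (h : HasLaplace c μ) (j : Fin n) {x : Fin n → ℝ}
    (hx : ∀ j, c j < x j) : Integrable (fun p => p j * laplaceKernel c p x) μ := by
  set δ := (x j - c j) / 2
  have hδ : 0 < δ := half_pos (sub_pos.2 (hx j))
  have hx' : ∀ i, c i < (x - Pi.single j δ : Fin n → ℝ) i := by
    intro i
    rcases eq_or_ne i j with rfl | hij
    · simp only [Pi.sub_apply, Pi.single_eq_same, δ]
      linarith [hx i]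
    · simpa [hij] using hx i
  refine ((h.2 _ hx').const_mul δ⁻¹).mono' (by fun_prop) ?_
  filter_upwards [h.1] with p hp
  rw [Real.norm_of_nonneg (mul_nonneg (hp j) (laplaceKernel_pos _ _ _).le)]
  have h1 : laplaceKernel c p (x - Pi.single j δ) = Real.exp (p j * δ) * laplaceKernel c p x := by
    unfold laplaceKernel
    rw [← Real.exp_add]
    congr 1
    have : ∑ i, p i * ((x - Pi.single j δ : Fin n → ℝ) i - c i) =
        ∑ i, p i * (x i - c i) - p j * δ := by
      have h2 : ∀ i, p i * ((x - Pi.single j δ : Fin n → ℝ) i - c i) =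
          p i * (x i - c i) - if i = j then p j * δ else 0 := by
        intro i
        rcases eq_or_ne i j with rfl | hij
        · simp
          ring
        · simp [hij]
      rw [Finset.sum_congr rfl fun i _ => h2 i, Finset.sum_sub_distrib]
      simp
    rw [this]
    ring
  rw [h1, ← mul_assoc]
  refine mul_le_mul_of_nonneg_right ?_ (laplaceKernel_pos _ _ _).le
  rw [← div_eq_inv_mul, le_div_iff₀ hδ]
  linarith [Real.add_one_le_exp (p j * δ)]

lemma HasLaplace.coordMeasure (h : HasLaplace c μ) (j : Fin n) :
    HasLaplace c (coordMeasure μ j) := by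
  refine ⟨(withDensity_absolutelyContinuous _ _).ae_le h.1, fun x hx => ?_⟩
  unfold Hyperbolic.coordMeasure
  rw [integrable_withDensity_iff_integrable_smul (by fun_prop)]
  refine (h.integrable_coord j hx).congr ?_
  filter_upwards [h.1] with p hp
  simp [NNReal.smul_def, hp j]

lemma HasLaplace.laplace_coordMeasure (h : HasLaplace c μ) (j : Fin n) (x : Fin n → ℝ) :
    laplace c (Hyperbolic.coordMeasure μ j) x = ∫ p, p j * laplaceKernel c p x ∂μ := by
  unfold Hyperbolic.coordMeasure laplace
  rw [integral_withDensity_eq_integral_smul (by fun_prop)]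
  refine integral_congr_ae ?_
  filter_upwards [h.1] with p hp
  simp [NNReal.smul_def, hp j]

lemma isOpen_cone (c : Fin n → ℝ) : IsOpen {x : Fin n → ℝ | ∀ j, c j < x j} := by
  simp only [ofPred_forall]
  exact isOpen_iInter_of_finite fun j => isOpen_lt continuous_const (continuous_apply j)

/-- Differentiation under the integral. The midpoint z between c and x gives the dominating
function, since the kernel decreases on the cone above z. -/
lemma HasLaplace.hasFDerivAt (h : HasLaplace c μ) {x : Fin n → ℝ} (hx : ∀ j, c j < x j) :
    HasFDerivAt (laplace c μ)
      (∑ j, (-laplace c (Hyperbolic.coordMeasure μ j) x) •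
        (ContinuousLinearMap.proj j : (Fin n → ℝ) →L[ℝ] ℝ)) x := by
  set z : Fin n → ℝ := fun j => (x j + c j) / 2
  have hz : ∀ j, c j < z j := fun j => by simp only [z]; linarith [hx j]
  have hzx : ∀ j, z j < x j := fun j => by simp only [z]; linarith [hx j]
  have key := hasFDerivAt_integral_of_dominated_of_fderiv_le (μ := μ) (𝕜 := ℝ)
    (F := fun y p => laplaceKernel c p y)
    (F' := fun y p => ∑ j, (-(p j * laplaceKernel c p y)) •
      (ContinuousLinearMap.proj j : (Fin n → ℝ) →L[ℝ] ℝ))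
    (bound := fun p => ∑ j, p j * laplaceKernel c p z)
    ((isOpen_cone z).mem_nhds hzx)
    (Eventually.of_forall fun y => (measurable_laplaceKernel c y).aestronglyMeasurable) (h.2 x hx)
    ?_ ?_ (integrable_finsetSum _ fun j _ => h.integrable_coord j hz) ?_
  · refine key.congr_fderiv ?_
    rw [integral_finsetSum]
    · refine Finset.sum_congr rfl fun j _ => ?_
      rw [integral_smul_const, integral_neg, h.laplace_coordMeasure]
    · exact fun j _ => ((h.integrable_coord j hx).neg).smul_const _
  · refine Finset.aestronglyMeasurable_fun_sum _ fun j _ => ?_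
    exact ((h.integrable_coord j hx).neg.smul_const _).aestronglyMeasurable
  · filter_upwards [h.1] with p hp y hy
    refine (norm_sum_le _ _).trans (Finset.sum_le_sum fun j _ => ?_)
    rw [norm_smul, norm_neg, Real.norm_of_nonneg (mul_nonneg (hp j) (laplaceKernel_pos _ _ _).le)]
    have h1 : ‖(ContinuousLinearMap.proj j : (Fin n → ℝ) →L[ℝ] ℝ)‖ ≤ 1 :=
      ContinuousLinearMap.opNorm_le_bound _ zero_le_one fun v => by
        simpa using norm_le_pi_norm v j
    have h2 := laplaceKernel_anti (c := c) hp (x := z) (y := y) fun j => (hy j).le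
    have h3 := mul_le_mul_of_nonneg_left h2 (hp j)
    have h4 := mul_nonneg (hp j) (laplaceKernel_pos c p y).le
    nlinarith
  · refine Eventually.of_forall fun p y _ => ?_
    have h1 : HasFDerivAt (fun y : Fin n → ℝ => -∑ j, p j * (y j - c j))
        (-∑ j, p j • (ContinuousLinearMap.proj j : (Fin n → ℝ) →L[ℝ] ℝ)) y := by
      refine HasFDerivAt.neg (HasFDerivAt.fun_sum fun j _ => ?_)
      exact ((hasFDerivAt_apply j y).sub_const _).const_mul _
    refine h1.exp.congr_fderiv ?_
    ext v
    simp only [laplaceKernel, smul_apply, neg_apply, sum_apply, ContinuousLinearMap.proj_apply,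
      smul_eq_mul, mul_neg, Finset.mul_sum, ← Finset.sum_neg_distrib]
    exact Finset.sum_congr rfl fun j _ => by ring

lemma HasLaplace.fderiv_eventuallyEq (h : HasLaplace c μ) {x : Fin n → ℝ} (hx : ∀ j, c j < x j) :
    fderiv ℝ (laplace c μ) =ᶠ[𝓝 x] fun y => ∑ j, (-laplace c (Hyperbolic.coordMeasure μ j) y) •
        (ContinuousLinearMap.proj j : (Fin n → ℝ) →L[ℝ] ℝ) := by
  filter_upwards [(isOpen_cone c).mem_nhds hx] with y hy
  exact (h.hasFDerivAt hy).fderiv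

lemma HasLaplace.contDiffOn_nat (h : HasLaplace c μ) (k : ℕ) :
    ContDiffOn ℝ k (laplace c μ) {x | ∀ j, c j < x j} := by
  induction k generalizing μ with
  | zero =>
    exact contDiffOn_zero.2 fun x hx => (h.hasFDerivAt hx).continuousAt.continuousWithinAt
  | succ k ih =>
    push_cast
    rw [contDiffOn_succ_iff_fderiv_of_isOpen (isOpen_cone c)]
    refine ⟨fun x hx => (h.hasFDerivAt hx).differentiableAt.differentiableWithinAt, by simp, ?_⟩
    refine ContDiffOn.congr (f := fun y => ∑ j, (-laplace c (Hyperbolic.coordMeasure μ j) y) •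
        (ContinuousLinearMap.proj j : (Fin n → ℝ) →L[ℝ] ℝ)) ?_
        fun x hx => (h.hasFDerivAt hx).fderiv
    exact ContDiffOn.sum fun j _ => (ih (h.coordMeasure j)).neg.smul contDiffOn_const

lemma HasLaplace.contDiffOn (h : HasLaplace c μ) :
    ContDiffOn ℝ (⊤ : ℕ∞) (laplace c μ) {x | ∀ j, c j < x j} :=
  contDiffOn_infty.2 h.contDiffOn_nat

/-- A partial derivative of a Laplace transform is minus the transform of the nonnegative measure p
j • dμ; each order of differentiation costs one sign. -/
lemma HasLaplace.iteratedFDeriv_sign (h : HasLaplace c μ) (k : ℕ) (i : Fin k → Fin n)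
    {x : Fin n → ℝ} (hx : ∀ j, c j < x j) :
    0 ≤ (-1 : ℝ) ^ k * iteratedFDeriv ℝ k (laplace c μ) x (fun l => Pi.single (i l) 1) := by
  induction k generalizing μ with
  | zero =>
    simpa [laplace] using integral_nonneg (μ := μ) fun p => (laplaceKernel_pos c p x).le
  | succ k ih =>
    set j := i (Fin.last k)
    have hcd : ContDiffAt ℝ k (fderiv ℝ (laplace c μ)) x :=
      ((h.contDiffOn_nat (k + 1)).contDiffAt ((isOpen_cone c).mem_nhds hx)).fderiv_right
        (by norm_cast)
    have h1 := ContinuousLinearMap.iteratedFDeriv_comp_left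
      (ContinuousLinearMap.apply ℝ ℝ (Pi.single j 1 : Fin n → ℝ)) hcd le_rfl
    have h2 : (ContinuousLinearMap.apply ℝ ℝ (Pi.single j 1 : Fin n → ℝ)) ∘
        fderiv ℝ (laplace c μ) =ᶠ[𝓝 x] -laplace c (Hyperbolic.coordMeasure μ j) := by
      filter_upwards [h.fderiv_eventuallyEq hx] with y hy
      simp [hy, Pi.single_apply]
    have h3 := (EventuallyEq.iteratedFDeriv ℝ h2 k).eq_of_nhds
    rw [h1, iteratedFDeriv_neg_apply] at h3
    have h4 := congrArg (fun T => T fun l : Fin k => (Pi.single (i l.castSucc) 1 : Fin n → ℝ)) h3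
    simp only [ContinuousLinearMap.compContinuousMultilinearMap_coe, Function.comp_apply,
      ContinuousLinearMap.apply_apply, neg_apply] at h4
    rw [iteratedFDeriv_succ_apply_right]
    have h5 := ih (h.coordMeasure j) fun l => i l.castSucc
    have h6 : (Fin.init fun l : Fin (k + 1) => (Pi.single (i l) 1 : Fin n → ℝ)) =
        fun l : Fin k => (Pi.single (i l.castSucc) 1 : Fin n → ℝ) := rfl
    rw [h6, h4, pow_succ]
    linarith

lemma CMOn.exists_hasLaplace {G : (Fin n → ℝ) → ℝ} (hG : CMOn (Ici c) G) :
    ∃ μ : Measure (Fin n → ℝ), IsFiniteMeasure μ ∧ HasLaplace c μ ∧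
      ∀ x, (∀ j, c j < x j) → G x = laplace c μ x := by
  obtain ⟨μ, hfin, hpos, hμ⟩ := hG.exists_measure
  refine ⟨μ, hfin, ⟨hpos, fun x hx => ?_⟩, hμ⟩
  refine (integrable_const (1 : ℝ)).mono' (by fun_prop) ?_
  filter_upwards [hpos] with p hp
  rw [Real.norm_of_nonneg (laplaceKernel_pos _ _ _).le]
  refine Real.exp_le_one_iff.2 (neg_nonpos.2 (Finset.sum_nonneg fun j _ => ?_))
  exact mul_nonneg (hp j) (sub_pos.2 (hx j)).le

/-- Smoothness and signs are local questions, and the cone with vertex x / 2 lies in the domain and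
has x in its interior. -/
lemma CMOn.isMultiCM {G : (Fin n → ℝ) → ℝ} (hG : CMOn {x : Fin n → ℝ | ∀ j, 0 < x j} G) :
    IsMultiCM G := by
  have key : ∀ x : Fin n → ℝ, (∀ j, 0 < x j) → ∃ c μ, (∀ j, c j < x j) ∧ HasLaplace c μ ∧
      G =ᶠ[𝓝 x] laplace c μ := by
    intro x hx
    have hc : ∀ j, (x / 2 : Fin n → ℝ) j < x j := fun j => by
      have := hx j
      simp only [Pi.div_apply, Pi.ofNat_apply]
      linarith
    have hsub : Ici (x / 2) ⊆ {x : Fin n → ℝ | ∀ j, 0 < x j} := fun y hy j => by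
      have h1 := hx j
      have h2 := hy j
      simp only [Pi.div_apply, Pi.ofNat_apply] at h2
      linarith
    obtain ⟨μ, -, hμ, hGμ⟩ := (hG.mono hsub).exists_hasLaplace
    refine ⟨x / 2, μ, hc, hμ, ?_⟩
    filter_upwards [(isOpen_cone (x / 2)).mem_nhds hc] with y hy using hGμ y hy
  refine ⟨fun x hx => ?_, fun k i x hx => ?_⟩
  · obtain ⟨c, μ, hc, hμ, he⟩ := key x hx
    exact ((hμ.contDiffOn.contDiffAt ((isOpen_cone c).mem_nhds hc)).congr_of_eventuallyEq
      he).contDiffWithinAt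
  · obtain ⟨c, μ, hc, hμ, he⟩ := key x hx
    rw [(EventuallyEq.iteratedFDeriv ℝ he k).eq_of_nhds]
    exact hμ.iteratedFDeriv_sign k i hc

/-- Bernstein's theorem on a half-line, with the Laplace transform written as a moment generating
function. -/
lemma CMOn.exists_mgf {g : ℝ → ℝ} {c : ℝ} (hg : CMOn (Ici c) g) :
    ∃ μ : Measure (Fin 1 → ℝ), IsFiniteMeasure μ ∧ (∀ᵐ p ∂μ, 0 ≤ p 0) ∧
      Ioi 0 ⊆ interior (integrableExpSet (fun p : Fin 1 → ℝ => -p 0) μ) ∧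
      ∀ x, c < x → g x = mgf (fun p : Fin 1 → ℝ => -p 0) μ (x - c) := by
  obtain ⟨μ, hfin, hpos, hμ⟩ := (hg.comp (S := Ici fun _ : Fin 1 => c)
    (A := fun x : Fin 1 → ℝ => x 0) (L := fun x => x 0) (fun x h => rfl) (fun h (hh : ∀ j, 0 ≤ h j) => hh 0)
    fun x hx => hx 0).exists_measure
  have hpos' : ∀ᵐ p ∂μ, 0 ≤ p 0 := hpos.mono fun p hp => hp 0
  refine ⟨μ, hfin, hpos', ?_, fun x hx => ?_⟩
  · refine interior_maximal (fun t ht => ?_) isOpen_Ioi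
    refine (integrable_const (1 : ℝ)).mono'
      (by fun_prop : Measurable fun p : Fin 1 → ℝ => Real.exp (t * -p 0)).aestronglyMeasurable ?_
    filter_upwards [hpos'] with p hp
    rw [Real.norm_of_nonneg (Real.exp_pos _).le]
    refine Real.exp_le_one_iff.2 ?_
    have := mul_nonneg (le_of_lt (show (0 : ℝ) < t from ht)) hp
    linarith
  · rw [show g x = g ((fun _ : Fin 1 => x) 0) from rfl, hμ (fun _ => x) fun _ => hx]
    refine integral_congr_ae (Eventually.of_forall fun p => ?_)
    simp only [Finset.univ_unique, Fin.default_eq_zero, Finset.sum_singleton]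
    congr 1
    ring

lemma CMOn.isCM {g : ℝ → ℝ} (hg : CMOn (Ioi 0) g) : IsCM g := by
  have key : ∀ x : ℝ, 0 < x → ∃ μ : Measure (Fin 1 → ℝ), IsFiniteMeasure μ ∧ (∀ᵐ p ∂μ, 0 ≤ p 0) ∧
      x - x / 2 ∈ interior (integrableExpSet (fun p : Fin 1 → ℝ => -p 0) μ) ∧
      g =ᶠ[𝓝 x] fun y => mgf (fun p : Fin 1 → ℝ => -p 0) μ (y - x / 2) := by
    intro x hx
    obtain ⟨μ, hfin, hpos, hint, hμ⟩ := (hg.mono (S' := Ici (x / 2))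
      fun y hy => (half_pos hx).trans_le hy).exists_mgf
    refine ⟨μ, hfin, hpos, hint (by simp only [mem_Ioi]; linarith), ?_⟩
    filter_upwards [Ioi_mem_nhds (half_lt_self hx)] with y hy using hμ y hy
  refine ⟨fun x hx => ?_, fun k x hx => ?_⟩
  · obtain ⟨μ, hfin, hpos, hint, he⟩ := key x hx
    have h1 : ContDiffAt ℝ (⊤ : ℕ∞) (fun y => mgf (fun p : Fin 1 → ℝ => -p 0) μ (y - x / 2)) x :=
      ContDiffAt.comp (g := mgf (fun p : Fin 1 → ℝ => -p 0) μ) x (analyticAt_mgf hint).contDiffAt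
        (contDiffAt_id.sub contDiffAt_const)
    exact (h1.congr_of_eventuallyEq he).contDiffWithinAt
  · obtain ⟨μ, hfin, hpos, hint, he⟩ := key x hx
    rw [(he.iteratedDeriv k).eq_of_nhds, iteratedDeriv_comp_sub_const]
    beta_reduce
    rw [iteratedDeriv_mgf hint, ← integral_const_mul]
    refine integral_nonneg_of_ae (hpos.mono fun p hp => ?_)
    have : (-1 : ℝ) ^ k * (-p 0) ^ k = p 0 ^ k := by rw [← mul_pow]; simp
    simp only [Pi.zero_apply]
    rw [← mul_assoc, this]
    positivity

end Laplace

/-! ### Measurable midpoint concave functions -/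

section MidpointConcave

variable {φ : ℝ → ℝ}

/-- The sets where φ < -k near s₀ shrink to the empty set, so one has measure below 1. Its two
preimages under t ↦ s + t and t ↦ s - t cannot cover [-1, 1], of length 2; a t outside both bounds φ
s below. -/
lemma exists_lower_bound_of_midpoint_concave (hm : Measurable φ)
    (h : ∀ s t, φ (s + t) + φ (s - t) ≤ 2 * φ s) (s₀ : ℝ) :
    ∃ M, ∀ s, |s - s₀| ≤ 1 → -M ≤ φ s := by
  let N : ℕ → Set ℝ := fun k => {x | φ x < -k} ∩ Icc (s₀ - 2) (s₀ + 2)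
  have hNm : ∀ k, MeasurableSet (N k) := fun k =>
    (measurableSet_lt hm measurable_const).inter measurableSet_Icc
  have hanti : Antitone N := fun k l hkl x hx => by
    have : (k : ℝ) ≤ l := by exact_mod_cast hkl
    have h1 : φ x < -l := hx.1
    exact ⟨show φ x < -k by linarith, hx.2⟩
  have hempty : ⋂ k, N k = ∅ := by
    refine eq_empty_of_forall_notMem fun x hx => ?_
    obtain ⟨k, hk⟩ := exists_nat_gt (-φ x)
    have : φ x < -k := (mem_iInter.1 hx k).1
    linarith
  have hlim := tendsto_measure_iInter_atTop (μ := volume) (fun k => (hNm k).nullMeasurableSet)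
    hanti ⟨0, ((measure_mono inter_subset_right).trans_lt measure_Icc_lt_top).ne⟩
  rw [hempty, measure_empty] at hlim
  obtain ⟨k, hk⟩ := (hlim.eventually (gt_mem_nhds zero_lt_one)).exists
  refine ⟨k, fun s hs => ?_⟩
  have h1 : volume ((fun t => s + t) ⁻¹' N k) = volume (N k) := measure_preimage_add _ _ _
  have h2 : volume ((fun t => s - t) ⁻¹' N k) = volume (N k) := by
    have := (Measure.measurePreserving_sub_left volume s).measure_preimage (hNm k).nullMeasurableSet
    exact this
  have hns : ¬ Icc (-1 : ℝ) 1 ⊆ ((fun t => s + t) ⁻¹' N k) ∪ ((fun t => s - t) ⁻¹' N k) := by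
    intro hsub
    have h3 := (measure_mono (μ := volume) hsub).trans (measure_union_le _ _)
    rw [h1, h2, Real.volume_Icc] at h3
    have h4 : volume (N k) + volume (N k) < 1 + 1 := ENNReal.add_lt_add hk hk
    have h5 : ENNReal.ofReal (1 - -1) = 1 + 1 := by
      rw [← ENNReal.ofReal_one, ← ENNReal.ofReal_add zero_le_one zero_le_one]
      norm_num
    rw [h5] at h3
    exact absurd h4 (not_lt.2 h3)
  obtain ⟨t, ht, hnt⟩ := not_subset.1 hns
  rw [abs_le] at hs
  simp only [N, mem_union, mem_preimage, mem_inter_iff, mem_ofPred_eq, mem_Icc, not_or] at hnt ht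
  have ha : -(k : ℝ) ≤ φ (s + t) := by
    by_contra hcon
    exact hnt.1 ⟨not_le.1 hcon, by linarith [ht.1], by linarith [ht.2]⟩
  have hb : -(k : ℝ) ≤ φ (s - t) := by
    by_contra hcon
    exact hnt.2 ⟨not_le.1 hcon, by linarith [ht.2], by linarith [ht.1]⟩
  linarith [h s t]

/-- A measurable midpoint concave function on the line is continuous. -/
lemma continuous_of_midpoint_concave (hm : Measurable φ)
    (h : ∀ s t, φ (s + t) + φ (s - t) ≤ 2 * φ s) : Continuous φ := by
  refine continuous_iff_continuousAt.2 fun s₀ => ?_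
  obtain ⟨M, hM⟩ := exists_lower_bound_of_midpoint_concave hm h s₀
  set B := M + |φ s₀|
  -- The midpoint inequality at s₀ + δ compares the increment for δ with half of the increment for
  -- 2δ, so the lower bound halves with the scale.
  have hlow : ∀ k : ℕ, ∀ δ : ℝ, |δ| ≤ (1 / 2) ^ k → -(B * (1 / 2) ^ k) ≤ φ (s₀ + δ) - φ s₀ := by
    intro k
    induction k with
    | zero =>
      intro δ hδ
      have := hM (s₀ + δ) (by simpa using hδ)
      have := le_abs_self (φ s₀)
      simp only [B, pow_zero, mul_one]
      linarith
    | succ k ih =>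
      intro δ hδ
      have h1 := ih (2 * δ) (by rw [abs_mul, abs_two]; rw [pow_succ] at hδ; linarith)
      have h2 := h (s₀ + δ) δ
      rw [add_sub_cancel_right, show s₀ + δ + δ = s₀ + 2 * δ by ring] at h2
      rw [pow_succ]
      linarith
  rw [Metric.continuousAt_iff]
  intro ε hε
  have hlim : Tendsto (fun k : ℕ => B * (1 / 2 : ℝ) ^ k) atTop (𝓝 0) := by
    simpa using (tendsto_pow_atTop_nhds_zero_of_lt_one (r := (1 / 2 : ℝ)) (by norm_num)
      (by norm_num)).const_mul B
  obtain ⟨k, hk⟩ := (hlim.eventually (gt_mem_nhds hε)).exists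
  refine ⟨(1 / 2) ^ k, by positivity, fun {s} hs => ?_⟩
  rw [Real.dist_eq] at hs ⊢
  have h1 := hlow k (s - s₀) hs.le
  have h2 := hlow k (-(s - s₀)) (by rw [abs_neg]; exact hs.le)
  have h3 := h s₀ (s - s₀)
  rw [← sub_eq_add_neg] at h2
  rw [add_sub_cancel] at h1 h3
  rw [abs_lt]
  constructor <;> linarith

/-- A measurable midpoint concave function on the line is concave. -/
lemma concaveOn_of_midpoint_concave (hm : Measurable φ)
    (h : ∀ s t, φ (s + t) + φ (s - t) ≤ 2 * φ s) : ConcaveOn ℝ univ φ := by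
  have hc := continuous_of_midpoint_concave hm h
  refine ⟨convex_univ, fun x _ y _ a b ha hb hab => ?_⟩
  let g : ℝ → ℝ := fun t => φ (x + t * (y - x)) - (φ x + t * (φ y - φ x))
  have hg : Continuous g := by fun_prop
  obtain ⟨t₀, ht₀, hmin⟩ := isCompact_Icc.exists_isMinOn (nonempty_Icc.2 zero_le_one)
    (hg.continuousOn (s := Icc (0 : ℝ) 1))
  have hmid : ∀ t d, g (t + d) + g (t - d) ≤ 2 * g t := fun t d => by
    have := h (x + t * (y - x)) (d * (y - x))
    simp only [g]
    rw [show x + (t + d) * (y - x) = x + t * (y - x) + d * (y - x) by ring,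
      show x + (t - d) * (y - x) = x + t * (y - x) - d * (y - x) by ring]
    linarith
  have g0 : g 0 = 0 := by simp [g]
  have g1 : g 1 = 0 := by simp [g]
  -- Reflecting the nearer endpoint in the minimizer t₀ stays in [0, 1]. As g vanishes at the
  -- endpoint, the midpoint inequality forces g t₀ ≥ 0.
  have hpos : 0 ≤ g t₀ := by
    rcases le_total t₀ (1 / 2) with h2 | h2
    · have h3 := hmid t₀ t₀
      rw [sub_self, g0] at h3
      have h4 := hmin (show t₀ + t₀ ∈ Icc (0 : ℝ) 1 from
        ⟨by linarith [ht₀.1], by linarith⟩)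
      simp only [mem_ofPred_eq] at h4
      linarith
    · have h3 := hmid t₀ (1 - t₀)
      rw [add_sub_cancel, g1] at h3
      have h4 := hmin (show t₀ - (1 - t₀) ∈ Icc (0 : ℝ) 1 from
        ⟨by linarith, by linarith [ht₀.2]⟩)
      simp only [mem_ofPred_eq] at h4
      linarith
  have hb1 : b ∈ Icc (0 : ℝ) 1 := ⟨hb, by linarith⟩
  have := hpos.trans (hmin hb1)
  simp only [g] at this
  have ha' : a = 1 - b := by linarith
  subst ha'
  simp only [smul_eq_mul]
  rw [show (1 - b) * x + b * y = x + b * (y - x) by ring]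
  linarith

end MidpointConcave

/-! ### Integrability of every section of a log-concave density -/

section Sections

lemma lintegral_Ioi_eq_lintegral_exp (g : ℝ → ℝ≥0∞) :
    ∫⁻ y in Ioi 0, g y = ∫⁻ b, ENNReal.ofReal (Real.exp b) * g (Real.exp b) := by
  have := lintegral_image_eq_lintegral_abs_deriv_mul (s := univ) (f := Real.exp) (f' := Real.exp)
    MeasurableSet.univ (fun x _ => (Real.hasDerivAt_exp x).hasDerivWithinAt)
    Real.exp_injective.injOn g
  rw [image_univ, Real.range_exp] at this
  simpa [abs_of_pos, Real.exp_pos] using this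

/-- A concave function which decreases strictly somewhere on both sides of the origin has an
integrable exponential. -/
lemma lintegral_exp_lt_top_of_concave {φ : ℝ → ℝ} (hc : Continuous φ) (h : ConcaveOn ℝ univ φ)
    {a b : ℝ} (ha : 0 < a) (hb : 0 < b) (hφa : φ a < φ 0) (hφb : φ (-b) < φ 0) :
    ∫⁻ x, ENNReal.ofReal (Real.exp (φ x)) < ⊤ := by
  have hright : ∀ x, a ≤ x → φ x ≤ φ 0 + (φ a - φ 0) / a * x := by
    intro x hx
    have hx0 : 0 < x := ha.trans_le hx
    have h1 : (1 - a / x) • φ 0 + (a / x) • φ x ≤ φ ((1 - a / x) • 0 + (a / x) • x) :=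
      h.2 (mem_univ 0) (mem_univ x) (by rw [sub_nonneg, div_le_one hx0]; exact hx)
        (by positivity) (by ring)
    simp only [smul_eq_mul, mul_zero, zero_add, div_mul_cancel₀ _ hx0.ne'] at h1
    have h2 : (φ a - φ 0) / a * x = (φ a - φ 0) / (a / x) := by field_simp
    rw [h2, ← sub_le_iff_le_add', le_div_iff₀ (by positivity)]
    linarith
  have hleft : ∀ x, x ≤ -b → φ x ≤ φ 0 + (φ 0 - φ (-b)) / b * x := by
    intro x hx
    have hx0 : 0 < -x := by linarith
    have h1 : (1 - b / -x) • φ 0 + (b / -x) • φ x ≤ φ ((1 - b / -x) • 0 + (b / -x) • x) :=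
      h.2 (mem_univ 0) (mem_univ x) (by rw [sub_nonneg, div_le_one hx0]; linarith)
        (by positivity) (by ring)
    have h3 : b / -x * x = -b := by field_simp [(by linarith : x ≠ 0)]
    simp only [smul_eq_mul, mul_zero, zero_add, h3] at h1
    have h2 : (φ 0 - φ (-b)) / b * x = (φ (-b) - φ 0) / (b / -x) := by
      have : x ≠ 0 := by linarith
      field_simp
      ring
    rw [h2, ← sub_le_iff_le_add', le_div_iff₀ (by positivity)]
    linarith
  have hmid : IntegrableOn (fun x => Real.exp (φ x)) (Icc (-b) a) :=
    (Real.continuous_exp.comp hc).continuousOn.integrableOn_Icc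
  have hI : IntegrableOn (fun x => Real.exp (φ x)) (Ioi a) := by
    refine ((integrableOn_exp_mul_Ioi (a := (φ a - φ 0) / a)
      (div_neg_of_neg_of_pos (by linarith) ha) a).const_mul (Real.exp (φ 0))).mono'
      (Real.continuous_exp.comp hc).aestronglyMeasurable ?_
    filter_upwards [ae_restrict_mem measurableSet_Ioi] with x hx
    rw [Real.norm_of_nonneg (Real.exp_pos _).le, ← Real.exp_add]
    exact Real.exp_le_exp.2 (hright x (le_of_lt hx))
  have hJ : IntegrableOn (fun x => Real.exp (φ x)) (Iic (-b)) := by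
    refine ((integrableOn_exp_mul_Iic (a := (φ 0 - φ (-b)) / b)
      (div_pos (by linarith) hb) (-b)).const_mul (Real.exp (φ 0))).mono'
      (Real.continuous_exp.comp hc).aestronglyMeasurable ?_
    filter_upwards [ae_restrict_mem measurableSet_Iic] with x hx
    rw [Real.norm_of_nonneg (Real.exp_pos _).le, ← Real.exp_add]
    exact Real.exp_le_exp.2 (hleft x hx)
  have hall : IntegrableOn (fun x => Real.exp (φ x)) univ := by
    refine ((hJ.union hmid).union hI).mono_set fun x _ => ?_
    rcases le_or_gt x (-b) with h1 | h1
    · exact Or.inl (Or.inl h1)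
    rcases le_or_gt x a with h2 | h2
    · exact Or.inl (Or.inr ⟨h1.le, h2⟩)
    · exact Or.inr h2
  rw [integrableOn_univ] at hall
  exact hall.lintegral_lt_top

/-- Midpoint log-concavity with respect to the multiplicative structure of `(0, ∞)²`. -/
def IsMulLogConcave (h : ℝ × ℝ → ℝ) : Prop :=
  ∀ u₁ u₂ v₁ v₂, 0 < u₁ → 0 < u₂ → 0 < v₁ → 0 < v₂ →
    h (u₁ * v₁, u₂ * v₂) * h (u₁ / v₁, u₂ / v₂) ≤ h (u₁, u₂) ^ 2

variable {h : ℝ × ℝ → ℝ}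

/-- The added linear term is the logarithm of the Jacobian of y = e^s; it does not affect concavity.
-/
lemma log_section_midpoint_concave (hpos : ∀ x y, 0 < x → 0 < y → 0 < h (x, y))
    (hc : IsMulLogConcave h) {x : ℝ} (hx : 0 < x) (s t : ℝ) :
    (Real.log (h (x, Real.exp (s + t))) + (s + t)) + (Real.log (h (x, Real.exp (s - t))) + (s - t))
      ≤ 2 * (Real.log (h (x, Real.exp s)) + s) := by
  have h1 := hc x (Real.exp s) 1 (Real.exp t) hx (Real.exp_pos _) one_pos (Real.exp_pos _)
  rw [mul_one, div_one, ← Real.exp_add, ← Real.exp_sub] at h1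
  have p1 := hpos x (Real.exp (s + t)) hx (Real.exp_pos _)
  have p2 := hpos x (Real.exp (s - t)) hx (Real.exp_pos _)
  have h2 := Real.log_le_log (mul_pos p1 p2) h1
  rw [Real.log_mul p1.ne' p2.ne', Real.log_pow] at h2
  push_cast at h2
  linarith

/-- All sections of a measurable integrable log-concave function are integrable. -/
lemma lintegral_section_lt_top (hm : Measurable h) (hpos : ∀ x y, 0 < x → 0 < y → 0 < h (x, y))
    (hc : IsMulLogConcave h) (hfin : ∫⁻ p in Ioi 0 ×ˢ Ioi 0, ENNReal.ofReal (h p) < ⊤)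
    {x : ℝ} (hx : 0 < x) : ∫⁻ y in Ioi 0, ENNReal.ofReal (h (x, y)) < ⊤ := by
  have hsub : ∀ z, 0 < z → ∫⁻ y in Ioi 0, ENNReal.ofReal (h (z, y)) =
      ∫⁻ b, ENNReal.ofReal (Real.exp (Real.log (h (z, Real.exp b)) + b)) := fun z hz => by
    rw [lintegral_Ioi_eq_lintegral_exp]
    refine lintegral_congr fun b => ?_
    rw [Real.exp_add, Real.exp_log (hpos z _ hz (Real.exp_pos b)), mul_comm,
      ENNReal.ofReal_mul (hpos z _ hz (Real.exp_pos b)).le]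
  by_contra hcon
  rw [hsub x hx] at hcon
  set φ : ℝ → ℝ := fun b => Real.log (h (x, Real.exp b)) + b
  have hφm : Measurable φ := by fun_prop
  have hφ := log_section_midpoint_concave hpos hc hx
  have hcont := continuous_of_midpoint_concave hφm hφ
  have hconc := concaveOn_of_midpoint_concave hφm hφ
  -- A concave φ whose exponential has infinite integral cannot fall below φ 0 on both sides of the
  -- origin, so it stays above φ 0 on a half-line. The factor 2 prepares the midpoint taken below.
  have hhalf : ∃ S : Set ℝ, MeasurableSet S ∧ volume S = ⊤ ∧ ∀ b ∈ S, φ 0 ≤ φ (2 * b) := by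
    by_cases hright : ∀ a, 0 < a → φ 0 ≤ φ a
    · exact ⟨Ioi 0, measurableSet_Ioi, Real.volume_Ioi, fun b hb =>
        hright _ (mul_pos two_pos hb)⟩
    · push Not at hright
      obtain ⟨a, ha, hφa⟩ := hright
      refine ⟨Iio 0, measurableSet_Iio, Real.volume_Iio, fun b hb => ?_⟩
      by_contra hb'
      have hb0 : b < 0 := hb
      refine hcon (lintegral_exp_lt_top_of_concave hcont hconc ha (b := -(2 * b))
        (by linarith) hφa ?_)
      rw [neg_neg]
      exact not_le.1 hb'
  obtain ⟨S, hS, hSv, hSφ⟩ := hhalf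
  have hinf : ∀ z, 0 < z → ∫⁻ y in Ioi 0, ENNReal.ofReal (h (z, y)) = ⊤ := by
    intro z hz
    rw [hsub z hz, eq_top_iff]
    set δ := Real.exp ((φ 0 + Real.log (h (z ^ 2 / x, 1))) / 2)
    have hlow : ∀ b ∈ S, δ ≤ Real.exp (Real.log (h (z, Real.exp b)) + b) := by
      intro b hb
      refine Real.exp_le_exp.2 ?_
      -- (z, e^b) is the geometric midpoint of (x, e^(2b)) and (z² / x, 1). A bound below on the
      -- section at x thus passes to every section at z, which contradicts Fubini.
      have h1 := hc z (Real.exp b) (x / z) (Real.exp b) hz (Real.exp_pos _) (by positivity)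
        (Real.exp_pos _)
      rw [mul_div_cancel₀ _ hz.ne', ← Real.exp_add, div_self (Real.exp_pos b).ne',
        show z / (x / z) = z ^ 2 / x by field_simp] at h1
      have p1 := hpos x (Real.exp (b + b)) hx (Real.exp_pos _)
      have p2 := hpos (z ^ 2 / x) 1 (by positivity) one_pos
      have h2 := Real.log_le_log (mul_pos p1 p2) h1
      rw [Real.log_mul p1.ne' p2.ne', Real.log_pow] at h2
      push_cast at h2
      have h3 := hSφ b hb
      simp only [φ, two_mul] at h3 ⊢
      linarith
    calc (⊤ : ℝ≥0∞) = ∫⁻ b in S, ENNReal.ofReal δ := by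
          rw [lintegral_const, Measure.restrict_apply_univ, hSv, ENNReal.mul_top]
          simp [δ, Real.exp_pos]
      _ ≤ ∫⁻ b in S, ENNReal.ofReal (Real.exp (Real.log (h (z, Real.exp b)) + b)) :=
          setLIntegral_mono' hS fun b hb => ENNReal.ofReal_le_ofReal (hlow b hb)
      _ ≤ _ := setLIntegral_le_lintegral _ _
  rw [Measure.volume_eq_prod, ← Measure.prod_restrict,
    lintegral_prod _ (by fun_prop : Measurable fun p : ℝ × ℝ => ENNReal.ofReal (h p)).aemeasurable]
    at hfin
  rw [setLIntegral_congr_fun measurableSet_Ioi fun z hz => hinf z hz] at hfin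
  simp at hfin

end Sections

/-! ### The marginal on the natural domain w ≥ 2 -/

section Marginal

/-- The larger root `v` of the equation `v + 1 / v = w`. -/
noncomputable def jroot (w : ℝ) : ℝ := (w + √(w ^ 2 - 4)) / 2

lemma two_le_add_inv {v : ℝ} (hv : 0 < v) : 2 ≤ v + 1 / v := by
  have : v + 1 / v - 2 = (v - 1) ^ 2 / v := by field_simp; ring
  have h : 0 ≤ (v - 1) ^ 2 / v := by positivity
  linarith

lemma two_lt_add_inv {v : ℝ} (hv : 0 < v) (h1 : v ≠ 1) : 2 < v + 1 / v := by
  have : v + 1 / v - 2 = (v - 1) ^ 2 / v := by field_simp; ring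
  have h2 : v - 1 ≠ 0 := sub_ne_zero.2 h1
  have h : 0 < (v - 1) ^ 2 / v := by positivity
  linarith

lemma jroot_pos {w : ℝ} (hw : 2 ≤ w) : 0 < jroot w := by
  unfold jroot
  positivity

lemma jroot_add_inv {w : ℝ} (hw : 2 ≤ w) : jroot w + 1 / jroot w = w := by
  have h0 := jroot_pos hw
  have h1 : √(w ^ 2 - 4) ^ 2 = w ^ 2 - 4 := Real.sq_sqrt (by nlinarith)
  have h2 : jroot w ^ 2 - w * jroot w + 1 = 0 := by
    unfold jroot
    linear_combination h1 / 4
  field_simp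
  linear_combination h2

/-- The product `f (u v) f (u / v)` is completely monotone in `w = v + 1 / v` on its natural
domain `w ≥ 2`. -/
def IsWeakHCM (f : ℝ → ℝ) : Prop :=
  ∀ u, 0 < u → ∃ F : ℝ → ℝ, CMOn (Ici 2) F ∧ ∀ v, 0 < v → f (u * v) * f (u / v) = F (v + 1 / v)

/-- A weak form of the property `IsBVHCM`, with complete monotonicity required only close to the
natural domain of the variables. -/
def IsWeakBVHCM (h : ℝ × ℝ → ℝ) : Prop :=
  ∀ u₁ u₂, 0 < u₁ → 0 < u₂ → ∃ G : (Fin 3 → ℝ) → ℝ, CMOn (Ici ![1, 2, 2]) G ∧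
    ∀ v₁ v₂, 0 < v₁ → 0 < v₂ → h (u₁ * v₁, u₂ * v₂) * h (u₁ / v₁, u₂ / v₂) =
      G ![v₁ + 1 / v₁, v₂ + 1 / v₂, v₁ / v₂ + v₂ / v₁]

/-- With q = e^(τ/2) the exponent is (a + b/v) q + (a + b v) / q up to sign. A translation in τ
normalizes the coefficient of q to 1 and leaves the product (a + b/v)(a + b v) over q, which is
affine in v + 1/v. -/
lemma lintegral_exp_quadratic_eq {a b v : ℝ} (ha : 0 ≤ a) (hb : 0 ≤ b) (hab : ¬ (a = 0 ∧ b = 0))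
    (hv : 0 < v) :
    ∫⁻ τ : ℝ, ENNReal.ofReal (Real.exp (-(a * (Real.exp (τ / 2) + 1 / Real.exp (τ / 2)) +
        b * (v / Real.exp (τ / 2) + Real.exp (τ / 2) / v)))) =
      ∫⁻ τ : ℝ, ENNReal.ofReal (Real.exp (-(Real.exp (τ / 2) +
        (a ^ 2 + b ^ 2 + a * b * (v + 1 / v)) / Real.exp (τ / 2)))) := by
  have hX : 0 < a + b / v := by
    rcases ha.eq_or_lt with h | h
    · have : b ≠ 0 := fun hb0 => hab ⟨h.symm, hb0⟩
      have : 0 < b := lt_of_le_of_ne hb this.symm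
      positivity
    · positivity
  rw [← lintegral_add_right_eq_self _ (-(2 * Real.log (a + b / v)))]
  refine lintegral_congr fun τ => ?_
  have h1 : Real.exp ((τ + -(2 * Real.log (a + b / v))) / 2) = Real.exp (τ / 2) / (a + b / v) := by
    rw [show (τ + -(2 * Real.log (a + b / v))) / 2 = τ / 2 - Real.log (a + b / v) by ring,
      Real.exp_sub, Real.exp_log hX]
  rw [h1]
  congr 3
  have := Real.exp_pos (τ / 2)
  generalize Real.exp (τ / 2) = q at *
  have hX' : a * v + b ≠ 0 := by
    have : 0 < a * v + b := by
      have h2 : a * v + b = (a + b / v) * v := by field_simp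
      rw [h2]
      positivity
    exact this.ne'
  have hX'' : a + b / v = (a * v + b) / v := by field_simp
  rw [hX'']
  field_simp
  ring

lemma ae_exp_half_ne (v : ℝ) : ∀ᵐ τ : ℝ, Real.exp (τ / 2) ≠ v := by
  have : {τ : ℝ | ¬ Real.exp (τ / 2) ≠ v} ⊆ {2 * Real.log v} := fun τ hτ => by
    simp only [ne_eq, not_not, mem_ofPred_eq] at hτ
    rw [mem_singleton_iff, ← hτ, Real.log_exp]
    ring
  exact measure_mono_null this (measure_singleton _)

/-- The integral over the second coordinate in logarithmic scale of a completely monotone function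
of `v + 1 / v`, `q + 1 / q`, `v / q + q / v`, is a completely monotone function of `v + 1 / v`. -/
lemma exists_cmOn_lintegral {G : (Fin 3 → ℝ) → ℝ} (hG : CMOn (Ici ![1, 2, 2]) G)
    (hfin : ∫⁻ τ : ℝ, ENNReal.ofReal (G ![1 + 1 / 1, Real.exp (τ / 2) + 1 / Real.exp (τ / 2),
      1 / Real.exp (τ / 2) + Real.exp (τ / 2) / 1]) < ⊤) :
    ∃ F : ℝ → ℝ, CMOn (Ici 2) F ∧ ∀ v, 0 < v →
      ∫⁻ τ : ℝ, ENNReal.ofReal (G ![v + 1 / v, Real.exp (τ / 2) + 1 / Real.exp (τ / 2),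
        v / Real.exp (τ / 2) + Real.exp (τ / 2) / v]) = ENNReal.ofReal (F (v + 1 / v)) := by
  obtain ⟨μ, hμfin, hpos, hμ⟩ : ∃ μ : Measure (Fin 3 → ℝ), IsFiniteMeasure μ ∧
      (∀ᵐ p ∂μ, ∀ j, 0 ≤ p j) ∧ ∀ x : Fin 3 → ℝ, (∀ j, (![1, 2, 2] : Fin 3 → ℝ) j < x j) →
        G x = ∫ p, Real.exp (-∑ j, p j * (x j - (![1, 2, 2] : Fin 3 → ℝ) j)) ∂μ :=
    hG.exists_measure
  have hint : ∀ x : Fin 3 → ℝ, (∀ j, (![1, 2, 2] : Fin 3 → ℝ) j < x j) →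
      ENNReal.ofReal (G x) =
        ∫⁻ p, ENNReal.ofReal (Real.exp (-∑ j, p j * (x j - (![1, 2, 2] : Fin 3 → ℝ) j))) ∂μ := by
    intro x hx
    rw [hμ x hx, ofReal_integral_eq_lintegral_ofReal]
    · refine (integrable_const (1 : ℝ)).mono' (by fun_prop : Measurable fun p : Fin 3 → ℝ =>
        Real.exp (-∑ j, p j * (x j - (![1, 2, 2] : Fin 3 → ℝ) j))).aestronglyMeasurable ?_
      filter_upwards [hpos] with p hp
      rw [Real.norm_of_nonneg (Real.exp_pos _).le]
      refine Real.exp_le_one_iff.2 (neg_nonpos.2 (Finset.sum_nonneg fun j _ => ?_))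
      exact mul_nonneg (hp j) (sub_pos.2 (hx j)).le
    · exact Eventually.of_forall fun p => (Real.exp_pos _).le
  have hstep : ∀ v, 0 < v →
      ∫⁻ τ : ℝ, ENNReal.ofReal (G ![v + 1 / v, Real.exp (τ / 2) + 1 / Real.exp (τ / 2),
        v / Real.exp (τ / 2) + Real.exp (τ / 2) / v]) =
      ∫⁻ p, ENNReal.ofReal (Real.exp (-(p 0 * (v + 1 / v - 1)) + 2 * p 1 + 2 * p 2)) *
        (∫⁻ τ : ℝ, ENNReal.ofReal (Real.exp (-(p 1 * (Real.exp (τ / 2) + 1 / Real.exp (τ / 2)) +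
        p 2 * (v / Real.exp (τ / 2) + Real.exp (τ / 2) / v))))) ∂μ := by
    intro v hv
    have h1 : ∀ᵐ τ : ℝ, ENNReal.ofReal (G ![v + 1 / v, Real.exp (τ / 2) + 1 / Real.exp (τ / 2),
        v / Real.exp (τ / 2) + Real.exp (τ / 2) / v]) =
        ∫⁻ p, ENNReal.ofReal (Real.exp (-(p 0 * (v + 1 / v - 1)) + 2 * p 1 + 2 * p 2)) *
        ENNReal.ofReal (Real.exp (-(p 1 * (Real.exp (τ / 2) + 1 / Real.exp (τ / 2)) +
        p 2 * (v / Real.exp (τ / 2) + Real.exp (τ / 2) / v)))) ∂μ := by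
      -- The representation holds only strictly above the vertex (1, 2, 2). The first coordinate is
      -- at least 2 > 1, even at v = 1; each of the others equals 2 for a single τ.
      filter_upwards [ae_exp_half_ne 1, ae_exp_half_ne v] with τ h1 h2
      rw [hint]
      · refine lintegral_congr fun p => ?_
        rw [← ENNReal.ofReal_mul (Real.exp_pos _).le, ← Real.exp_add]
        congr 2
        simp [Fin.sum_univ_three]
        ring
      · intro j
        have hq := Real.exp_pos (τ / 2)
        have hv2 := two_le_add_inv hv
        have h3 : (2 : ℝ) < v / Real.exp (τ / 2) + Real.exp (τ / 2) / v := by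
          have := two_lt_add_inv (v := v / Real.exp (τ / 2)) (by positivity) (fun h => h2 (by
            rw [div_eq_one_iff_eq hq.ne'] at h; exact h.symm))
          rwa [one_div_div] at this
        have h4 := two_lt_add_inv hq h1
        fin_cases j
        · simp only [Fin.zero_eta, Matrix.cons_val_zero]
          linarith
        · exact h4
        · exact h3
    rw [lintegral_congr_ae h1, lintegral_lintegral_swap]
    · refine lintegral_congr fun p => ?_
      rw [lintegral_const_mul _ (by fun_prop)]
    · exact (by fun_prop : Measurable (Function.uncurry fun (τ : ℝ) (p : Fin 3 → ℝ) =>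
        ENNReal.ofReal (Real.exp (-(p 0 * (v + 1 / v - 1)) + 2 * p 1 + 2 * p 2)) *
        ENNReal.ofReal (Real.exp (-(p 1 * (Real.exp (τ / 2) + 1 / Real.exp (τ / 2)) +
        p 2 * (v / Real.exp (τ / 2) + Real.exp (τ / 2) / v)))))).aemeasurable
  -- If both exponents vanish the inner integral is that of 1 over the line; finiteness at v = 1
  -- excludes this almost everywhere.
  have hne : ∀ᵐ p ∂μ, ¬ (p 1 = 0 ∧ p 2 = 0) := by
    rw [hstep 1 one_pos] at hfin
    have hmeas : Measurable fun p : Fin 3 → ℝ =>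
        ENNReal.ofReal (Real.exp (-(p 0 * (1 + 1 / 1 - 1)) + 2 * p 1 + 2 * p 2)) *
        ∫⁻ τ : ℝ, ENNReal.ofReal (Real.exp (-(p 1 * (Real.exp (τ / 2) + 1 / Real.exp (τ / 2)) +
        p 2 * (1 / Real.exp (τ / 2) + Real.exp (τ / 2) / 1)))) := by
      refine Measurable.mul (by fun_prop) ?_
      exact Measurable.lintegral_prod_right' (f := fun z : (Fin 3 → ℝ) × ℝ =>
        ENNReal.ofReal (Real.exp (-(z.1 1 * (Real.exp (z.2 / 2) + 1 / Real.exp (z.2 / 2)) +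
        z.1 2 * (1 / Real.exp (z.2 / 2) + Real.exp (z.2 / 2) / 1))))) (by fun_prop)
    filter_upwards [ae_lt_top hmeas hfin.ne] with p hp hp0
    rw [hp0.1, hp0.2] at hp
    simp [ENNReal.mul_top, Real.exp_pos] at hp
  -- The integrand after rescaling: w enters only through an exponential with nonnegative rate, and
  -- the constants z.1 0 + 2 * z.1 1 + 2 * z.1 2 come from the vertex.
  let k : ℝ → (Fin 3 → ℝ) × ℝ → ℝ := fun w z =>
    Real.exp (z.1 0 + 2 * z.1 1 + 2 * z.1 2 - Real.exp (z.2 / 2) -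
      (z.1 1 ^ 2 + z.1 2 ^ 2) / Real.exp (z.2 / 2)) *
      Real.exp (-((z.1 0 + z.1 1 * z.1 2 / Real.exp (z.2 / 2)) * w))
  have hkm : ∀ w, Measurable (k w) := fun w => by fun_prop
  have hk0 : ∀ w z, 0 ≤ k w z := fun w z => by positivity
  have hk : ∀ v, 0 < v →
      ∫⁻ τ : ℝ, ENNReal.ofReal (G ![v + 1 / v, Real.exp (τ / 2) + 1 / Real.exp (τ / 2),
        v / Real.exp (τ / 2) + Real.exp (τ / 2) / v]) =
      ∫⁻ z, ENNReal.ofReal (k (v + 1 / v) z) ∂(μ.prod volume) := by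
    intro v hv
    rw [hstep v hv, lintegral_prod _ (hkm _).ennreal_ofReal.aemeasurable]
    refine lintegral_congr_ae ?_
    filter_upwards [hpos, hne] with p hp hp0
    rw [lintegral_exp_quadratic_eq (hp 1) (hp 2) hp0 hv, ← lintegral_const_mul _ (by fun_prop)]
    refine lintegral_congr fun τ => ?_
    rw [← ENNReal.ofReal_mul (Real.exp_pos _).le]
    simp only [k, ← Real.exp_add]
    congr 2
    ring
  have hpos' : ∀ᵐ z ∂(μ.prod (volume : Measure ℝ)), ∀ j, 0 ≤ z.1 j := by
    refine Measure.quasiMeasurePreserving_fst.ae (p := fun p : Fin 3 → ℝ => ∀ j, 0 ≤ p j) hpos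
  have hexp : ∀ᵐ z ∂(μ.prod (volume : Measure ℝ)), 0 ≤ z.1 0 + z.1 1 * z.1 2 / Real.exp (z.2 / 2) := by
    filter_upwards [hpos'] with z hz
    have := hz 0
    have := hz 1
    have := hz 2
    positivity
  have hk2 : Integrable (k 2) (μ.prod volume) := by
    refine ⟨(hkm 2).aestronglyMeasurable, ?_⟩
    rw [hasFiniteIntegral_iff_ofReal (Eventually.of_forall (hk0 2))]
    rw [hk 1 one_pos] at hfin
    norm_num at hfin
    exact hfin
  have hkint : ∀ w ∈ Ici (2 : ℝ), Integrable (k w) (μ.prod volume) := by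
    intro w hw
    refine hk2.mono' (hkm w).aestronglyMeasurable ?_
    filter_upwards [hexp] with z hz
    rw [Real.norm_of_nonneg (hk0 w z)]
    refine mul_le_mul_of_nonneg_left (Real.exp_le_exp.2 (neg_le_neg ?_)) (Real.exp_pos _).le
    exact mul_le_mul_of_nonneg_left hw hz
  refine ⟨fun w => ∫ z, k w z ∂(μ.prod volume), ?_, fun v hv => ?_⟩
  · refine CMOn.integral (isUpperSet_Ici 2) (K := fun z w => k w z) ?_ hkint
    filter_upwards [hexp] with z hz
    exact (cmOn_exp_neg_mul _ hz).const_mul (Real.exp_pos _).le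
  · rw [hk v hv, ofReal_integral_eq_lintegral_ofReal (hkint _ (two_le_add_inv hv))
      (Eventually.of_forall (hk0 _))]

variable {h : ℝ × ℝ → ℝ}

/-- In logarithmic coordinates this is the change of variables a = σ + τ/2, b = σ - τ/2, of Jacobian
1. It exhibits u₂ = e^σ and v₂ = e^(τ/2) in the BVHCM product. -/
lemma lintegral_mul_lintegral_eq (hm : Measurable h) (hpos : ∀ x y, 0 < x → 0 < y → 0 ≤ h (x, y))
    {x₁ x₂ : ℝ} (hx₁ : 0 < x₁) (hx₂ : 0 < x₂) :
    (∫⁻ y in Ioi 0, ENNReal.ofReal (h (x₁, y))) * (∫⁻ y in Ioi 0, ENNReal.ofReal (h (x₂, y))) =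
      ∫⁻ σ : ℝ, ∫⁻ τ : ℝ, ENNReal.ofReal (Real.exp (2 * σ)) * ENNReal.ofReal
        (h (x₁, Real.exp σ * Real.exp (τ / 2)) * h (x₂, Real.exp σ / Real.exp (τ / 2))) := by
  set A : ℝ → ℝ → ℝ≥0∞ := fun x b => ENNReal.ofReal (Real.exp b) * ENNReal.ofReal (h (x, Real.exp b))
  have hA : ∀ x, Measurable (A x) := fun x => by fun_prop
  rw [lintegral_Ioi_eq_lintegral_exp, lintegral_Ioi_eq_lintegral_exp]
  change (∫⁻ b, A x₁ b) * (∫⁻ b, A x₂ b) = _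
  calc (∫⁻ b, A x₁ b) * (∫⁻ b, A x₂ b) = ∫⁻ a, ∫⁻ b, A x₁ a * A x₂ b := by
        rw [← lintegral_mul_const _ (hA x₁)]
        exact lintegral_congr fun a => (lintegral_const_mul _ (hA x₂)).symm
    _ = ∫⁻ a, ∫⁻ τ, A x₁ a * A x₂ (a - τ) := by
        refine lintegral_congr fun a => ?_
        exact (lintegral_sub_left_eq_self (fun b => A x₁ a * A x₂ b) a).symm
    _ = ∫⁻ τ, ∫⁻ a, A x₁ a * A x₂ (a - τ) := by
        refine lintegral_lintegral_swap (Measurable.aemeasurable ?_)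
        have h1 := hA x₁
        have h2 := hA x₂
        fun_prop
    _ = ∫⁻ τ, ∫⁻ σ, A x₁ (σ + τ / 2) * A x₂ (σ + τ / 2 - τ) := by
        refine lintegral_congr fun τ => ?_
        exact (lintegral_add_right_eq_self (fun a => A x₁ a * A x₂ (a - τ)) (τ / 2)).symm
    _ = ∫⁻ σ, ∫⁻ τ, A x₁ (σ + τ / 2) * A x₂ (σ + τ / 2 - τ) := by
        refine lintegral_lintegral_swap (Measurable.aemeasurable ?_)
        have h1 := hA x₁
        have h2 := hA x₂
        fun_prop
    _ = _ := by
        refine lintegral_congr fun σ => lintegral_congr fun τ => ?_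
        have e1 : Real.exp (σ + τ / 2) = Real.exp σ * Real.exp (τ / 2) := Real.exp_add _ _
        have e2 : Real.exp (σ + τ / 2 - τ) = Real.exp σ / Real.exp (τ / 2) := by
          rw [← Real.exp_sub]
          congr 1
          ring
        have e3 : Real.exp (2 * σ) = Real.exp (σ + τ / 2) * Real.exp (σ + τ / 2 - τ) := by
          rw [← Real.exp_add]
          congr 1
          ring
        have p1 := hpos x₁ _ hx₁ (Real.exp_pos (σ + τ / 2))
        have p2 := hpos x₂ _ hx₂ (Real.exp_pos (σ + τ / 2 - τ))
        simp only [A]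
        rw [e3, ← e1, ← e2, ENNReal.ofReal_mul (Real.exp_pos _).le, ENNReal.ofReal_mul p1]
        ring

lemma marginalDensity_eq_toReal (hm : Measurable h)
    (hpos : ∀ x y, 0 < x → 0 < y → 0 ≤ h (x, y)) {x : ℝ} (hx : 0 < x) :
    marginalDensity h x = (∫⁻ y in Ioi 0, ENNReal.ofReal (h (x, y))).toReal := by
  refine integral_eq_lintegral_of_nonneg_ae ?_
    (by fun_prop : Measurable fun y => h (x, y)).aestronglyMeasurable
  filter_upwards [ae_restrict_mem measurableSet_Ioi] with y hy using hpos x y hx hy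

/-- The marginal of a weakly bivariate HCM function is weakly HCM. -/
theorem IsWeakBVHCM.marginal (hm : Measurable h) (hpos : ∀ x y, 0 < x → 0 < y → 0 ≤ h (x, y))
    (hh : IsWeakBVHCM h) (hfin : ∀ x, 0 < x → ∫⁻ y in Ioi 0, ENNReal.ofReal (h (x, y)) < ⊤) :
    IsWeakHCM (marginalDensity h) := by
  intro u hu
  set P : ℝ → ℝ → ℝ≥0∞ := fun σ v => ∫⁻ τ : ℝ, ENNReal.ofReal (Real.exp (2 * σ)) * ENNReal.ofReal
        (h (u * v, Real.exp σ * Real.exp (τ / 2)) * h (u / v, Real.exp σ / Real.exp (τ / 2)))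
    with hP
  have hPm : ∀ v, Measurable fun σ => P σ v := fun v => by
    refine Measurable.lintegral_prod_right' (f := fun z : ℝ × ℝ =>
      ENNReal.ofReal (Real.exp (2 * z.1)) * ENNReal.ofReal
        (h (u * v, Real.exp z.1 * Real.exp (z.2 / 2)) *
          h (u / v, Real.exp z.1 / Real.exp (z.2 / 2)))) ?_
    fun_prop
  have hprod : ∀ v, 0 < v → (∫⁻ y in Ioi 0, ENNReal.ofReal (h (u * v, y))) *
      (∫⁻ y in Ioi 0, ENNReal.ofReal (h (u / v, y))) = ∫⁻ σ, P σ v := fun v hv =>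
    lintegral_mul_lintegral_eq hm hpos (by positivity) (by positivity)
  have hPfin : ∀ v, 0 < v → ∫⁻ σ, P σ v < ⊤ := fun v hv => by
    rw [← hprod v hv]
    exact ENNReal.mul_lt_top (hfin _ (by positivity)) (hfin _ (by positivity))
  have hF : ∀ᵐ σ : ℝ, ∃ F : ℝ → ℝ, CMOn (Ici 2) F ∧
      ∀ v, 0 < v → P σ v = ENNReal.ofReal (F (v + 1 / v)) := by
    filter_upwards [ae_lt_top (hPm 1) (hPfin 1 one_pos).ne] with σ hσ
    obtain ⟨G, hG, hGh⟩ := hh u (Real.exp σ) hu (Real.exp_pos σ)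
    have hPG : ∀ v, 0 < v → P σ v = ENNReal.ofReal (Real.exp (2 * σ)) *
        ∫⁻ τ : ℝ, ENNReal.ofReal (G ![v + 1 / v, Real.exp (τ / 2) + 1 / Real.exp (τ / 2),
        v / Real.exp (τ / 2) + Real.exp (τ / 2) / v]) := by
      intro v hv
      rw [hP, ← lintegral_const_mul' _ _ ENNReal.ofReal_ne_top]
      exact lintegral_congr fun τ => by rw [← hGh v _ hv (Real.exp_pos _)]
    have hfinG : ∫⁻ τ : ℝ, ENNReal.ofReal (G ![1 + 1 / 1, Real.exp (τ / 2) + 1 / Real.exp (τ / 2),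
        1 / Real.exp (τ / 2) + Real.exp (τ / 2) / 1]) < ⊤ := by
      rw [hPG 1 one_pos] at hσ
      rw [lt_top_iff_ne_top] at hσ ⊢
      intro htop
      rw [htop, ENNReal.mul_top (by simp [Real.exp_pos])] at hσ
      exact hσ rfl
    obtain ⟨F, hF, hFv⟩ := exists_cmOn_lintegral hG hfinG
    refine ⟨fun w => Real.exp (2 * σ) * F w, hF.const_mul (Real.exp_pos _).le, fun v hv => ?_⟩
    rw [hPG v hv, hFv v hv, ENNReal.ofReal_mul (Real.exp_pos _).le]
  -- The functions F are chosen separately for each σ and need not be measurable in σ; evaluating P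
  -- σ at `jroot w` gives the same values measurably.
  refine ⟨fun w => ∫ σ, (P σ (jroot w)).toReal, ?_, fun v hv => ?_⟩
  · refine CMOn.integral (isUpperSet_Ici 2) (K := fun σ w => (P σ (jroot w)).toReal) ?_ ?_
    · filter_upwards [hF] with σ hσ
      obtain ⟨F, hF, hFv⟩ := hσ
      refine hF.congr (isUpperSet_Ici 2) fun w hw => ?_
      rw [hFv _ (jroot_pos hw), jroot_add_inv hw, ENNReal.toReal_ofReal (hF.nonneg hw)]
    · exact fun w hw => integrable_toReal_of_lintegral_ne_top (hPm _).aemeasurable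
        (hPfin _ (jroot_pos hw)).ne
  · have hw := two_le_add_inv hv
    rw [marginalDensity_eq_toReal hm hpos (by positivity : 0 < u * v),
      marginalDensity_eq_toReal hm hpos (by positivity : 0 < u / v), ← ENNReal.toReal_mul,
      hprod v hv]
    have h1 : ∫⁻ σ, P σ v = ∫⁻ σ, P σ (jroot (v + 1 / v)) := by
      refine lintegral_congr_ae ?_
      filter_upwards [hF] with σ hσ
      obtain ⟨F, -, hFv⟩ := hσ
      rw [hFv v hv, hFv _ (jroot_pos hw), jroot_add_inv hw]
    rw [h1]
    beta_reduce
    rw [integral_toReal (hPm _).aemeasurable]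
    exact ae_lt_top (hPm _) (hPfin _ (jroot_pos hw)).ne

end Marginal

/-! ### Complete monotonicity by analytic continuation -/

section HalfPlane

/-- The open right half-plane. -/
def rightHalfPlane : Set ℂ := {z | 0 < z.re}

lemma isOpen_rightHalfPlane : IsOpen rightHalfPlane :=
  isOpen_lt continuous_const Complex.continuous_re

lemma isOpen_re_gt (a : ℝ) : IsOpen {z : ℂ | a < z.re} :=
  isOpen_lt continuous_const Complex.continuous_re

variable {F : ℝ → ℝ} {H : ℂ → ℂ}

/-- A holomorphic function on the right half-plane which extends a completely monotone function
on `[2, ∞)` coincides with its Laplace transform representation. -/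
lemma exists_eqOn_complexMGF (hF : CMOn (Ici 2) F) (hH : DifferentiableOn ℂ H rightHalfPlane)
    (hHF : ∀ w : ℝ, 2 ≤ w → H w = F w) :
    ∃ μ : Measure (Fin 1 → ℝ), IsFiniteMeasure μ ∧ (∀ᵐ p ∂μ, 0 ≤ p 0) ∧
      Ioi 0 ⊆ interior (integrableExpSet (fun p : Fin 1 → ℝ => -p 0) μ) ∧
      (∀ x, 2 < x → F x = mgf (fun p : Fin 1 → ℝ => -p 0) μ (x - 2)) ∧
      ∀ w : ℂ, 2 < w.re → H w = complexMGF (fun p : Fin 1 → ℝ => -p 0) μ (w - 2) := by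
  obtain ⟨μ, hfin, hpos, hint, hμ⟩ := hF.exists_mgf
  refine ⟨μ, hfin, hpos, hint, hμ, ?_⟩
  set X : (Fin 1 → ℝ) → ℝ := fun p => -p 0
  set U : Set ℂ := {z : ℂ | 2 < z.re}
  have hU : IsOpen U := isOpen_re_gt 2
  have hL : DifferentiableOn ℂ (fun w : ℂ => complexMGF X μ (w - 2)) U := by
    refine differentiableOn_complexMGF.comp (by fun_prop) fun w hw => ?_
    refine hint ?_
    have : 2 < w.re := hw
    simp only [Complex.sub_re, Complex.re_ofNat, mem_Ioi]
    linarith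
  have hHU : DifferentiableOn ℂ H U := hH.mono fun z hz => by
    have : 2 < z.re := hz
    change 0 < z.re
    linarith
  have h3 : (3 : ℂ) ∈ U := by simp [U]; norm_num
  -- The two holomorphic functions agree at real points accumulating at 3, which is enough for the
  -- identity theorem.
  have hfreq : ∃ᶠ z in 𝓝[≠] (3 : ℂ), H z = complexMGF X μ (z - 2) := by
    have hlim : Tendsto (fun n : ℕ => ((3 + 1 / ((n : ℝ) + 1) : ℝ) : ℂ)) atTop (𝓝[≠] (3 : ℂ)) := by
      refine tendsto_nhdsWithin_iff.2 ⟨?_, Eventually.of_forall fun n => ?_⟩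
      · have h1 := tendsto_one_div_add_atTop_nhds_zero_nat (𝕜 := ℝ)
        have h2 := (Complex.continuous_ofReal.tendsto (3 + 0)).comp (h1.const_add 3)
        have h4 : ((3 + 0 : ℝ) : ℂ) = 3 := by norm_num
        rw [h4] at h2
        exact h2
      · simp only [mem_compl_iff, mem_singleton_iff]
        intro h
        have h' := congrArg Complex.re h
        rw [Complex.ofReal_re] at h'
        have : 0 < 1 / ((n : ℝ) + 1) := by positivity
        norm_num at h'
        linarith
    refine hlim.frequently (Eventually.of_forall fun n => ?_).frequently
    have h0 : 0 < 1 / ((n : ℝ) + 1) := by positivity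
    set x : ℝ := 3 + 1 / ((n : ℝ) + 1)
    have hx : 2 < x := by simp only [x]; linarith
    rw [hHF x hx.le, hμ x hx, ← complexMGF_ofReal]
    push_cast
    rfl
  have hEq := (hHU.analyticOnNhd hU).eqOn_of_preconnected_of_frequently_eq
    (hL.analyticOnNhd hU) (convex_halfSpace_re_gt 2).isPreconnected h3 hfreq
  exact fun w hw => hEq hw

/-- A holomorphic function on the right half-plane which extends a completely monotone function
on `[2, ∞)` is completely monotone on `(0, ∞)`. -/
lemma cmOn_re_of_differentiableOn (hF : CMOn (Ici 2) F) (hH : DifferentiableOn ℂ H rightHalfPlane)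
    (hHF : ∀ w : ℝ, 2 ≤ w → H w = F w) : CMOn (Ioi 0) fun w : ℝ => (H w).re := by
  obtain ⟨μ, hfin, hpos, hint, -, hL⟩ := exists_eqOn_complexMGF hF hH hHF
  set X : (Fin 1 → ℝ) → ℝ := fun p => -p 0
  have hsign : ∀ (k : ℕ) (w₀ : ℝ), 2 < w₀ → ∃ a : ℝ, 0 ≤ a ∧
      iteratedDeriv k H w₀ = ((-1 : ℝ) ^ k * a : ℝ) := by
    intro k w₀ hw₀
    have he : H =ᶠ[𝓝 (w₀ : ℂ)] fun w => complexMGF X μ (w - 2) := by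
      filter_upwards [(isOpen_re_gt 2).mem_nhds (show (w₀ : ℂ) ∈ {z : ℂ | 2 < z.re} from hw₀)]
        with w hw using hL w hw
    refine ⟨∫ p, p 0 ^ k * Real.exp ((w₀ - 2) * -p 0) ∂μ, integral_nonneg_of_ae ?_, ?_⟩
    · filter_upwards [hpos] with p hp
      simp only [Pi.zero_apply]
      positivity
    · rw [(he.iteratedDeriv k).eq_of_nhds, iteratedDeriv_comp_sub_const]
      beta_reduce
      rw [iteratedDeriv_complexMGF (hint (by simpa using hw₀)), ← integral_const_mul,
        ← integral_complex_ofReal]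
      refine integral_congr_ae (Eventually.of_forall fun p => ?_)
      have : ((-p 0 : ℝ) : ℂ) ^ k = (-1) ^ k * (p 0 : ℂ) ^ k := by
        rw [← mul_pow]; push_cast; simp
      simp only [X, this]
      push_cast
      ring
  have hdiff : ∀ k : ℕ, DifferentiableOn ℂ (iteratedDeriv k H) rightHalfPlane := by
    intro k
    induction k with
    | zero => simpa using hH
    | succ k ih =>
      rw [iteratedDeriv_succ]
      exact ih.deriv isOpen_rightHalfPlane
  have hpos' : ∀ (k : ℕ) (w : ℝ), 0 < w → 0 ≤ ((-1 : ℝ) ^ k * (iteratedDeriv k H w).re) := by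
    intro k w hw
    -- Taylor expansion about w₀ > 2, where the signs are known, in the disc of radius w₀ inside the
    -- half-plane. Since w - w₀ = -3, the powers (w - w₀)^j cancel the alternating signs and the
    -- terms all have sign (-1)^k or vanish.
    set w₀ : ℝ := w + 3
    have hball : Metric.ball (w₀ : ℂ) w₀ ⊆ rightHalfPlane := by
      intro z hz
      rw [Metric.mem_ball, dist_eq_norm] at hz
      have h1 := (abs_le.1 (Complex.abs_re_le_norm (z - w₀))).1
      simp only [Complex.sub_re, Complex.ofReal_re] at h1
      change 0 < z.re
      linarith
    have hmem : (w : ℂ) ∈ Metric.ball (w₀ : ℂ) w₀ := by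
      rw [Metric.mem_ball, dist_eq_norm, ← Complex.ofReal_sub, Complex.norm_real]
      simp only [w₀, Real.norm_eq_abs]
      rw [show w - (w + 3) = -3 by ring]
      norm_num
      linarith
    have hsum := Complex.hasSum_taylorSeries_on_ball ((hdiff k).mono hball) hmem
    have hre := (Complex.hasSum_re hsum).mul_left ((-1 : ℝ) ^ k)
    refine hre.nonneg fun j => ?_
    obtain ⟨a, ha, hak⟩ := hsign (j + k) w₀ (by simp only [w₀]; linarith)
    have hit : iteratedDeriv j (iteratedDeriv k H) (w₀ : ℂ) = iteratedDeriv (j + k) H w₀ := by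
      simp only [iteratedDeriv_eq_iterate, Function.iterate_add, Function.comp_apply]
    rw [hit, hak, ← Complex.ofReal_sub]
    simp only [smul_eq_mul]
    have : ((j.factorial : ℂ))⁻¹ * (((w - w₀ : ℝ) : ℂ) ^ j * (((-1 : ℝ) ^ (j + k) * a : ℝ) : ℂ)) =
        (((j.factorial : ℝ)⁻¹ * ((w - w₀) ^ j * ((-1) ^ (j + k) * a)) : ℝ) : ℂ) := by
      push_cast
      ring
    rw [this, Complex.ofReal_re]
    have h2 : (-1 : ℝ) ^ k * ((j.factorial : ℝ)⁻¹ * ((w - w₀) ^ j * ((-1) ^ (j + k) * a))) =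
        ((-1) ^ k * (-1) ^ k) * ((j.factorial : ℝ)⁻¹ * (((w - w₀) ^ j * (-1) ^ j) * a)) := by
      rw [pow_add]
      ring
    rw [h2, ← mul_pow, ← mul_pow]
    have h3 : (w - w₀) * -1 = 3 := by simp only [w₀]; ring
    rw [h3]
    positivity
  refine (cmOn_of_hasDerivAt (isUpperSet_Ioi 0)
    (fun k (w : ℝ) => (-1 : ℝ) ^ k * (iteratedDeriv k H w).re) (fun k w hw => ?_)
    fun k w hw => hpos' k w hw).congr (isUpperSet_Ioi 0) fun w _ => by simp
  have h1 : HasDerivAt (iteratedDeriv k H) (iteratedDeriv (k + 1) H w) (w : ℂ) := by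
    rw [iteratedDeriv_succ]
    exact ((hdiff k).differentiableAt (isOpen_rightHalfPlane.mem_nhds
      (show (0 : ℝ) < (w : ℂ).re from hw))).hasDerivAt
  refine (h1.real_of_complex.const_mul _).congr_deriv ?_
  rw [pow_succ]
  ring

/-- A Laplace transform at a complex point is dominated by its value at the real part, which
monotonicity bounds by the value at 2. -/
lemma norm_le_of_cmOn (hF : CMOn (Ici 2) F) (hH : DifferentiableOn ℂ H rightHalfPlane)
    (hHF : ∀ w : ℝ, 2 ≤ w → H w = F w) {w : ℂ} (hw : 2 < w.re) : ‖H w‖ ≤ F 2 := by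
  obtain ⟨μ, hfin, hpos, hint, hFm, hL⟩ := exists_eqOn_complexMGF hF hH hHF
  rw [hL w hw]
  refine norm_complexMGF_le_mgf.trans ?_
  have h1 := hFm w.re hw
  have h2 := hF.antitone (x := 2) (h := w.re - 2) self_mem_Ici (by linarith)
  rw [add_sub_cancel] at h2
  rw [Complex.sub_re, Complex.re_ofNat, ← h1]
  exact h2

end HalfPlane

/-! ### The product as a holomorphic function of w = v + 1/v -/

section Joukowski

/-- Taking real parts in v + 1/v = w gives Re v (1 + 1/|v|²) = Re w, so v lies in the right
half-plane for either square root. -/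
lemma joukowski_root {w r : ℂ} (hw : 0 < w.re) (hr : r ^ 2 = w ^ 2 - 4) :
    0 < ((w + r) / 2).re ∧ (w + r) / 2 + 1 / ((w + r) / 2) = w := by
  set v := (w + r) / 2
  have h1 : v ^ 2 - w * v + 1 = 0 := by
    simp only [v]
    linear_combination hr / 4
  have hv : v ≠ 0 := by
    intro h
    simp [h] at h1
  have h2 : v + 1 / v = w := by
    field_simp
    linear_combination h1
  refine ⟨?_, h2⟩
  have h3 := congrArg Complex.re h2
  rw [one_div, Complex.add_re, Complex.inv_re] at h3
  have hn : 0 < Complex.normSq v := Complex.normSq_pos.2 hv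
  by_contra hcon
  have h4 : v.re / Complex.normSq v ≤ 0 := div_nonpos_of_nonpos_of_nonneg (not_lt.1 hcon) hn.le
  linarith

/-- The function `w ↦ q (u v) q (u / v)`, with `v + 1 / v = w`. -/
noncomputable def joukowskiProd (q : ℂ → ℂ) (u : ℝ) (w : ℂ) : ℂ :=
  q (u * ((w + (w ^ 2 - 4) ^ (1 / 2 : ℂ)) / 2)) * q (u / ((w + (w ^ 2 - 4) ^ (1 / 2 : ℂ)) / 2))

variable {q : ℂ → ℂ} {u : ℝ}

lemma cpow_half_sq (z : ℂ) : (z ^ (1 / 2 : ℂ)) ^ 2 = z := by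
  rw [← Complex.cpow_nat_mul]
  simp

lemma re_inv_pos {v : ℂ} (hv : 0 < v.re) : 0 < (1 / v).re := by
  have : v ≠ 0 := fun h => by simp [h] at hv
  rw [one_div, Complex.inv_re]
  exact div_pos hv (Complex.normSq_pos.2 this)

/-- The principal square root selects v or 1/v, and the product is symmetric in the two. -/
lemma joukowskiProd_eq (q : ℂ → ℂ) (u : ℝ) {v : ℂ} (hv : 0 < v.re) :
    joukowskiProd q u (v + 1 / v) = q (u * v) * q (u / v) := by
  have hv0 : v ≠ 0 := fun h => by simp [h] at hv
  set w := v + 1 / v with hw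
  have hwre : 0 < w.re := by
    rw [hw, Complex.add_re]
    exact add_pos hv (re_inv_pos hv)
  obtain ⟨hre, hvw⟩ := joukowski_root hwre (cpow_half_sq (w ^ 2 - 4))
  unfold joukowskiProd
  set s := (w + (w ^ 2 - 4) ^ (1 / 2 : ℂ)) / 2
  have hs0 : s ≠ 0 := fun h => by simp [h] at hre
  have hfac : (s - v) * (s - 1 / v) = 0 := by
    have h1 : s ^ 2 - w * s + 1 = 0 := by
      have h2 : s * (s + 1 / s) = s * w := by rw [hvw]
      rw [mul_add, mul_one_div_cancel hs0] at h2
      linear_combination h2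
    have h3 : (s - v) * (s - 1 / v) = s ^ 2 - (v + 1 / v) * s + v * (1 / v) := by ring
    rw [h3, mul_one_div_cancel hv0, ← hw, h1]
  rcases mul_eq_zero.1 hfac with h | h
  · rw [sub_eq_zero.1 h]
  · rw [sub_eq_zero.1 h, mul_comm]
    congr 2
    · field_simp
    · ring

/-- By symmetry any local branch of the square root computes the product, so it is holomorphic away
from w = 2. There it is continuous, and the singularity is removable. -/
lemma differentiableOn_joukowskiProd (hq : DifferentiableOn ℂ q rightHalfPlane) (hu : 0 < u) :
    DifferentiableOn ℂ (joukowskiProd q u) rightHalfPlane := by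
  have hscale : ∀ {v : ℂ}, 0 < v.re → (u * v : ℂ) ∈ rightHalfPlane := fun {v} hv => by
    change 0 < (u * v : ℂ).re
    rw [Complex.re_ofReal_mul]
    positivity
  have hscale' : ∀ {v : ℂ}, 0 < v.re → (u / v : ℂ) ∈ rightHalfPlane := fun {v} hv => by
    have := hscale (re_inv_pos hv)
    rwa [mul_one_div] at this
  have hqd : ∀ z ∈ rightHalfPlane, DifferentiableAt ℂ q z := fun z hz =>
    hq.differentiableAt (isOpen_rightHalfPlane.mem_nhds hz)
  have hne : ∀ w ∈ rightHalfPlane, w ≠ 2 → DifferentiableAt ℂ (joukowskiProd q u) w := by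
    intro w₀ hw₀ hw2
    have hw₀' : 0 < w₀.re := hw₀
    have hd : w₀ ^ 2 - 4 ≠ 0 := by
      have h1 : w₀ - 2 ≠ 0 := sub_ne_zero.2 hw2
      have h2 : w₀ + 2 ≠ 0 := fun h => by
        have := congrArg Complex.re h
        simp at this
        linarith
      have : w₀ ^ 2 - 4 = (w₀ - 2) * (w₀ + 2) := by ring
      rw [this]
      exact mul_ne_zero h1 h2
    set r₀ := (w₀ ^ 2 - 4) ^ (1 / 2 : ℂ)
    have hr₀ : r₀ ^ 2 = w₀ ^ 2 - 4 := cpow_half_sq _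
    -- A square root of w² - 4 holomorphic near w₀, whatever the position of w₀² - 4 relative to the
    -- cut: the quotient is close to 1.
    set r : ℂ → ℂ := fun w => r₀ * ((w ^ 2 - 4) / (w₀ ^ 2 - 4)) ^ (1 / 2 : ℂ)
    have hr : ∀ w, r w ^ 2 = w ^ 2 - 4 := fun w => by
      simp only [r]
      rw [mul_pow, hr₀, cpow_half_sq]
      field_simp
    have hrd : DifferentiableAt ℂ r w₀ := by
      refine (DifferentiableAt.cpow_const (by fun_prop) ?_).const_mul _
      rw [div_self hd]
      exact Complex.one_mem_slitPlane
    have hvd : DifferentiableAt ℂ (fun w => (w + r w) / 2) w₀ := by fun_prop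
    have hv0 : 0 < ((w₀ + r w₀) / 2).re := (joukowski_root hw₀' (hr w₀)).1
    have hv0' : (w₀ + r w₀) / 2 ≠ 0 := fun h => by simp [h] at hv0
    have heq : joukowskiProd q u =ᶠ[𝓝 w₀]
        fun w => q (u * ((w + r w) / 2)) * q (u / ((w + r w) / 2)) := by
      filter_upwards [isOpen_rightHalfPlane.mem_nhds hw₀] with w hw
      obtain ⟨h1, h2⟩ := joukowski_root hw (hr w)
      rw [← joukowskiProd_eq q u h1, h2]
    refine DifferentiableAt.congr_of_eventuallyEq ?_ heq
    refine DifferentiableAt.mul ?_ ?_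
    · exact DifferentiableAt.comp (g := q) w₀ (hqd _ (hscale hv0)) (hvd.const_mul _)
    · exact DifferentiableAt.comp (g := q) w₀ (hqd _ (hscale' hv0))
        ((differentiableAt_const _).div hvd hv0')
  intro w hw
  rcases eq_or_ne w 2 with rfl | hw2
  · refine (Complex.analyticAt_of_differentiable_on_punctured_nhds_of_continuousAt ?_
      ?_).differentiableAt.differentiableWithinAt
    · filter_upwards [self_mem_nhdsWithin, nhdsWithin_le_nhds (isOpen_rightHalfPlane.mem_nhds hw)]
        with z hz hz' using hne z hz' hz
    · have h0 : ContinuousAt (fun z : ℂ => (z ^ 2 - 4) ^ (1 / 2 : ℂ)) 2 := by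
        refine ContinuousAt.comp (g := fun z : ℂ => z ^ (1 / 2 : ℂ)) ?_
          (by fun_prop : ContinuousAt (fun z : ℂ => z ^ 2 - 4) 2)
        exact Complex.continuousAt_cpow_const_of_re_pos (Or.inl (by norm_num)) (by norm_num)
      have h1 : ContinuousAt (fun w : ℂ => (w + (w ^ 2 - 4) ^ (1 / 2 : ℂ)) / 2) 2 := by fun_prop
      have hv0 := (joukowski_root hw (cpow_half_sq ((2 : ℂ) ^ 2 - 4))).1
      have hv0' : (2 + ((2 : ℂ) ^ 2 - 4) ^ (1 / 2 : ℂ)) / 2 ≠ 0 := fun h => by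
        rw [h] at hv0
        exact hv0.false
      refine ContinuousAt.mul ?_ ?_
      · exact ContinuousAt.comp (g := q) (hqd _ (hscale hv0)).continuousAt (h1.const_mul _)
      · exact ContinuousAt.comp (g := q) (hqd _ (hscale' hv0)).continuousAt
          (continuousAt_const.div h1 hv0')
  · exact (hne w hw hw2).differentiableWithinAt

end Joukowski

/-! ### Extension to w > 0, with a bound -/

section Extension

/-- A weakly HCM function with a holomorphic extension to the right half-plane: the product
`f (u v) f (u / v)` extends to a completely monotone function of `w` on `(0, ∞)`, which is bounded
in terms of the values of `f`. -/
lemma IsWeakHCM.exists_extension {g : ℝ → ℝ} (hg : IsWeakHCM g) (hpos : ∀ x, 0 < x → 0 < g x)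
    {q : ℂ → ℂ} (hq : DifferentiableOn ℂ q rightHalfPlane) (hqg : ∀ x : ℝ, 0 < x → q x = g x)
    (hconj : ∀ z ∈ rightHalfPlane, q (starRingEnd ℂ z) = starRingEnd ℂ (q z)) {u : ℝ} (hu : 0 < u) :
    ∃ Φ : ℝ → ℝ, CMOn (Ioi 0) Φ ∧ (∀ v, 0 < v → g (u * v) * g (u / v) = Φ (v + 1 / v)) ∧
      ∀ w, 0 < w → w < 2 → Φ w ≤ g (u / (4 / w)) ^ 2 * g (u * (4 / w)) ^ 2 /
        (g (u / (4 / w) ^ 2) * g (u * (4 / w) ^ 2)) := by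
  have hHreal : ∀ (s : ℝ), 0 < s → ∀ v : ℝ, 0 < v →
      joukowskiProd q s ((v + 1 / v : ℝ) : ℂ) = (g (s * v) * g (s / v) : ℝ) := fun s hs v hv => by
    have h1 := joukowskiProd_eq q s (v := (v : ℂ)) (by simpa using hv)
    have h2 : ((v + 1 / v : ℝ) : ℂ) = (v : ℂ) + 1 / (v : ℂ) := by push_cast; ring
    rw [h2, h1, ← Complex.ofReal_mul, ← Complex.ofReal_div, hqg _ (by positivity),
      hqg _ (by positivity)]
    push_cast
    ring
  have hHF : ∀ s : ℝ, 0 < s → ∃ F : ℝ → ℝ, CMOn (Ici 2) F ∧ F 2 = g s ^ 2 ∧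
      ∀ w : ℝ, 2 ≤ w → joukowskiProd q s w = F w := by
    intro s hs
    obtain ⟨F, hF, hFg⟩ := hg s hs
    refine ⟨F, hF, ?_, fun w hw => ?_⟩
    · have := hFg 1 one_pos
      norm_num at this
      rw [← this, sq]
    · have h1 := hHreal s hs _ (jroot_pos hw)
      rwa [hFg _ (jroot_pos hw), jroot_add_inv hw] at h1
  have hdiff := fun (s : ℝ) (hs : 0 < s) => differentiableOn_joukowskiProd (u := s) hq hs
  have hCM : ∀ s : ℝ, 0 < s → CMOn (Ioi 0) fun w : ℝ => (joukowskiProd q s w).re := by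
    intro s hs
    obtain ⟨F, hF, -, hFw⟩ := hHF s hs
    exact cmOn_re_of_differentiableOn hF (hdiff s hs) hFw
  refine ⟨fun w => (joukowskiProd q u w).re, hCM u hu, fun v hv => ?_, fun w hw hw2 => ?_⟩
  · simp only [hHreal u hu v hv, Complex.ofReal_re]
  -- Chosen so that ρ Re v = 2 for the v below. Then ρ v + 1/(ρ v) has real part above 2, where
  -- `norm_le_of_cmOn` applies.
  set ρ := 4 / w with hρ
  have hρ0 : 0 < ρ := by positivity
  -- For w < 2 the roots are conjugate on the unit circle, so the product at w is |q(u v)|².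
  set v : ℂ := ⟨w / 2, √(4 - w ^ 2) / 2⟩ with hv
  have hnorm : Complex.normSq v = 1 := by
    rw [Complex.normSq_apply]
    have : √(4 - w ^ 2) * √(4 - w ^ 2) = 4 - w ^ 2 := Real.mul_self_sqrt (by nlinarith)
    simp only [v]
    linear_combination this / 4
  have hvre : 0 < v.re := by simp only [v]; positivity
  have hv0 : v ≠ 0 := fun h => by simp [h] at hvre
  have hinv : 1 / v = starRingEnd ℂ v := by
    rw [one_div, Complex.inv_def, hnorm]
    simp
  have hsum : v + 1 / v = (w : ℂ) := by
    rw [hinv, Complex.add_conj]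
    simp only [v]
    push_cast
    ring
  have hdiv : ∀ s : ℝ, (s : ℂ) / v = starRingEnd ℂ (s * v) := fun s => by
    rw [map_mul, Complex.conj_ofReal, ← hinv, mul_one_div]
  have hmem : ∀ s : ℝ, 0 < s → (s * v : ℂ) ∈ rightHalfPlane := fun s hs => by
    change 0 < (s * v : ℂ).re
    rw [Complex.re_ofReal_mul]
    positivity
  have hsq : ∀ s : ℝ, 0 < s → (joukowskiProd q s w).re = ‖q (s * v)‖ ^ 2 := by
    intro s hs
    rw [← hsum, joukowskiProd_eq q s hvre, hdiv, hconj _ (hmem s hs), Complex.mul_conj,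
      Complex.ofReal_re, Complex.normSq_eq_norm_sq]
  have hlow : ∀ s : ℝ, 0 < s → g s ≤ ‖q (s * v)‖ := by
    intro s hs
    have h1 := (hCM s hs).antitone (x := w) (h := 2 - w) hw (by linarith)
    simp only [add_sub_cancel] at h1
    rw [hsq s hs] at h1
    obtain ⟨F, -, hF2, hFw⟩ := hHF s hs
    rw [hFw 2 le_rfl, Complex.ofReal_re, hF2] at h1
    exact le_of_sq_le_sq h1 (norm_nonneg _)
  have hupp : ∀ s : ℝ, 0 < s → ‖q ((s * ρ : ℝ) * v)‖ * ‖q ((s / ρ : ℝ) * v)‖ ≤ g s ^ 2 := by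
    intro s hs
    have hV : 0 < ((ρ : ℂ) * v).re := hmem ρ hρ0
    have h1 := joukowskiProd_eq q s hV
    have hre : 2 < ((ρ : ℂ) * v + 1 / (ρ * v)).re := by
      have h2 : 1 / ((ρ : ℂ) * v) = ((1 / ρ : ℝ) : ℂ) * starRingEnd ℂ v := by
        rw [← hinv]
        push_cast
        field_simp
      rw [h2, Complex.add_re, Complex.re_ofReal_mul, Complex.re_ofReal_mul, Complex.conj_re]
      have h3 : ρ * v.re = 2 := by simp only [v, ρ]; field_simp; norm_num
      have h4 : 0 < 1 / ρ * v.re := by positivity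
      linarith
    obtain ⟨F, hF, hF2, hFw⟩ := hHF s hs
    have h5 := norm_le_of_cmOn hF (hdiff s hs) hFw hre
    rw [h1, norm_mul, hF2] at h5
    have h6 : (s : ℂ) / (ρ * v) = starRingEnd ℂ ((s / ρ : ℝ) * v) := by
      rw [← hdiv]
      push_cast
      field_simp
    rw [h6, hconj _ (hmem _ (by positivity)), Complex.norm_conj, ← mul_assoc] at h5
    push_cast at h5 ⊢
    exact h5
  -- The upper bounds centred at u / ρ and u ρ both contain the factor |q(u v)|; their other factors
  -- are bounded below by `hlow`.
  have hA := hupp (u / ρ) (by positivity)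
  have hB := hupp (u * ρ) (by positivity)
  rw [div_mul_cancel₀ _ hρ0.ne', div_div, ← sq] at hA
  rw [mul_div_cancel_right₀ _ hρ0.ne', mul_assoc, ← sq] at hB
  have hC := hlow (u / ρ ^ 2) (by positivity)
  have hD := hlow (u * ρ ^ 2) (by positivity)
  have p1 := hpos (u / ρ ^ 2) (by positivity)
  have p2 := hpos (u * ρ ^ 2) (by positivity)
  simp only [hsq u hu]
  rw [le_div_iff₀ (by positivity)]
  calc ‖q (u * v)‖ ^ 2 * (g (u / ρ ^ 2) * g (u * ρ ^ 2))
      ≤ ‖q (u * v)‖ ^ 2 * (‖q ((u / ρ ^ 2 : ℝ) * v)‖ * ‖q ((u * ρ ^ 2 : ℝ) * v)‖) := by gcongr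
    _ = (‖q (u * v)‖ * ‖q ((u / ρ ^ 2 : ℝ) * v)‖) *
        (‖q ((u * ρ ^ 2 : ℝ) * v)‖ * ‖q (u * v)‖) := by ring
    _ ≤ g (u / ρ) ^ 2 * g (u * ρ) ^ 2 := by gcongr

end Extension

/-! ### The substitution y = x / t -/

section DivSubstitution

variable {E : Type*} [NormedAddCommGroup E] [NormedSpace ℝ E] {x : ℝ}

lemma image_const_div_Ioi (hx : 0 < x) : (fun t => x / t) '' Ioi 0 = Ioi 0 := by
  ext y
  simp only [mem_image, mem_Ioi]
  refine ⟨?_, fun hy => ⟨x / y, by positivity, by field_simp⟩⟩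
  rintro ⟨t, ht, rfl⟩
  positivity

lemma injOn_const_div_Ioi (hx : 0 < x) : InjOn (fun t => x / t) (Ioi 0) := by
  intro s hs t ht h
  have hs' : 0 < s := hs
  have ht' : 0 < t := ht
  field_simp at h
  exact h.symm

lemma hasDerivWithinAt_const_div (x : ℝ) {t : ℝ} (ht : t ∈ Ioi (0 : ℝ)) :
    HasDerivWithinAt (fun t => x / t) (-(x / t ^ 2)) (Ioi 0) t := by
  have h := ((hasDerivAt_inv (ne_of_gt ht)).const_mul x).hasDerivWithinAt (s := Ioi 0)
  simp only [← div_eq_mul_inv] at h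
  refine h.congr_deriv ?_
  ring

lemma integral_Ioi_const_div (hx : 0 < x) (g : ℝ → E) :
    ∫ y in Ioi 0, g y = ∫ t in Ioi 0, (x / t ^ 2) • g (x / t) := by
  have := integral_image_eq_integral_abs_deriv_smul measurableSet_Ioi
    (fun t ht => hasDerivWithinAt_const_div x ht) (injOn_const_div_Ioi hx) g
  rw [image_const_div_Ioi hx] at this
  rw [this]
  refine setIntegral_congr_fun measurableSet_Ioi fun t ht => ?_
  have ht' : 0 < t := ht
  simp only [abs_neg]
  rw [abs_of_pos (by positivity)]

lemma integrableOn_Ioi_const_div (hx : 0 < x) {g : ℝ → E} :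
    IntegrableOn g (Ioi 0) ↔ IntegrableOn (fun t => (x / t ^ 2) • g (x / t)) (Ioi 0) := by
  have := integrableOn_image_iff_integrableOn_abs_deriv_smul measurableSet_Ioi
    (fun t ht => hasDerivWithinAt_const_div x ht) (injOn_const_div_Ioi hx) g
  rw [image_const_div_Ioi hx] at this
  rw [this]
  refine integrableOn_congr_fun (fun t ht => ?_) measurableSet_Ioi
  have ht' : 0 < t := ht
  simp only [abs_neg]
  rw [abs_of_pos (by positivity)]

end DivSubstitution

/-! ### Laplace's method for the kernel (t e^(-t))^n -/

section Peak

lemma mul_exp_neg_le {a t : ℝ} (ha : 1 ≤ a) (ht : a ≤ t) :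
    t * Real.exp (-t) ≤ a * Real.exp (-a) := by
  have h1 : t ≤ a * Real.exp (t - a) := by
    have := Real.add_one_le_exp (t - a)
    nlinarith
  calc t * Real.exp (-t) ≤ a * Real.exp (t - a) * Real.exp (-t) := by gcongr
    _ = a * Real.exp (-a) := by rw [mul_assoc, ← Real.exp_add]; ring_nf

lemma mul_exp_neg_lt {t : ℝ} (ht : t ≠ 1) : t * Real.exp (-t) < 1 * Real.exp (-1) := by
  have h1 : t < Real.exp (t - 1) := by
    have := Real.add_one_lt_exp (sub_ne_zero.2 ht)
    linarith
  calc t * Real.exp (-t) < Real.exp (t - 1) * Real.exp (-t) := by gcongr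
    _ = 1 * Real.exp (-1) := by rw [← Real.exp_add]; ring_nf

lemma mul_exp_neg_le_one (t : ℝ) : t * Real.exp (-t) ≤ 1 := by
  have h1 : t ≤ Real.exp t := by
    have := Real.add_one_le_exp t
    linarith
  calc t * Real.exp (-t) ≤ Real.exp t * Real.exp (-t) := by gcongr
    _ = 1 := by rw [← Real.exp_add]; simp

/-- The normalization of the kernel `(t e^{-t}) ^ n`. -/
noncomputable def peakMass (n : ℕ) : ℝ := ∫ t in Icc 0 2, (t * Real.exp (-t)) ^ n

lemma peakMass_ge (n : ℕ) : (3 / 2 * Real.exp (-(3 / 2))) ^ n / 2 ≤ peakMass n := by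
  have hI : IntegrableOn (fun t : ℝ => (t * Real.exp (-t)) ^ n) (Icc 0 2) :=
    (by fun_prop : Continuous fun t : ℝ => (t * Real.exp (-t)) ^ n).continuousOn.integrableOn_Icc
  have hsub : Icc (1 : ℝ) (3 / 2) ⊆ Icc 0 2 := Icc_subset_Icc (by norm_num) (by norm_num)
  have h1 : ∫ t in Icc (1 : ℝ) (3 / 2), (3 / 2 * Real.exp (-(3 / 2))) ^ n =
      (3 / 2 * Real.exp (-(3 / 2))) ^ n / 2 := by
    rw [setIntegral_const, Real.volume_real_Icc_of_le (by norm_num), smul_eq_mul]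
    ring
  rw [← h1]
  refine (setIntegral_mono_on (integrable_const _) (hI.mono_set hsub) measurableSet_Icc
    fun t ht => ?_).trans (setIntegral_mono_set hI ?_ hsub.eventuallyLE)
  · exact pow_le_pow_left₀ (by positivity) (mul_exp_neg_le ht.1 ht.2) n
  · filter_upwards [ae_restrict_mem measurableSet_Icc] with t ht
    have : 0 ≤ t := ht.1
    simp only [Pi.zero_apply]
    positivity

lemma peakMass_pos (n : ℕ) : 0 < peakMass n := lt_of_lt_of_le (by positivity) (peakMass_ge n)

/-- Laplace's method for the powers of `t e^{-t}`, which concentrate at `t = 1`. -/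
lemma tendsto_peak {g : ℝ → ℝ} (hg : IntegrableOn g (Ioi 0)) (hc : ContinuousAt g 1) :
    Tendsto (fun n => (peakMass n)⁻¹ * ∫ t in Ioi 0, (t * Real.exp (-t)) ^ n * g t) atTop
      (𝓝 (g 1)) := by
  have hcont : ∀ n, Continuous fun t : ℝ => (t * Real.exp (-t)) ^ n := fun n => by fun_prop
  have hb : ∀ n, ∀ t ∈ Ioi (0 : ℝ), ‖(t * Real.exp (-t)) ^ n‖ ≤ 1 := fun n t ht => by
    have ht' : 0 < t := ht
    rw [norm_pow, Real.norm_of_nonneg (by positivity)]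
    exact pow_le_one₀ (by positivity) (mul_exp_neg_le_one t)
  have hint : ∀ n, IntegrableOn (fun t => (t * Real.exp (-t)) ^ n * g t) (Ioi 0) := fun n =>
    hg.bdd_mul (c := 1) (hcont n).aestronglyMeasurable
      (by filter_upwards [ae_restrict_mem measurableSet_Ioi] with t ht using hb n t ht)
  have hsplit : ∀ n, ∫ t in Ioi 0, (t * Real.exp (-t)) ^ n * g t =
      (∫ t in Icc 0 2, (t * Real.exp (-t)) ^ n * g t) +
        ∫ t in Ioi 2, (t * Real.exp (-t)) ^ n * g t := fun n => by
    rw [integral_Icc_eq_integral_Ioc, ← setIntegral_union (Ioc_disjoint_Ioi le_rfl)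
      measurableSet_Ioi ((hint n).mono_set Ioc_subset_Ioi_self)
      ((hint n).mono_set (Ioi_subset_Ioi (by norm_num))), Ioc_union_Ioi_eq_Ioi (by norm_num)]
  have hmain : Tendsto (fun n => (peakMass n)⁻¹ * ∫ t in Icc 0 2, (t * Real.exp (-t)) ^ n * g t)
      atTop (𝓝 (g 1)) := by
    have := tendsto_setIntegral_pow_smul_of_unique_maximum_of_isCompact_of_integrableOn
      (μ := volume) (s := Icc (0 : ℝ) 2) (x₀ := 1) (c := fun t => t * Real.exp (-t)) (g := g)
      isCompact_Icc (by fun_prop) (fun y _ hy => mul_exp_neg_lt hy)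
      (fun t ht => mul_nonneg ht.1 (Real.exp_pos _).le) (by positivity)
      (subset_closure (by rw [interior_Icc]; constructor <;> norm_num))
      ((integrableOn_Icc_iff_integrableOn_Ioc (by finiteness)).2 (hg.mono_set Ioc_subset_Ioi_self))
      hc.continuousWithinAt
    simpa only [smul_eq_mul, peakMass] using this
  have htail : Tendsto (fun n => (peakMass n)⁻¹ * ∫ t in Ioi 2, (t * Real.exp (-t)) ^ n * g t)
      atTop (𝓝 0) := by
    -- The kernel is at most a^n beyond 2, while its mass is at least b^n / 2, with b the value of t
    -- e^(-t) at 3/2. As a < b, the tail is negligible.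
    set a : ℝ := 2 * Real.exp (-2)
    set b : ℝ := 3 / 2 * Real.exp (-(3 / 2))
    have ha : 0 ≤ a := by positivity
    have hb0 : 0 < b := by positivity
    have hab : a < b := by
      have h1 := Real.add_one_le_exp (1 / 2)
      have h2 : Real.exp (-(3 / 2)) = Real.exp (1 / 2) * Real.exp (-2) := by
        rw [← Real.exp_add]; norm_num
      simp only [a, b, h2]
      have := Real.exp_pos (-2)
      nlinarith
    have hI : Integrable g (volume.restrict (Ioi 2)) :=
      hg.mono_set (Ioi_subset_Ioi (by norm_num))
    have hlim : Tendsto (fun n : ℕ => 2 * (∫ t in Ioi 2, ‖g t‖) * (a / b) ^ n) atTop (𝓝 0) := by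
      have := (tendsto_pow_atTop_nhds_zero_of_lt_one (by positivity)
        ((div_lt_one hb0).2 hab)).const_mul (2 * ∫ t in Ioi 2, ‖g t‖)
      simpa using this
    refine squeeze_zero_norm (fun n => ?_) hlim
    have h1 : ‖∫ t in Ioi 2, (t * Real.exp (-t)) ^ n * g t‖ ≤ a ^ n * ∫ t in Ioi 2, ‖g t‖ := by
      rw [← integral_const_mul]
      refine norm_integral_le_of_norm_le (hI.norm.const_mul _) ?_
      filter_upwards [ae_restrict_mem measurableSet_Ioi] with t ht
      have ht' : 2 < t := ht
      rw [norm_mul, norm_pow, Real.norm_of_nonneg (by positivity : 0 ≤ t * Real.exp (-t))]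
      gcongr
      exact mul_exp_neg_le (by norm_num) ht'.le
    have h2 : (peakMass n)⁻¹ ≤ 2 / b ^ n := by
      rw [inv_le_comm₀ (peakMass_pos n) (by positivity), inv_div]
      exact peakMass_ge n
    rw [norm_mul, Real.norm_of_nonneg (inv_nonneg.2 (peakMass_pos n).le)]
    calc (peakMass n)⁻¹ * ‖∫ t in Ioi 2, (t * Real.exp (-t)) ^ n * g t‖
        ≤ 2 / b ^ n * (a ^ n * ∫ t in Ioi 2, ‖g t‖) := by gcongr
      _ = 2 * (∫ t in Ioi 2, ‖g t‖) * (a / b) ^ n := by rw [div_pow]; ring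
  have := hmain.add htail
  rw [add_zero] at this
  refine this.congr fun n => ?_
  rw [hsplit, mul_add]

end Peak

/-! ### Multiplicative smoothing of a weakly HCM function -/

section Smoothing

variable {f : ℝ → ℝ}

lemma IsWeakHCM.mul_le_sq (hf : IsWeakHCM f) {u v : ℝ} (hu : 0 < u) (hv : 0 < v) :
    f (u * v) * f (u / v) ≤ f u ^ 2 := by
  obtain ⟨F, hF, hFf⟩ := hf u hu
  have h1 := hFf 1 one_pos
  norm_num at h1
  have h2 := hF.antitone (x := 2) (h := v + 1 / v - 2) self_mem_Ici
    (by linarith [two_le_add_inv hv])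
  rw [add_sub_cancel] at h2
  rw [hFf v hv, sq, h1]
  exact h2

/-- In logarithmic coordinates log f is measurable and midpoint concave, hence continuous; this is
what lets the smoothings converge at every point. -/
lemma IsWeakHCM.continuousOn (hf : IsWeakHCM f) (hm : Measurable f) (hpos : ∀ x, 0 < x → 0 < f x) :
    ContinuousOn f (Ioi 0) := by
  have hc : Continuous fun s => Real.log (f (Real.exp s)) := by
    refine continuous_of_midpoint_concave (by fun_prop) fun s t => ?_
    have h := hf.mul_le_sq (Real.exp_pos s) (Real.exp_pos t)
    rw [← Real.exp_add, ← Real.exp_sub] at h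
    have p1 := hpos _ (Real.exp_pos (s + t))
    have p2 := hpos _ (Real.exp_pos (s - t))
    have := Real.log_le_log (by positivity) h
    rw [Real.log_mul p1.ne' p2.ne', Real.log_pow] at this
    exact_mod_cast this
  have h2 : ContinuousOn (fun x => Real.exp (Real.log (f (Real.exp (Real.log x))))) (Ioi 0) :=
    Real.continuous_exp.comp_continuousOn (hc.comp_continuousOn
      (Real.continuousOn_log.mono fun x hx => ne_of_gt hx))
  refine h2.congr fun x hx => ?_
  simp only [Real.exp_log hx, Real.exp_log (hpos x hx)]

/-- The kernel of the multiplicative convolution of `f` with `(t e^{-t}) ^ n`. -/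
noncomputable def smoothKernel (f : ℝ → ℝ) (n : ℕ) (p : ℝ × ℝ) : ℝ :=
  p.1⁻¹ * ((p.1 / p.2) * Real.exp (-(p.1 / p.2))) ^ n * f p.2

lemma measurable_smoothKernel (hm : Measurable f) (n : ℕ) : Measurable (smoothKernel f n) := by
  unfold smoothKernel
  fun_prop

lemma smoothKernel_pos (hpos : ∀ x, 0 < x → 0 < f x) (n : ℕ) {x y : ℝ} (hx : 0 < x) (hy : 0 < y) :
    0 < smoothKernel f n (x, y) := by
  have := hpos y hy
  unfold smoothKernel
  positivity

/-- The exponentials combine to exp(-n (u₁/u₂) w₃), the powers to a constant, and f contributes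
F(w₂). As F is controlled only on [2, ∞), only the weak form is available. -/
lemma IsWeakHCM.isWeakBVHCM_smoothKernel (hf : IsWeakHCM f) (n : ℕ) : IsWeakBVHCM (smoothKernel f n) := by
  intro u₁ u₂ hu₁ hu₂
  obtain ⟨F, hF, hFf⟩ := hf u₂ hu₂
  have hS : IsUpperSet (Ici (![1, 2, 2] : Fin 3 → ℝ)) := isUpperSet_Ici _
  refine ⟨fun x => (u₁⁻¹ ^ 2 * ((u₁ / u₂) ^ n) ^ 2) * (Real.exp (-((n * (u₁ / u₂)) * x 2)) * F (x 1)),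
    ?_, fun v₁ v₂ hv₁ hv₂ => ?_⟩
  · have h1 : CMOn (Ici (![1, 2, 2] : Fin 3 → ℝ))
        fun x : Fin 3 → ℝ => Real.exp (-((n * (u₁ / u₂)) * x 2)) :=
      (cmOn_exp_neg_mul univ (by positivity : 0 ≤ n * (u₁ / u₂))).comp (A := fun x : Fin 3 → ℝ => x 2)
        (L := fun x : Fin 3 → ℝ => x 2) (fun _ _ => rfl) (fun h hh => hh 2) fun x _ => mem_univ _
    have h2 : CMOn (Ici (![1, 2, 2] : Fin 3 → ℝ)) fun x : Fin 3 → ℝ => F (x 1) :=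
      hF.comp (A := fun x : Fin 3 → ℝ => x 1) (L := fun x : Fin 3 → ℝ => x 1) (fun _ _ => rfl) (fun h hh => hh 1)
        fun x hx => hx 1
    exact (h1.mul hS h2).const_mul (by positivity)
  · have h1 := hFf v₂ hv₂
    simp only [smoothKernel, Matrix.cons_val]
    rw [← h1]
    have h2 : Real.exp (-((n * (u₁ / u₂)) * (v₁ / v₂ + v₂ / v₁))) =
        Real.exp (-(u₁ * v₁ / (u₂ * v₂))) ^ n * Real.exp (-(u₁ / v₁ / (u₂ / v₂))) ^ n := by
      rw [← Real.exp_nat_mul, ← Real.exp_nat_mul, ← Real.exp_add]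
      congr 1
      field_simp
      ring
    rw [h2]
    simp only [mul_pow, div_pow, inv_pow, mul_inv, inv_div]
    field_simp

lemma integrableOn_smoothKernel (hint : IntegrableOn f (Ioi 0)) (n : ℕ) {x : ℝ}
    (hx : 0 < x) : IntegrableOn (fun y => smoothKernel f n (x, y)) (Ioi 0) := by
  unfold smoothKernel
  simp only
  refine hint.bdd_mul (c := x⁻¹) (by fun_prop) ?_
  filter_upwards [ae_restrict_mem measurableSet_Ioi] with y hy
  have hy' : 0 < y := hy
  rw [norm_mul, norm_pow, Real.norm_of_nonneg (by positivity : 0 ≤ x⁻¹),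
    Real.norm_of_nonneg (by positivity : 0 ≤ x / y * Real.exp (-(x / y)))]
  exact mul_le_of_le_one_right (by positivity) (pow_le_one₀ (by positivity) (mul_exp_neg_le_one _))

lemma lintegral_smoothKernel_lt_top (hint : IntegrableOn f (Ioi 0)) (n : ℕ)
    {x : ℝ} (hx : 0 < x) : ∫⁻ y in Ioi 0, ENNReal.ofReal (smoothKernel f n (x, y)) < ⊤ :=
  (lintegral_mono fun _ => Real.ofReal_le_enorm _).trans_lt
    (integrableOn_smoothKernel hint n hx).hasFiniteIntegral

lemma marginalDensity_smoothKernel_pos (hint : IntegrableOn f (Ioi 0))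
    (hpos : ∀ x, 0 < x → 0 < f x) (n : ℕ) {x : ℝ} (hx : 0 < x) :
    0 < marginalDensity (smoothKernel f n) x := by
  refine (setIntegral_pos_iff_support_of_nonneg_ae ?_ (integrableOn_smoothKernel hint n hx)).2 ?_
  · filter_upwards [ae_restrict_mem measurableSet_Ioi] with y hy
    exact (smoothKernel_pos hpos n hx hy).le
  · have : Function.support (fun y => smoothKernel f n (x, y)) ∩ Ioi 0 = Ioi 0 :=
      inter_eq_right.2 fun y hy => (smoothKernel_pos hpos n hx hy).ne'
    rw [this]
    simp

/-- With y = x / t the marginal becomes the integral of (t e^(-t))^n against t^(-2) f(x / t), whose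
value at the peak t = 1 is f x. -/
lemma tendsto_marginalDensity_smoothKernel (hint : IntegrableOn f (Ioi 0))
    (hc : ContinuousOn f (Ioi 0)) {x : ℝ} (hx : 0 < x) :
    Tendsto (fun n => (peakMass n)⁻¹ * marginalDensity (smoothKernel f n) x) atTop (𝓝 (f x)) := by
  have hg : IntegrableOn (fun t => (t ^ 2)⁻¹ * f (x / t)) (Ioi 0) := by
    have := ((integrableOn_Ioi_const_div hx).1 hint).const_mul x⁻¹
    refine this.congr (Eventually.of_forall fun t => ?_)
    simp only [smul_eq_mul]
    field_simp
  have hc1 : ContinuousAt (fun t => (t ^ 2)⁻¹ * f (x / t)) 1 := by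
    have h1 : ContinuousAt f (x / 1) := hc.continuousAt (Ioi_mem_nhds (by simpa using hx))
    have h2 : ContinuousAt (fun t : ℝ => x / t) 1 := by
      fun_prop (disch := norm_num)
    have h3 : ContinuousAt (fun t : ℝ => (t ^ 2)⁻¹) 1 := by
      fun_prop (disch := norm_num)
    exact h3.mul (ContinuousAt.comp (g := f) h1 h2)
  have h := tendsto_peak hg hc1
  simp only [one_pow, inv_one, div_one, one_mul] at h
  refine h.congr fun n => ?_
  congr 1
  unfold marginalDensity smoothKernel
  rw [integral_Ioi_const_div hx]
  refine setIntegral_congr_fun measurableSet_Ioi fun t ht => ?_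
  have ht' : 0 < t := ht
  have : x / (x / t) = t := by field_simp
  simp only [smul_eq_mul, this]
  field_simp

end Smoothing

/-! ### Holomorphic extension of the smoothings -/

section SmoothingExtension

variable {f : ℝ → ℝ}

/-- The measure whose Laplace transform describes the smoothing of `f`. -/
noncomputable def smoothMeasure (f : ℝ → ℝ) (n : ℕ) : Measure ℝ :=
  (volume.restrict (Ioi 0)).withDensity fun y => ENNReal.ofReal ((y ^ n)⁻¹ * f y)

/-- Apart from x^n, the variable x occurs only in an exponential, so the smoothing is x^n times a
moment generating function. The index n + 1 absorbs the factor x⁻¹. -/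
lemma smoothKernel_eq (f : ℝ → ℝ) (n : ℕ) {x y : ℝ} (hx : 0 < x) (hy : 0 < y) :
    smoothKernel f (n + 1) (x, y) =
      x ^ n * (((y ^ (n + 1))⁻¹ * f y) * Real.exp (x * (-(n + 1) / y))) := by
  have h : Real.exp (x * (-(n + 1) / y)) = Real.exp (-(x / y)) ^ (n + 1) := by
    rw [← Real.exp_nat_mul]
    push_cast
    congr 1
    field_simp
  rw [h]
  simp only [smoothKernel, mul_pow, div_pow]
  field_simp
  ring

lemma integral_smoothMeasure (hm : Measurable f) (hpos : ∀ x, 0 < x → 0 < f x) (n : ℕ)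
    (g : ℝ → ℝ) : ∫ y, g y ∂smoothMeasure f n = ∫ y in Ioi 0, (y ^ n)⁻¹ * f y * g y := by
  unfold smoothMeasure
  rw [integral_withDensity_eq_integral_toReal_smul (by fun_prop) (by simp)]
  refine setIntegral_congr_fun measurableSet_Ioi fun y hy => ?_
  have hy' : 0 < y := hy
  have := hpos y hy
  simp only [smul_eq_mul]
  rw [ENNReal.toReal_ofReal (by positivity)]

lemma Ioi_subset_integrableExpSet_smoothMeasure (hm : Measurable f)
    (hint : IntegrableOn f (Ioi 0)) (hpos : ∀ x, 0 < x → 0 < f x) (n : ℕ) :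
    Ioi 0 ⊆ integrableExpSet (fun y : ℝ => -(n + 1) / y) (smoothMeasure f (n + 1)) := by
  intro x hx
  have hx' : 0 < x := hx
  change Integrable _ _
  unfold smoothMeasure
  rw [integrable_withDensity_iff_integrable_smul' (by fun_prop) (by simp)]
  refine ((integrableOn_smoothKernel hint (n + 1) hx).const_mul (x ^ n)⁻¹).congr ?_
  filter_upwards [ae_restrict_mem measurableSet_Ioi] with y hy
  have hy' : 0 < y := hy
  have := hpos y hy
  rw [smoothKernel_eq f n hx hy, inv_mul_cancel_left₀ (by positivity), smul_eq_mul,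
    ENNReal.toReal_ofReal (by positivity)]

lemma marginalDensity_smoothKernel_eq (hm : Measurable f) (hpos : ∀ x, 0 < x → 0 < f x) (n : ℕ)
    {x : ℝ} (hx : 0 < x) : marginalDensity (smoothKernel f (n + 1)) x =
      x ^ n * mgf (fun y : ℝ => -(n + 1) / y) (smoothMeasure f (n + 1)) x := by
  rw [mgf, integral_smoothMeasure hm hpos, marginalDensity, ← integral_const_mul]
  exact setIntegral_congr_fun measurableSet_Ioi fun y hy => smoothKernel_eq f n hx hy

lemma complexMGF_conj {Ω : Type*} [MeasurableSpace Ω] (X : Ω → ℝ) (μ : Measure Ω) (z : ℂ) :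
    complexMGF X μ (starRingEnd ℂ z) = starRingEnd ℂ (complexMGF X μ z) := by
  rw [complexMGF, complexMGF, ← integral_conj]
  refine integral_congr_ae (Eventually.of_forall fun ω => ?_)
  simp only [← Complex.exp_conj, map_mul, Complex.conj_ofReal]

/-- The normalized smoothings of `f` satisfy the extension property of weakly HCM functions with
a holomorphic extension. -/
lemma IsWeakHCM.exists_extension_smooth (hf : IsWeakHCM f) (hm : Measurable f)
    (hpos : ∀ x, 0 < x → 0 < f x) (hint : IntegrableOn f (Ioi 0)) (n : ℕ) {u : ℝ} (hu : 0 < u)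
    {g : ℝ → ℝ}
    (hg : g = fun x => (peakMass (n + 1))⁻¹ * marginalDensity (smoothKernel f (n + 1)) x) :
    ∃ Φ : ℝ → ℝ, CMOn (Ioi 0) Φ ∧ (∀ v, 0 < v → g (u * v) * g (u / v) = Φ (v + 1 / v)) ∧
      ∀ w, 0 < w → w < 2 → Φ w ≤ g (u / (4 / w)) ^ 2 * g (u * (4 / w)) ^ 2 /
        (g (u / (4 / w) ^ 2) * g (u * (4 / w) ^ 2)) := by
  have hC := peakMass_pos (n + 1)
  set X : ℝ → ℝ := fun y => -(n + 1) / y with hX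
  set ν := smoothMeasure f (n + 1)
  refine IsWeakHCM.exists_extension (g := g)
    (q := fun z => ((peakMass (n + 1))⁻¹ : ℝ) * (z ^ n * complexMGF X ν z)) ?_ ?_ ?_ ?_ ?_ hu
  · intro s hs
    obtain ⟨F, hF, hFg⟩ := IsWeakBVHCM.marginal (measurable_smoothKernel hm (n + 1))
      (fun x y hx hy => (smoothKernel_pos hpos _ hx hy).le) (hf.isWeakBVHCM_smoothKernel (n + 1))
      (fun x hx => lintegral_smoothKernel_lt_top hint _ hx) s hs
    refine ⟨fun w => (peakMass (n + 1))⁻¹ ^ 2 * F w, hF.const_mul (by positivity), fun v hv => ?_⟩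
    simp only [hg]
    rw [← hFg v hv]
    ring
  · intro x hx
    have := marginalDensity_smoothKernel_pos hint hpos (n + 1) hx
    simp only [hg]
    positivity
  · have hd : DifferentiableOn ℂ (complexMGF X ν) rightHalfPlane := by
      refine differentiableOn_complexMGF.mono fun z hz => ?_
      exact interior_maximal (Ioi_subset_integrableExpSet_smoothMeasure hm hint hpos n) isOpen_Ioi hz
    fun_prop
  · intro x hx
    simp only [hg]
    rw [marginalDensity_smoothKernel_eq hm hpos n hx, complexMGF_ofReal]
    push_cast
    rfl
  · intro z hz
    simp only [complexMGF_conj, map_mul, map_pow, Complex.conj_ofReal]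

end SmoothingExtension

/-! ### From w ≥ 2 to w > 0 by passing to the limit -/

section WeakToStrong

variable {f : ℝ → ℝ}

/-- A positive integrable weakly HCM function is HCM. -/
theorem IsWeakHCM.isHCM (hf : IsWeakHCM f) (hm : Measurable f) (hpos : ∀ x, 0 < x → 0 < f x)
    (hint : IntegrableOn f (Ioi 0)) : IsHCM f := by
  refine ⟨fun x hx => (hpos x hx).le, fun u hu => ?_⟩
  set g : ℕ → ℝ → ℝ := fun n x =>
    (peakMass (n + 1))⁻¹ * marginalDensity (smoothKernel f (n + 1)) x with hg
  have hlim : ∀ x, 0 < x → Tendsto (fun n => g n x) atTop (𝓝 (f x)) := fun x hx =>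
    (tendsto_marginalDensity_smoothKernel hint (hf.continuousOn hm hpos) hx).comp
      (tendsto_add_atTop_nat 1)
  choose Φ hΦ hΦg hΦle using fun n => hf.exists_extension_smooth hm hpos hint n hu (g := g n) rfl
  -- For w ≥ 2 the values converge. For w < 2 they are bounded by an expression in real values of
  -- the smoothings, which converges because its limiting denominator is positive.
  have hbdd : ∀ w, 0 < w → ∃ M, ∀ n, Φ n w ≤ M := by
    intro w hw
    rcases le_or_gt 2 w with h2 | h2
    · have hv := jroot_pos h2
      have hl := (hlim (u * jroot w) (by positivity)).mul (hlim (u / jroot w) (by positivity))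
      obtain ⟨M, hM⟩ := hl.bddAbove_range
      refine ⟨M, fun n => ?_⟩
      rw [← jroot_add_inv h2, ← hΦg n _ hv]
      exact hM ⟨n, rfl⟩
    · set r := 4 / w
      have hr : 0 < r := by positivity
      have p1 := hpos (u / r ^ 2) (by positivity)
      have p2 := hpos (u * r ^ 2) (by positivity)
      have hl := (((hlim (u / r) (by positivity)).pow 2).mul
        ((hlim (u * r) (by positivity)).pow 2)).div
        ((hlim (u / r ^ 2) (by positivity)).mul (hlim (u * r ^ 2) (by positivity)))
        (mul_pos p1 p2).ne'
      obtain ⟨M, hM⟩ := hl.bddAbove_range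
      exact ⟨M, fun n => (hΦle n w hw h2).trans (hM ⟨n, rfl⟩)⟩
  -- A single ultrafilter serves all w at once, so boundedness at each point yields a pointwise
  -- limit function.
  have hex : ∀ w, ∃ L, 0 < w → Tendsto (fun n => Φ n w) (hyperfilter ℕ) (𝓝 L) := by
    intro w
    by_cases hw : 0 < w
    · obtain ⟨M, hM⟩ := hbdd w hw
      have hmem : ∀ n, Φ n w ∈ Icc 0 M := fun n => ⟨(hΦ n).nonneg hw, hM n⟩
      obtain ⟨L, -, hL⟩ := isCompact_Icc.ultrafilter_le_nhds ((hyperfilter ℕ).map fun n => Φ n w)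
        (by
          rw [le_principal_iff]
          exact mem_map.2 (Eventually.of_forall hmem))
      exact ⟨L, fun _ => hL⟩
    · exact ⟨0, fun h => absurd h hw⟩
  choose G hG using hex
  have hGcm : CMOn (Ioi 0) G := CMOn.of_tendsto (u := (hyperfilter ℕ : Filter ℕ)) (F := Φ)
    (isUpperSet_Ioi 0) (Eventually.of_forall hΦ) fun w hw => hG w hw
  refine ⟨G, hGcm.isCM, fun v hv => ?_⟩
  have hl := (hlim (u * v) (by positivity)).mul (hlim (u / v) (by positivity))
  simp only [hΦg _ v hv] at hl
  exact tendsto_nhds_unique (hl.mono_left Nat.hyperfilter_le_atTop) (hG _ (by positivity))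

end WeakToStrong

/-! ### v^r + v^(-r) as a Bernstein function of v + 1/v -/

section PowerBernstein

variable {r : ℝ}

/-- The integrand of the representation of `v ^ r + v ^ (-r)` in terms of `w = v + 1 / v`. -/
noncomputable def powIntegrand (r t w : ℝ) : ℝ :=
  (t ^ r / t + t ^ (-r) / t) - (t ^ 2 - 1) * (t ^ r / t - t ^ (-r) / t) * (1 + t ^ 2 + t * w)⁻¹

/-- Symmetrizing the integral formula for v^r in v and 1/v yields a function of w, but with a
coefficient changing sign at t = 1. Pairing t with 1/t repairs this. -/
lemma powIntegrand_eq_rpowIntegrand {t v : ℝ} (ht : 0 < t) (hv : 0 < v) :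
    powIntegrand r t (v + 1 / v) = (Real.rpowIntegrand₀₁ r t v + Real.rpowIntegrand₀₁ r t (1 / v)) +
      (1 / t ^ 2) •
        (Real.rpowIntegrand₀₁ r (1 / t) v + Real.rpowIntegrand₀₁ r (1 / t) (1 / v)) := by
  have h : (1 / t) ^ r = t ^ (-r) := by
    rw [one_div, Real.inv_rpow ht.le, Real.rpow_neg ht.le]
  simp only [powIntegrand, Real.rpowIntegrand₀₁, h, smul_eq_mul]
  generalize t ^ r = p
  generalize t ^ (-r) = q
  have h1 : t + v ≠ 0 := by positivity
  have h2 : 1 + t * v ≠ 0 := by positivity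
  have h3 : 1 + t ^ 2 + t * (v + 1 / v) ≠ 0 := by positivity
  have h4 : 1 + t ^ 2 + t * (v + 1 / v) = (t + v) * (1 + t * v) / v := by field_simp; ring
  have h5 : t + 1 / v = (1 + t * v) / v := by field_simp; ring
  have h6 : 1 / t + v = (1 + t * v) / t := by field_simp
  have h7 : 1 / t + 1 / v = (t + v) / (t * v) := by field_simp; ring
  rw [h4, h5, h6, h7]
  field_simp
  ring

lemma powIntegrand_coeff_nonneg (hr : 0 ≤ r) {t : ℝ} (ht : 0 < t) :
    0 ≤ (t ^ 2 - 1) * (t ^ r / t - t ^ (-r) / t) := by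
  rw [← sub_div]
  rcases le_total 1 t with h | h
  · have h1 : t ^ (-r) ≤ t ^ r := Real.rpow_le_rpow_of_exponent_le h (by linarith)
    exact mul_nonneg (by nlinarith) (div_nonneg (by linarith) ht.le)
  · have h1 : t ^ r ≤ t ^ (-r) := Real.rpow_le_rpow_of_exponent_ge ht h (by linarith)
    exact mul_nonneg_of_nonpos_of_nonpos (by nlinarith)
      (div_nonpos_of_nonpos_of_nonneg (by linarith) ht.le)

lemma powIntegrand_pos {t w : ℝ} (ht : 0 < t) (hw : 0 < w) : 0 < powIntegrand r t w := by
  have h : powIntegrand r t w =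
      (t ^ r * (2 + t * w) / t + t ^ (-r) * (2 * t + w)) * (1 + t ^ 2 + t * w)⁻¹ := by
    unfold powIntegrand
    have : 1 + t ^ 2 + t * w ≠ 0 := by positivity
    field_simp
    ring
  rw [h]
  positivity

lemma powIntegrand_mono (hr : 0 ≤ r) {t w w' : ℝ} (ht : 0 < t) (hw : 0 < w) (h : w ≤ w') :
    powIntegrand r t w ≤ powIntegrand r t w' := by
  unfold powIntegrand
  have := powIntegrand_coeff_nonneg hr ht
  gcongr

lemma continuousOn_powIntegrand (r : ℝ) {w : ℝ} (hw : 0 < w) :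
    ContinuousOn (fun t => powIntegrand r t w) (Ioi 0) := by
  unfold powIntegrand
  intro t ht
  have ht' : 0 < t := ht
  have h1 : 1 + t ^ 2 + t * w ≠ 0 := by positivity
  refine ContinuousAt.continuousWithinAt ?_
  have h2 : ContinuousAt (fun t : ℝ => t ^ r) t := Real.continuousAt_rpow_const _ _ (Or.inl ht'.ne')
  have h3 : ContinuousAt (fun t : ℝ => t ^ (-r)) t :=
    Real.continuousAt_rpow_const _ _ (Or.inl ht'.ne')
  have h4 := ht'.ne'
  fun_prop (disch := assumption)

lemma integrableOn_powIntegrand_add_inv (hr : r ∈ Ioo 0 1) {v : ℝ} (hv : 0 < v) :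
    IntegrableOn (fun t => powIntegrand r t (v + 1 / v)) (Ioi 0) ∧
      ∫ t in Ioi 0, powIntegrand r t (v + 1 / v) =
        2 * (∫ t in Ioi 0, Real.rpowIntegrand₀₁ r t 1) * (v ^ r + v ^ (-r)) := by
  set R : ℝ → ℝ := fun t => Real.rpowIntegrand₀₁ r t v + Real.rpowIntegrand₀₁ r t (1 / v)
  have hv1 : 0 ≤ 1 / v := by positivity
  have i1 := Real.integrableOn_rpowIntegrand₀₁_Ioi hr hv.le
  have i2 := Real.integrableOn_rpowIntegrand₀₁_Ioi hr hv1
  have hR : IntegrableOn R (Ioi 0) := i1.add i2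
  have hR' := (integrableOn_Ioi_const_div one_pos).1 hR
  have heq : EqOn (fun t => powIntegrand r t (v + 1 / v))
      (fun t => R t + (1 / t ^ 2) • R (1 / t)) (Ioi 0) := fun t ht =>
    powIntegrand_eq_rpowIntegrand ht hv
  refine ⟨(integrableOn_congr_fun heq measurableSet_Ioi).2 (hR.add hR'), ?_⟩
  have hK := (Real.integral_rpowIntegrand₀₁_one_pos hr).ne'
  rw [setIntegral_congr_fun measurableSet_Ioi heq, integral_add hR hR',
    ← integral_Ioi_const_div one_pos R]
  have h2 : ∫ t in Ioi 0, R t =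
      (∫ t in Ioi 0, Real.rpowIntegrand₀₁ r t 1) * (v ^ r + v ^ (-r)) := by
    rw [integral_add i1 i2, Real.rpow_neg hv.le, ← Real.inv_rpow hv.le, ← one_div,
      Real.rpow_eq_const_mul_integral hr hv.le, Real.rpow_eq_const_mul_integral hr hv1]
    field_simp
  rw [h2]
  ring

/-- The integrand is positive and increasing in w, hence dominated by its value at max w 2, which is
of the form v + 1/v. -/
lemma integrableOn_powIntegrand (hr : r ∈ Ioo 0 1) {w : ℝ} (hw : 0 < w) :
    IntegrableOn (fun t => powIntegrand r t w) (Ioi 0) := by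
  have h2 : 2 ≤ max w 2 := le_max_right _ _
  have hi := (integrableOn_powIntegrand_add_inv hr (jroot_pos h2)).1
  rw [jroot_add_inv h2] at hi
  refine hi.mono' ((continuousOn_powIntegrand r hw).aestronglyMeasurable measurableSet_Ioi) ?_
  filter_upwards [ae_restrict_mem measurableSet_Ioi] with t ht
  rw [Real.norm_of_nonneg (powIntegrand_pos ht hw).le]
  exact powIntegrand_mono hr.1.le ht hw (le_max_left _ _)

/-- On a compact interval the integral splits as a constant minus a completely monotone function D,
so the exponential is a positive constant times exp (c D). -/
lemma cmOn_exp_neg_setIntegral_powIntegrand (hr : r ∈ Ioo 0 1) {a b c : ℝ} (ha : 0 < a)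
    (hc : 0 ≤ c) :
    CMOn (Ioi 0) fun w => Real.exp (-(c * ∫ t in Icc a b, powIntegrand r t w)) := by
  have hsub : Icc a b ⊆ Ioi 0 := fun t ht => ha.trans_le ht.1
  set A : ℝ → ℝ := fun t => t ^ r / t + t ^ (-r) / t
  set K : ℝ → ℝ → ℝ := fun t w =>
    (t ^ 2 - 1) * (t ^ r / t - t ^ (-r) / t) * (1 + t ^ 2 + t * w)⁻¹
  have hA : IntegrableOn A (Icc a b) := by
    refine ContinuousOn.integrableOn_Icc fun t ht => ContinuousAt.continuousWithinAt ?_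
    have ht' : 0 < t := hsub ht
    have h2 : ContinuousAt (fun t : ℝ => t ^ r) t :=
      Real.continuousAt_rpow_const _ _ (Or.inl ht'.ne')
    have h3 : ContinuousAt (fun t : ℝ => t ^ (-r)) t :=
      Real.continuousAt_rpow_const _ _ (Or.inl ht'.ne')
    have h4 := ht'.ne'
    fun_prop (disch := assumption)
  have hI : ∀ w ∈ Ioi (0 : ℝ), IntegrableOn (fun t => powIntegrand r t w) (Icc a b) := fun w hw =>
    (integrableOn_powIntegrand hr hw).mono_set hsub
  have hKI : ∀ w ∈ Ioi (0 : ℝ), IntegrableOn (fun t => K t w) (Icc a b) := fun w hw => by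
    refine (hA.sub (hI w hw)).congr (Eventually.of_forall fun t => ?_)
    simp only [Pi.sub_apply, A, K, powIntegrand]
    ring
  have hD : CMOn (Ioi 0) fun w => ∫ t in Icc a b, K t w := by
    refine CMOn.integral (isUpperSet_Ioi 0) ?_ hKI
    filter_upwards [ae_restrict_mem measurableSet_Icc] with t ht
    have ht' : 0 < t := hsub ht
    exact (cmOn_inv_add (by positivity) ht'.le).const_mul (powIntegrand_coeff_nonneg hr.1.le ht')
  refine (((hD.const_mul hc).exp (isUpperSet_Ioi 0)).const_mul
    (Real.exp_pos (-(c * ∫ t in Icc a b, A t))).le).congr (isUpperSet_Ioi 0) fun w hw => ?_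
  have h : ∫ t in Icc a b, powIntegrand r t w = (∫ t in Icc a b, A t) - ∫ t in Icc a b, K t w := by
    rw [← integral_sub hA (hKI w hw)]
    rfl
  rw [h, ← Real.exp_add]
  congr 1
  ring

lemma iUnion_Icc_inv : ⋃ N : ℕ, Icc ((N : ℝ) + 1)⁻¹ (N + 1) = Ioi 0 := by
  ext t
  simp only [mem_iUnion, mem_Icc, mem_Ioi]
  refine ⟨fun ⟨N, hN, _⟩ => lt_of_lt_of_le (by positivity) hN, fun ht => ?_⟩
  obtain ⟨N, hN⟩ := exists_nat_ge (max t t⁻¹)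
  refine ⟨N, ?_, ?_⟩
  · rw [inv_le_comm₀ (by positivity) ht]
    linarith [le_max_right t t⁻¹]
  · linarith [le_max_left t t⁻¹]

lemma monotone_Icc_inv : Monotone fun N : ℕ => Icc ((N : ℝ) + 1)⁻¹ (N + 1) := by
  intro M N h
  have : (M : ℝ) ≤ N := by exact_mod_cast h
  exact Icc_subset_Icc (by gcongr) (by gcongr)

/-- For `0 < r ≤ 1`, `v ^ r + v ^ (-r)` is a positive function of `w = v + 1 / v`, extending to a
Bernstein function on `(0, ∞)`. -/
lemma exists_bernstein_rpow (hr0 : 0 < r) (hr1 : r ≤ 1) : ∃ B : ℝ → ℝ, (∀ w, 0 < w → 0 < B w) ∧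
    (∀ c, 0 ≤ c → CMOn (Ioi 0) fun w => Real.exp (-(c * B w))) ∧
    ∀ v, 0 < v → B (v + 1 / v) = v ^ r + v ^ (-r) := by
  rcases hr1.eq_or_lt with rfl | hr1
  · refine ⟨id, fun w hw => hw, fun c hc => cmOn_exp_neg_mul _ hc, fun v hv => ?_⟩
    rw [Real.rpow_one, Real.rpow_neg_one, id, one_div]
  have hr : r ∈ Ioo 0 1 := ⟨hr0, hr1⟩
  have hK := Real.integral_rpowIntegrand₀₁_one_pos hr
  set k := (2 * ∫ t in Ioi 0, Real.rpowIntegrand₀₁ r t 1)⁻¹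
  have hk : 0 < k := by positivity
  refine ⟨fun w => k * ∫ t in Ioi 0, powIntegrand r t w, fun w hw => ?_, fun c hc => ?_,
    fun v hv => ?_⟩
  · refine mul_pos hk ((setIntegral_pos_iff_support_of_nonneg_ae ?_
      (integrableOn_powIntegrand hr hw)).2 ?_)
    · filter_upwards [ae_restrict_mem measurableSet_Ioi] with t ht using (powIntegrand_pos ht hw).le
    · have h : Function.support (fun t => powIntegrand r t w) ∩ Ioi 0 = Ioi 0 :=
        inter_eq_right.2 fun t ht => (powIntegrand_pos ht hw).ne'
      rw [h]
      simp
  -- The splitting into a constant and a CM part diverges on the whole half-line, hence the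
  -- exhaustion by compact intervals.
  · refine CMOn.of_tendsto (isUpperSet_Ioi 0) (u := atTop) (F := fun (N : ℕ) w =>
      Real.exp (-((c * k) * ∫ t in Icc ((N : ℝ) + 1)⁻¹ (N + 1), powIntegrand r t w)))
      (Eventually.of_forall fun N =>
        cmOn_exp_neg_setIntegral_powIntegrand hr (by positivity) (by positivity)) fun w hw => ?_
    have hi := integrableOn_powIntegrand hr hw
    rw [← iUnion_Icc_inv] at hi ⊢
    have := tendsto_setIntegral_of_monotone (fun N => measurableSet_Icc) monotone_Icc_inv hi
    simp only [← mul_assoc]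
    exact (Real.continuous_exp.tendsto _).comp (this.const_mul (c * k)).neg
  · simp only [(integrableOn_powIntegrand_add_inv hr hv).2]
    rw [← mul_assoc, inv_mul_cancel₀ (by positivity), one_mul]

end PowerBernstein

/-! ### Composition with Bernstein functions -/

section Composition

variable {n : ℕ}

lemma CMOn.of_forall_mem {E : Type*} [AddCommMonoid E] [Preorder E] {S : Set E} {F : E → ℝ}
    (h : ∀ x ∈ S, ∃ T, x ∈ T ∧ CMOn T F) : CMOn S F := fun l hl x hx => by
  obtain ⟨T, hxT, hT⟩ := h x hx
  exact hT l hl x hxT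

/-- The composition of a completely monotone function of several variables with a Bernstein function
in each variable is completely monotone. -/
lemma CMOn.comp_bernstein {G : (Fin n → ℝ) → ℝ} (hG : CMOn {x | ∀ j, 0 < x j} G) {B : ℝ → ℝ}
    (hB0 : ∀ w, 0 < w → 0 < B w) (hB : ∀ c, 0 ≤ c → CMOn (Ioi 0) fun w => Real.exp (-(c * B w))) :
    CMOn {x : Fin n → ℝ | ∀ j, 0 < x j} fun x => G fun j => B (x j) := by
  have hmono : ∀ {w w'}, 0 < w → w ≤ w' → B w ≤ B w' := by
    intro w w' hw h
    have := (hB 1 zero_le_one).antitone (x := w) (h := w' - w) hw (by linarith)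
    simpa using this
  refine CMOn.of_forall_mem fun x hx => ⟨Ici x, self_mem_Ici, ?_⟩
  have hx' : ∀ j, 0 < x j := hx
  -- Differences at x only see the cone above x, which B maps strictly above this vertex; there G is
  -- a mixture of products of exp(-p j B(y j)).
  set c : Fin n → ℝ := fun j => B (x j) / 2
  have hc : ∀ j, 0 < c j := fun j => half_pos (hB0 _ (hx' j))
  have hcy : ∀ y ∈ Ici x, ∀ j, c j < B (y j) := fun y hy j =>
    (half_lt_self (hB0 _ (hx' j))).trans_le (hmono (hx' j) (hy j))
  obtain ⟨μ, hμ, hpos, hGμ⟩ := (hG.mono (S' := Ici c)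
    fun y hy j => (hc j).trans_le (mem_Ici.1 hy j)).exists_measure
  have hS := isUpperSet_Ici x
  refine CMOn.congr hS (CMOn.integral hS (μ := μ)
    (K := fun p y => Real.exp (-∑ j, p j * (B (y j) - c j))) ?_ fun y hy => ?_)
    fun y hy => (hGμ _ (hcy y hy)).symm
  · filter_upwards [hpos] with p hp
    refine CMOn.congr hS (CMOn.prod hS Finset.univ (F := fun j y =>
      Real.exp (p j * c j) * Real.exp (-(p j * B (y j)))) fun j _ => CMOn.const_mul ?_ ?_) ?_
    · exact (hB (p j) (hp j)).comp (A := fun y : Fin n → ℝ => y j) (L := fun y : Fin n → ℝ => y j)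
        (fun _ _ => rfl) (fun h hh => hh j) fun y hy => (hx' j).trans_le (hy j)
    · positivity
    · intro y _
      rw [← Finset.sum_neg_distrib, Real.exp_sum]
      refine Finset.prod_congr rfl fun j _ => ?_
      rw [← Real.exp_add]
      congr 1
      ring
  · refine (integrable_const (1 : ℝ)).mono' (by fun_prop : Measurable fun p : Fin n → ℝ =>
      Real.exp (-∑ j, p j * (B (y j) - c j))).aestronglyMeasurable ?_
    filter_upwards [hpos] with p hp
    rw [Real.norm_of_nonneg (Real.exp_pos _).le]
    exact Real.exp_le_one_iff.2 (neg_nonpos.2 (Finset.sum_nonneg fun j _ =>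
      mul_nonneg (hp j) (sub_pos.2 (hcy y hy j)).le))

end Composition

/-! ### Closure properties of BVHCM functions -/

section Bivariate

variable {f : ℝ × ℝ → ℝ}

lemma IsMultiCM.comp_coord {m n : ℕ} {G : (Fin n → ℝ) → ℝ} (hG : IsMultiCM G) (σ : Fin n → Fin m) :
    IsMultiCM fun x : Fin m → ℝ => G fun j => x (σ j) :=
  (hG.cmOn.comp (S := {x : Fin m → ℝ | ∀ j, 0 < x j}) (A := fun (x : Fin m → ℝ) j => x (σ j))
    (L := fun (x : Fin m → ℝ) j => x (σ j)) (fun _ _ => rfl) (fun (h : Fin m → ℝ) (hh : 0 ≤ h) j => hh (σ j))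
    fun _ hx j => hx (σ j)).isMultiCM

lemma pos_vec3 {a b c : ℝ} (ha : 0 < a) (hb : 0 < b) (hc : 0 < c) :
    ![a, b, c] ∈ {x : Fin 3 → ℝ | ∀ j, 0 < x j} := by
  intro j
  fin_cases j <;> assumption

lemma IsBVHCM.isWeakBVHCM (hf : IsBVHCM f) : IsWeakBVHCM f := by
  intro u₁ u₂ hu₁ hu₂
  obtain ⟨G, hG, hGf⟩ := hf.2 u₁ u₂ hu₁ hu₂
  exact ⟨G, hG.cmOn.mono fun x hx j =>
    (pos_vec3 one_pos two_pos two_pos j).trans_le (mem_Ici.1 hx j), hGf⟩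

lemma two_le_div_add_div {a b : ℝ} (ha : 0 < a) (hb : 0 < b) : 2 ≤ a / b + b / a := by
  have := two_le_add_inv (div_pos ha hb)
  rwa [one_div_div] at this

/-- G decreases in each variable, and w₁, w₂, w₃ are all smallest, equal to 2, at v₁ = v₂ = 1. -/
lemma IsBVHCM.isMulLogConcave (hf : IsBVHCM f) : IsMulLogConcave f := by
  intro u₁ u₂ v₁ v₂ hu₁ hu₂ hv₁ hv₂
  obtain ⟨G, hG, hGf⟩ := hf.2 u₁ u₂ hu₁ hu₂
  have h1 := hGf 1 1 one_pos one_pos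
  norm_num at h1
  have hle : ![2, 2, 2] ≤ ![v₁ + 1 / v₁, v₂ + 1 / v₂, v₁ / v₂ + v₂ / v₁] := by
    intro j
    fin_cases j
    · exact two_le_add_inv hv₁
    · exact two_le_add_inv hv₂
    · exact two_le_div_add_div hv₁ hv₂
  have h2 := hG.cmOn.antitone (pos_vec3 two_pos two_pos two_pos) (sub_nonneg.2 hle)
  rw [add_sub_cancel] at h2
  rw [hGf v₁ v₂ hv₁ hv₂, sq, h1]
  exact h2

/-- A completely monotone function is either zero or positive. -/
lemma CMOn.pos_of_lt {n : ℕ} {G : (Fin n → ℝ) → ℝ} {c : Fin n → ℝ} (hG : CMOn (Ici c) G)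
    {x₀ x : Fin n → ℝ} (hx₀ : ∀ j, c j < x₀ j) (h₀ : G x₀ ≠ 0) (hx : ∀ j, c j < x j) : 0 < G x := by
  obtain ⟨μ, hμ, hpos, hGμ⟩ := hG.exists_measure
  have hint : Integrable (fun p : Fin n → ℝ => Real.exp (-∑ j, p j * (x j - c j))) μ := by
    refine (integrable_const (1 : ℝ)).mono' (by fun_prop : Measurable fun p : Fin n → ℝ =>
      Real.exp (-∑ j, p j * (x j - c j))).aestronglyMeasurable ?_
    filter_upwards [hpos] with p hp
    rw [Real.norm_of_nonneg (Real.exp_pos _).le]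
    exact Real.exp_le_one_iff.2 (neg_nonpos.2 (Finset.sum_nonneg fun j _ =>
      mul_nonneg (hp j) (sub_pos.2 (hx j)).le))
  have hne : NeZero μ := ⟨by
    rintro rfl
    exact h₀ (by simp [hGμ x₀ hx₀])⟩
  rw [hGμ x hx]
  exact integral_exp_pos hint

/-- With u = (a, b), G at (2, 2, 2) is f(a, b)² ≠ 0, so its Laplace measure is nonzero and G is
positive everywhere in the cone. The product containing f (x, y) is one of its values. -/
lemma IsBVHCM.pos (hf : IsBVHCM f) {a b : ℝ} (ha : 0 < a) (hb : 0 < b) (hab : f (a, b) ≠ 0)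
    {x y : ℝ} (hx : 0 < x) (hy : 0 < y) : 0 < f (x, y) := by
  obtain ⟨G, hG, hGf⟩ := hf.2 a b ha hb
  have h1 := hGf 1 1 one_pos one_pos
  norm_num at h1
  have h2 := hGf (x / a) (y / b) (by positivity) (by positivity)
  rw [mul_div_cancel₀ _ ha.ne', mul_div_cancel₀ _ hb.ne'] at h2
  have hG1 : CMOn (Ici ![1, 1, 1]) G := hG.cmOn.mono fun x hx j =>
    (pos_vec3 one_pos one_pos one_pos j).trans_le (mem_Ici.1 hx j)
  have hpos : 0 < G ![x / a + 1 / (x / a), y / b + 1 / (y / b), x / a / (y / b) + y / b / (x / a)] := by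
    refine hG1.pos_of_lt (x₀ := ![2, 2, 2]) (fun j => ?_) ?_ fun j => ?_
    · fin_cases j <;> norm_num
    · rw [← h1]
      exact mul_ne_zero hab hab
    · have e1 := two_le_add_inv (div_pos hx ha)
      have e2 := two_le_add_inv (div_pos hy hb)
      have e3 := two_le_div_add_div (div_pos hx ha) (div_pos hy hb)
      fin_cases j
      · exact one_lt_two.trans_le e1
      · exact one_lt_two.trans_le e2
      · exact one_lt_two.trans_le e3
  rw [← h2] at hpos
  exact lt_of_le_of_ne (hf.1 x y hx hy) fun h => by simp [← h] at hpos

lemma IsBVHCM.swap (hf : IsBVHCM f) : IsBVHCM fun p => f (p.2, p.1) := by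
  refine ⟨fun x y hx hy => hf.1 y x hy hx, fun u₁ u₂ hu₁ hu₂ => ?_⟩
  obtain ⟨G, hG, hGf⟩ := hf.2 u₂ u₁ hu₂ hu₁
  refine ⟨_, hG.comp_coord ![1, 0, 2], fun v₁ v₂ hv₁ hv₂ => ?_⟩
  rw [hGf v₂ v₁ hv₂ hv₁]
  congr 1
  ext j
  fin_cases j
  · rfl
  · rfl
  · exact add_comm _ _

/-- The density of `(X / Y, 1 / Y)`, when `f` is the density of `(X, Y)`. -/
noncomputable def quotientInvDensity (f : ℝ × ℝ → ℝ) (p : ℝ × ℝ) : ℝ := (p.2 ^ 3)⁻¹ * f (p.1 / p.2, 1 / p.2)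

lemma measurable_quotientInvDensity (hm : Measurable f) : Measurable (quotientInvDensity f) := by
  unfold quotientInvDensity
  fun_prop

/-- Replacing (v₁, v₂) by (v₁/v₂, 1/v₂) turns (w₁, w₂, w₃) into (w₃, w₂, w₁); the power of the
second variable contributes a constant. -/
lemma isBVHCM_quotientInvDensity (hf : IsBVHCM f) : IsBVHCM (quotientInvDensity f) := by
  refine ⟨fun x y hx hy => ?_, fun u₁ u₂ hu₁ hu₂ => ?_⟩
  · have := hf.1 (x / y) (1 / y) (by positivity) (by positivity)
    unfold quotientInvDensity
    positivity
  obtain ⟨G, hG, hGf⟩ := hf.2 (u₁ / u₂) (1 / u₂) (by positivity) (by positivity)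
  refine ⟨fun x => (u₂ ^ 3)⁻¹ ^ 2 * G fun j => x ((![2, 1, 0] : Fin 3 → Fin 3) j),
    ((hG.comp_coord ![2, 1, 0]).cmOn.const_mul (by positivity)).isMultiCM, fun v₁ v₂ hv₁ hv₂ => ?_⟩
  have h := hGf (v₁ / v₂) (1 / v₂) (by positivity) (by positivity)
  have hv : (fun j => (![v₁ + 1 / v₁, v₂ + 1 / v₂, v₁ / v₂ + v₂ / v₁] : Fin 3 → ℝ)
      ((![2, 1, 0] : Fin 3 → Fin 3) j)) = ![v₁ / v₂ + 1 / (v₁ / v₂), 1 / v₂ + 1 / (1 / v₂),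
        v₁ / v₂ / (1 / v₂) + 1 / v₂ / (v₁ / v₂)] := by
    ext j
    fin_cases j
    · simp
    · simp [add_comm]
    · simp only [Fin.reduceFinMk, Matrix.cons_val]
      field_simp
  beta_reduce
  rw [hv, ← h]
  simp only [quotientInvDensity]
  have e1 : u₁ * v₁ / (u₂ * v₂) = u₁ / u₂ * (v₁ / v₂) := by field_simp
  have e2 : 1 / (u₂ * v₂) = 1 / u₂ * (1 / v₂) := by field_simp
  have e3 : u₁ / v₁ / (u₂ / v₂) = u₁ / u₂ / (v₁ / v₂) := by field_simp
  have e4 : 1 / (u₂ / v₂) = 1 / u₂ / (1 / v₂) := by field_simp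
  rw [e1, e2, e3, e4]
  field_simp

lemma quotientDensity_eq (f : ℝ × ℝ → ℝ) :
    quotientDensity f = marginalDensity (quotientInvDensity f) := by
  ext z
  unfold quotientDensity marginalDensity quotientInvDensity
  rw [integral_Ioi_const_div one_pos]
  refine setIntegral_congr_fun measurableSet_Ioi fun t ht => ?_
  have ht' : 0 < t := ht
  simp only [smul_eq_mul, mul_one_div]
  field_simp

/-- The density of `(X ^ (1 / ρ), Y ^ (1 / ρ))`, when `f` is the density of `(X, Y)`. -/
noncomputable def powDensity (ρ : ℝ) (f : ℝ × ℝ → ℝ) (p : ℝ × ℝ) : ℝ :=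
  |ρ| * p.1 ^ (ρ - 1) * (|ρ| * p.2 ^ (ρ - 1)) * f (p.1 ^ ρ, p.2 ^ ρ)

lemma measurable_powDensity (ρ : ℝ) (hm : Measurable f) : Measurable (powDensity ρ f) := by
  unfold powDensity
  fun_prop

/-- The monomial factors multiply to constants, and each of w₁, w₂, w₃ is replaced by its image
under the same Bernstein function, insensitive to the sign of ρ. -/
lemma isBVHCM_powDensity (hf : IsBVHCM f) {ρ : ℝ} (hρ0 : ρ ≠ 0) (hρ : |ρ| ≤ 1) :
    IsBVHCM (powDensity ρ f) := by
  refine ⟨fun x y hx hy => ?_, fun u₁ u₂ hu₁ hu₂ => ?_⟩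
  · have := hf.1 (x ^ ρ) (y ^ ρ) (by positivity) (by positivity)
    unfold powDensity
    positivity
  obtain ⟨G, hG, hGf⟩ := hf.2 (u₁ ^ ρ) (u₂ ^ ρ) (by positivity) (by positivity)
  obtain ⟨B, hB0, hB, hBv⟩ := exists_bernstein_rpow (abs_pos.2 hρ0) hρ
  have hBρ : ∀ v, 0 < v → B (v + 1 / v) = v ^ ρ + 1 / v ^ ρ := by
    intro v hv
    rw [hBv v hv, one_div, ← Real.rpow_neg hv.le]
    rcases abs_choice ρ with h | h
    · rw [h]
    · rw [h, neg_neg, add_comm]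
  refine ⟨fun x => (|ρ| ^ 2 * (u₁ ^ (ρ - 1) * u₂ ^ (ρ - 1))) ^ 2 * G fun j => B (x j),
    ((hG.cmOn.comp_bernstein hB0 hB).const_mul (by positivity)).isMultiCM, fun v₁ v₂ hv₁ hv₂ => ?_⟩
  have h := hGf (v₁ ^ ρ) (v₂ ^ ρ) (by positivity) (by positivity)
  have hv : (fun j => B ((![v₁ + 1 / v₁, v₂ + 1 / v₂, v₁ / v₂ + v₂ / v₁] : Fin 3 → ℝ) j)) =
      ![v₁ ^ ρ + 1 / v₁ ^ ρ, v₂ ^ ρ + 1 / v₂ ^ ρ, v₁ ^ ρ / v₂ ^ ρ + v₂ ^ ρ / v₁ ^ ρ] := by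
    ext j
    fin_cases j
    · exact hBρ v₁ hv₁
    · exact hBρ v₂ hv₂
    · have := hBρ (v₁ / v₂) (by positivity)
      rw [one_div_div, Real.div_rpow hv₁.le hv₂.le, one_div_div] at this
      exact this
  beta_reduce
  rw [hv, ← h]
  simp only [powDensity]
  rw [Real.mul_rpow hu₁.le hv₁.le, Real.mul_rpow hu₂.le hv₂.le, Real.div_rpow hu₁.le hv₁.le,
    Real.div_rpow hu₂.le hv₂.le, Real.mul_rpow hu₁.le hv₁.le, Real.mul_rpow hu₂.le hv₂.le,
    Real.div_rpow hu₁.le hv₁.le, Real.div_rpow hu₂.le hv₂.le]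
  have := Real.rpow_pos_of_pos hv₁ (ρ - 1)
  have := Real.rpow_pos_of_pos hv₂ (ρ - 1)
  field_simp

end Bivariate

/-! ### Changes of variables for lower integrals -/

section Substitution

lemma lintegral_Ioi_const_div {x : ℝ} (hx : 0 < x) (k : ℝ → ℝ≥0∞) :
    ∫⁻ y in Ioi 0, k y = ∫⁻ t in Ioi 0, ENNReal.ofReal (x / t ^ 2) * k (x / t) := by
  have := lintegral_image_eq_lintegral_abs_deriv_mul measurableSet_Ioi
    (fun t ht => hasDerivWithinAt_const_div x ht) (injOn_const_div_Ioi hx) k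
  rw [image_const_div_Ioi hx] at this
  rw [this]
  refine setLIntegral_congr_fun measurableSet_Ioi fun t ht => ?_
  have ht' : 0 < t := ht
  simp only [abs_neg]
  rw [abs_of_pos (by positivity)]

lemma lintegral_Ioi_mul_const {c : ℝ} (hc : 0 < c) (k : ℝ → ℝ≥0∞) :
    ∫⁻ x in Ioi 0, k x = ∫⁻ z in Ioi 0, ENNReal.ofReal c * k (z * c) := by
  have himg : (fun z => z * c) '' Ioi 0 = Ioi 0 := by
    ext y
    simp only [mem_image, mem_Ioi]
    refine ⟨?_, fun hy => ⟨y / c, by positivity, by field_simp⟩⟩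
    rintro ⟨t, ht, rfl⟩
    positivity
  have := lintegral_image_eq_lintegral_abs_deriv_mul measurableSet_Ioi (s := Ioi 0)
    (f := fun z => z * c) (f' := fun _ => c)
    (fun t _ => by simpa using ((hasDerivAt_id t).mul_const c).hasDerivWithinAt)
    (mul_left_injective₀ hc.ne').injOn k
  rw [himg] at this
  rw [this, abs_of_pos hc]

lemma lintegral_Ioi_rpow {ρ : ℝ} (hρ : ρ ≠ 0) (k : ℝ → ℝ≥0∞) :
    ∫⁻ x in Ioi 0, k x = ∫⁻ s in Ioi 0, ENNReal.ofReal (|ρ| * s ^ (ρ - 1)) * k (s ^ ρ) := by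
  have hinv : ∀ s : ℝ, 0 < s → (s ^ ρ) ^ ρ⁻¹ = s := fun s hs => Real.rpow_rpow_inv hs.le hρ
  have himg : (fun s : ℝ => s ^ ρ) '' Ioi 0 = Ioi 0 := by
    ext y
    simp only [mem_image, mem_Ioi]
    refine ⟨?_, fun hy => ⟨y ^ ρ⁻¹, by positivity, Real.rpow_inv_rpow hy.le hρ⟩⟩
    rintro ⟨t, ht, rfl⟩
    positivity
  have := lintegral_image_eq_lintegral_abs_deriv_mul measurableSet_Ioi (s := Ioi 0)
    (f := fun s : ℝ => s ^ ρ) (f' := fun s => ρ * s ^ (ρ - 1))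
    (fun t ht => (Real.hasDerivAt_rpow_const (Or.inl (ne_of_gt ht))).hasDerivWithinAt)
    (fun s hs t ht h => by
      rw [← hinv s hs, ← hinv t ht]
      exact congrArg (fun z : ℝ => z ^ ρ⁻¹) h) k
  rw [himg] at this
  rw [this]
  refine setLIntegral_congr_fun measurableSet_Ioi fun s hs => ?_
  have hs' : 0 < s := hs
  rw [abs_mul, abs_of_pos (Real.rpow_pos_of_pos hs' (ρ - 1))]

end Substitution

/-! ### Densities of transformed vectors -/

section Densities

variable {f h : ℝ × ℝ → ℝ} {g : ℝ → ℝ}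

lemma lintegral_densityMeasure (hg : Measurable g) {φ : ℝ → ℝ≥0∞} (hφ : Measurable φ) :
    ∫⁻ x, φ x ∂densityMeasure g = ∫⁻ x in Ioi 0, ENNReal.ofReal (g x) * φ x :=
  lintegral_withDensity_eq_lintegral_mul _ hg.ennreal_ofReal hφ

lemma lintegral_densityMeasure₂ (hf : Measurable f) {φ : ℝ × ℝ → ℝ≥0∞} (hφ : Measurable φ) :
    ∫⁻ p, φ p ∂densityMeasure₂ f =
      ∫⁻ x in Ioi 0, ∫⁻ y in Ioi 0, ENNReal.ofReal (f (x, y)) * φ (x, y) := by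
  rw [densityMeasure₂, lintegral_withDensity_eq_lintegral_mul _ hf.ennreal_ofReal hφ,
    Measure.volume_eq_prod, ← Measure.prod_restrict,
    lintegral_prod _ (hf.ennreal_ofReal.mul hφ).aemeasurable]
  rfl

lemma measure_ext_of_lintegral {α : Type*} [MeasurableSpace α] {μ ν : Measure α}
    (h : ∀ φ : α → ℝ≥0∞, Measurable φ → ∫⁻ a, φ a ∂μ = ∫⁻ a, φ a ∂ν) : μ = ν := by
  ext s hs
  have := h (s.indicator 1) (measurable_one.indicator hs)
  rwa [lintegral_indicator_one hs, lintegral_indicator_one hs] at this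

lemma setLIntegral_swap {F : ℝ → ℝ → ℝ≥0∞} (hF : Measurable (Function.uncurry F)) :
    ∫⁻ x in Ioi 0, ∫⁻ y in Ioi 0, F x y = ∫⁻ y in Ioi 0, ∫⁻ x in Ioi 0, F x y :=
  lintegral_lintegral_swap hF.aemeasurable

variable {Ω : Type*} [MeasurableSpace Ω] {μ : Measure Ω} {X Y : Ω → ℝ}

lemma HasDensity₂.aemeasurable (hXY : HasDensity₂ μ X Y f) :
    AEMeasurable (fun ω => (X ω, Y ω)) μ :=
  hXY.1.prodMk hXY.2.1

lemma HasDensity₂.measurable (hXY : HasDensity₂ μ X Y f) : Measurable f := hXY.2.2.1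

lemma HasDensity₂.lintegral_map {β : Type*} [MeasurableSpace β] (hXY : HasDensity₂ μ X Y f)
    {T : ℝ × ℝ → β} (hT : Measurable T) {φ : β → ℝ≥0∞} (hφ : Measurable φ) :
    ∫⁻ b, φ b ∂(μ.map fun ω => T (X ω, Y ω)) =
      ∫⁻ x in Ioi 0, ∫⁻ y in Ioi 0, ENNReal.ofReal (f (x, y)) * φ (T (x, y)) := by
  have : (μ.map fun ω => T (X ω, Y ω)) = (densityMeasure₂ f).map T := by
    rw [← hXY.2.2.2.2, AEMeasurable.map_map_of_aemeasurable hT.aemeasurable hXY.aemeasurable]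
    rfl
  rw [this, MeasureTheory.lintegral_map hφ hT,
    lintegral_densityMeasure₂ hXY.measurable (by fun_prop : Measurable fun p => φ (T p))]

lemma HasDensity₂.map_eq (hXY : HasDensity₂ μ X Y f) (hh : Measurable h) {T : ℝ × ℝ → ℝ × ℝ}
    (hT : Measurable T) (key : ∀ φ : ℝ × ℝ → ℝ≥0∞, Measurable φ →
      ∫⁻ x in Ioi 0, ∫⁻ y in Ioi 0, ENNReal.ofReal (f (x, y)) * φ (T (x, y)) =
        ∫⁻ x in Ioi 0, ∫⁻ y in Ioi 0, ENNReal.ofReal (h (x, y)) * φ (x, y)) :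
    (μ.map fun ω => T (X ω, Y ω)) = densityMeasure₂ h := by
  refine measure_ext_of_lintegral fun φ hφ => ?_
  rw [hXY.lintegral_map hT hφ, lintegral_densityMeasure₂ hh hφ, key φ hφ]

lemma HasDensity₂.swap (hXY : HasDensity₂ μ X Y f) :
    HasDensity₂ μ Y X fun p => f (p.2, p.1) := by
  have hf := hXY.measurable
  refine ⟨hXY.2.1, hXY.1, by fun_prop, fun x y hx hy => hXY.2.2.2.1 y x hy hx, ?_⟩
  refine hXY.map_eq (T := Prod.swap) (by fun_prop) measurable_swap fun φ hφ => ?_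
  exact setLIntegral_swap (by fun_prop)

/-- The substitutions y = 1/t and x = z/t have Jacobians t^(-2) and t^(-1), whence the cube in the
density. -/
lemma HasDensity₂.div_inv (hXY : HasDensity₂ μ X Y f) :
    HasDensity₂ μ (fun ω => X ω / Y ω) (fun ω => 1 / Y ω) (quotientInvDensity f) := by
  have hf := hXY.measurable
  have hm := measurable_quotientInvDensity hf
  refine ⟨hXY.1.div hXY.2.1, aemeasurable_const.div hXY.2.1, hm, fun x y hx hy => ?_, ?_⟩
  · have := hXY.2.2.2.1 (x / y) (1 / y) (by positivity) (by positivity)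
    unfold quotientInvDensity
    positivity
  refine hXY.map_eq (T := fun p => (p.1 / p.2, 1 / p.2)) hm (by fun_prop) fun φ hφ => ?_
  rw [setLIntegral_swap (F := fun z t => ENNReal.ofReal (quotientInvDensity f (z, t)) *
    φ (z, t)) (by fun_prop)]
  calc ∫⁻ x in Ioi 0, ∫⁻ y in Ioi 0, ENNReal.ofReal (f (x, y)) * φ (x / y, 1 / y)
      = ∫⁻ x in Ioi 0, ∫⁻ t in Ioi 0, ENNReal.ofReal (1 / t ^ 2) *
          (ENNReal.ofReal (f (x, 1 / t)) * φ (x * t, t)) := by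
        refine lintegral_congr fun x => ?_
        rw [lintegral_Ioi_const_div one_pos]
        simp only [div_div_eq_mul_div, div_one, one_mul]
    _ = ∫⁻ t in Ioi 0, ∫⁻ x in Ioi 0, ENNReal.ofReal (1 / t ^ 2) *
          (ENNReal.ofReal (f (x, 1 / t)) * φ (x * t, t)) := setLIntegral_swap (by fun_prop)
    _ = ∫⁻ t in Ioi 0, ∫⁻ z in Ioi 0,
          ENNReal.ofReal (quotientInvDensity f (z, t)) * φ (z, t) := by
        refine setLIntegral_congr_fun measurableSet_Ioi fun t ht => ?_
        have ht' : 0 < t := ht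
        rw [lintegral_Ioi_mul_const ht' fun z =>
          ENNReal.ofReal (quotientInvDensity f (z, t)) * φ (z, t)]
        refine lintegral_congr fun x => ?_
        rw [← mul_assoc, ← mul_assoc, ← ENNReal.ofReal_mul (by positivity),
          ← ENNReal.ofReal_mul ht'.le]
        congr 2
        simp only [quotientInvDensity, mul_div_cancel_right₀ _ ht'.ne']
        field_simp

lemma HasDensity₂.rpow (hXY : HasDensity₂ μ X Y f) {q : ℝ} (hq : q ≠ 0) :
    HasDensity₂ μ (fun ω => X ω ^ q) (fun ω => Y ω ^ q) (powDensity q⁻¹ f) := by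
  have hf := hXY.measurable
  have hm := measurable_powDensity q⁻¹ hf
  have hq' : q⁻¹ ≠ 0 := inv_ne_zero hq
  refine ⟨hXY.1.pow_const q, hXY.2.1.pow_const q, hm, fun x y hx hy => ?_, ?_⟩
  · have := hXY.2.2.2.1 (x ^ q⁻¹) (y ^ q⁻¹) (by positivity) (by positivity)
    unfold powDensity
    positivity
  refine hXY.map_eq (T := fun p => (p.1 ^ q, p.2 ^ q)) hm (by fun_prop) fun φ hφ => ?_
  rw [lintegral_Ioi_rpow hq']
  refine setLIntegral_congr_fun measurableSet_Ioi fun s hs => ?_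
  have hs' : 0 < s := hs
  rw [lintegral_Ioi_rpow hq', ← lintegral_const_mul _ (by fun_prop)]
  refine setLIntegral_congr_fun measurableSet_Ioi fun t ht => ?_
  have ht' : 0 < t := ht
  rw [Real.rpow_inv_rpow hs'.le hq, Real.rpow_inv_rpow ht'.le hq, ← mul_assoc, ← mul_assoc,
    ← ENNReal.ofReal_mul (by positivity), ← ENNReal.ofReal_mul (by positivity)]
  rfl

end Densities

/-! ### The law of the first coordinate -/

section Marginals

variable {Ω : Type*} [MeasurableSpace Ω] {μ : Measure Ω} [IsProbabilityMeasure μ] {X Y : Ω → ℝ}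
  {f : ℝ × ℝ → ℝ}

lemma HasDensity₂.isProbabilityMeasure (hXY : HasDensity₂ μ X Y f) :
    IsProbabilityMeasure (densityMeasure₂ f) := by
  rw [← hXY.2.2.2.2]
  exact Measure.isProbabilityMeasure_map hXY.aemeasurable

lemma HasDensity₂.setLIntegral_eq_one (hXY : HasDensity₂ μ X Y f) :
    ∫⁻ p in Ioi 0 ×ˢ Ioi 0, ENNReal.ofReal (f p) = 1 := by
  have := hXY.isProbabilityMeasure
  rw [← measure_univ (μ := densityMeasure₂ f), densityMeasure₂,
    withDensity_apply _ MeasurableSet.univ, Measure.restrict_univ]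

/-- A BVHCM function with one zero vanishes identically, which total mass 1 forbids. -/
lemma HasDensity₂.pos (hXY : HasDensity₂ μ X Y f) (hf : IsBVHCM f) {x y : ℝ} (hx : 0 < x)
    (hy : 0 < y) : 0 < f (x, y) := by
  by_contra hcon
  have h0 : ∀ a b, 0 < a → 0 < b → f (a, b) = 0 := by
    intro a b ha hb
    by_contra hab
    exact hcon (hf.pos ha hb hab hx hy)
  have h1 := hXY.setLIntegral_eq_one
  rw [setLIntegral_congr_fun (g := fun _ => 0) (measurableSet_Ioi.prod measurableSet_Ioi)
    fun p hp => by simp [h0 p.1 p.2 hp.1 hp.2]] at h1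
  simp at h1

lemma HasDensity₂.lintegral_section_lt_top (hXY : HasDensity₂ μ X Y f) (hf : IsBVHCM f) {x : ℝ}
    (hx : 0 < x) : ∫⁻ y in Ioi 0, ENNReal.ofReal (f (x, y)) < ⊤ :=
  Hyperbolic.lintegral_section_lt_top hXY.measurable (fun _ _ => hXY.pos hf) hf.isMulLogConcave
    (by rw [hXY.setLIntegral_eq_one]; exact ENNReal.one_lt_top) hx

lemma HasDensity₂.ofReal_marginalDensity (hXY : HasDensity₂ μ X Y f) (hf : IsBVHCM f) {x : ℝ}
    (hx : 0 < x) : ENNReal.ofReal (marginalDensity f x) =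
      ∫⁻ y in Ioi 0, ENNReal.ofReal (f (x, y)) := by
  rw [marginalDensity_eq_toReal hXY.measurable (fun _ _ => hf.1 _ _) hx,
    ENNReal.ofReal_toReal (hXY.lintegral_section_lt_top hf hx).ne]

lemma HasDensity₂.marginalDensity_pos (hXY : HasDensity₂ μ X Y f) (hf : IsBVHCM f) {x : ℝ}
    (hx : 0 < x) : 0 < marginalDensity f x := by
  rw [← ENNReal.ofReal_pos, hXY.ofReal_marginalDensity hf hx,
    setLIntegral_pos_iff (by have := hXY.measurable; fun_prop)]
  have : (Function.support fun y => ENNReal.ofReal (f (x, y))) ∩ Ioi 0 = Ioi 0 :=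
    inter_eq_right.2 fun y hy => (ENNReal.ofReal_pos.2 (hXY.pos hf hx hy)).ne'
  rw [this]
  simp

lemma measurable_marginalDensity (hf : Measurable f) : Measurable (marginalDensity f) :=
  (hf.stronglyMeasurable.integral_prod_right' (ν := volume.restrict (Ioi 0))).measurable

/-- The first coordinate of a BVHCM vector. -/
theorem HasDensity₂.hasDensity_marginalDensity (hXY : HasDensity₂ μ X Y f) (hf : IsBVHCM f) :
    HasDensity μ X (marginalDensity f) := by
  have hm := measurable_marginalDensity hXY.measurable
  refine ⟨hXY.1, hm, fun x hx => (hXY.marginalDensity_pos hf hx).le, ?_⟩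
  refine measure_ext_of_lintegral fun φ hφ => ?_
  rw [hXY.lintegral_map measurable_fst hφ, lintegral_densityMeasure hm hφ]
  refine setLIntegral_congr_fun measurableSet_Ioi fun x hx => ?_
  rw [hXY.ofReal_marginalDensity hf hx]
  have hf := hXY.measurable
  exact lintegral_mul_const (φ x) (by fun_prop : Measurable fun y => ENNReal.ofReal (f (x, y)))

lemma HasDensity.integrableOn {g : ℝ → ℝ} (hX : HasDensity μ X g) : IntegrableOn g (Ioi 0) := by
  refine ⟨hX.2.1.aestronglyMeasurable, ?_⟩
  rw [hasFiniteIntegral_iff_ofReal]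
  · have : ∫⁻ x in Ioi 0, ENNReal.ofReal (g x) = (μ.map X) univ := by
      rw [hX.2.2.2, densityMeasure, withDensity_apply _ MeasurableSet.univ, Measure.restrict_univ]
    rw [this]
    have := Measure.isProbabilityMeasure_map hX.1
    exact measure_lt_top _ _
  · filter_upwards [ae_restrict_mem measurableSet_Ioi] with x hx using hX.2.2.1 x hx

theorem HasDensity₂.isHCM_marginalDensity (hXY : HasDensity₂ μ X Y f) (hf : IsBVHCM f) :
    IsHCM (marginalDensity f) :=
  (hf.isWeakBVHCM.marginal hXY.measurable (fun _ _ => hf.1 _ _)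
    fun _ => hXY.lintegral_section_lt_top hf).isHCM (measurable_marginalDensity hXY.measurable)
    (fun _ => hXY.marginalDensity_pos hf) (hXY.hasDensity_marginalDensity hf).integrableOn

end Marginals

/-! ### The conditional law -/

section Conditional

variable {Ω : Type*} [MeasurableSpace Ω] {μ : Measure Ω} [IsProbabilityMeasure μ] {X Y : Ω → ℝ}
  {f : ℝ × ℝ → ℝ}

lemma condDensity_eq (f : ℝ × ℝ → ℝ) (y x : ℝ) :
    condDensity f y x = f (x, y) / marginalDensity (fun p => f (p.2, p.1)) y := rfl

lemma HasDensity₂.isProbabilityMeasure_condDensity (hXY : HasDensity₂ μ X Y f) (hf : IsBVHCM f)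
    {y : ℝ} (hy : 0 < y) : IsProbabilityMeasure (densityMeasure (condDensity f y)) := by
  have hpos := hXY.swap.marginalDensity_pos hf.swap hy
  refine ⟨?_⟩
  rw [densityMeasure, withDensity_apply _ MeasurableSet.univ, Measure.restrict_univ]
  simp only [condDensity_eq, ENNReal.ofReal_div_of_pos hpos]
  simp only [div_eq_mul_inv]
  rw [lintegral_mul_const _ (by have := hXY.measurable; fun_prop),
    hXY.swap.ofReal_marginalDensity hf.swap hy]
  refine ENNReal.mul_inv_cancel ?_ (hXY.swap.lintegral_section_lt_top hf.swap hy).ne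
  rw [← hXY.swap.ofReal_marginalDensity hf.swap hy]
  exact (ENNReal.ofReal_pos.2 hpos).ne'

/-- With u₂ = y and v₂ = 1 the variables become (w, 2, w), so G is restricted to an increasing line;
no integration over x is involved beyond the normalizing constant. -/
lemma HasDensity₂.isHCM_condDensity (hXY : HasDensity₂ μ X Y f) (hf : IsBVHCM f)
    {y : ℝ} (hy : 0 < y) : IsHCM (condDensity f y) := by
  have hpos := hXY.swap.marginalDensity_pos hf.swap hy
  refine ⟨fun x hx => div_nonneg (hf.1 x y hx hy) hpos.le, fun u hu => ?_⟩
  obtain ⟨G, hG, hGf⟩ := hf.2 u y hu hy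
  have hcm : CMOn (Ioi 0) fun w : ℝ => G ![w, 2, w] := by
    refine hG.cmOn.comp (A := fun w => ![w, 2, w]) (L := fun w => ![w, 0, w]) (fun x h => ?_)
      (fun h hh j => ?_) fun w hw => pos_vec3 hw two_pos hw
    · ext j
      fin_cases j <;> simp
    · fin_cases j
      · exact hh
      · exact le_rfl
      · exact hh
  refine ⟨_, (hcm.const_mul (c := (marginalDensity (fun p => f (p.2, p.1)) y)⁻¹ ^ 2)
    (by positivity)).isCM, fun v hv => ?_⟩
  have h := hGf v 1 hv one_pos
  rw [mul_one, div_one, div_one, div_one, one_add_one_eq_two] at h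
  rw [condDensity_eq, condDensity_eq, ← h]
  ring

/-- The conditional law of the first coordinate of a BVHCM vector, given the second one. -/
theorem HasDensity₂.condDistrib_ae_eq (hXY : HasDensity₂ μ X Y f) (hf : IsBVHCM f) :
    ∀ᵐ y ∂(μ.map Y), condDistrib X Y μ y = densityMeasure (condDensity f y) := by
  have hfm := hXY.measurable
  set I := marginalDensity fun p => f (p.2, p.1)
  have hI : Measurable I := measurable_marginalDensity (by fun_prop)
  have hY := hXY.swap.hasDensity_marginalDensity hf.swap
  -- The value 1 for y ≤ 0 makes the kernel Markov everywhere; the law of Y does not charge these y.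
  set m : ℝ → ℝ := fun y => if 0 < y then y else 1
  have hm : Measurable m := Measurable.ite measurableSet_Ioi measurable_id measurable_const
  have hm0 : ∀ y, 0 < m y := fun y => by
    simp only [m]
    split_ifs with h
    · exact h
    · exact one_pos
  have hd : Measurable (Function.uncurry fun y x => ENNReal.ofReal (condDensity f (m y) x)) := by
    exact ((hfm.comp (measurable_snd.prodMk (hm.comp measurable_fst))).div
      (hI.comp (hm.comp measurable_fst))).ennreal_ofReal
  set κ : Kernel ℝ ℝ := Kernel.withDensity (Kernel.const ℝ (volume.restrict (Ioi 0)))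
    fun y x => ENNReal.ofReal (condDensity f (m y) x)
  have hκ : ∀ y, κ y = densityMeasure (condDensity f (m y)) := fun y => by
    rw [Kernel.withDensity_apply _ hd, Kernel.const_apply]
    rfl
  have hmarkov : IsMarkovKernel κ := ⟨fun y => by
    rw [hκ]
    exact hXY.isProbabilityMeasure_condDensity hf (hm0 y)⟩
  have hcond : condDistrib X Y μ =ᵐ[μ.map Y] κ := by
    refine condDistrib_ae_eq_of_measure_eq_compProd Y hXY.1 (measure_ext_of_lintegral fun φ hφ => ?_)
    have hmap := hXY.swap.lintegral_map (T := id) measurable_id hφ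
    simp only [id] at hmap
    rw [hmap, Measure.lintegral_compProd hφ,
      hY.2.2.2, lintegral_densityMeasure hI hφ.lintegral_kernel_prod_right']
    refine setLIntegral_congr_fun measurableSet_Ioi fun y hy => ?_
    have hpos := hXY.swap.marginalDensity_pos hf.swap hy
    have hmy : m y = y := if_pos hy
    have hcm : Measurable (condDensity f y) := by
      unfold condDensity
      fun_prop
    rw [hκ, hmy, lintegral_densityMeasure hcm (by fun_prop), ← lintegral_const_mul _ (by fun_prop)]
    refine setLIntegral_congr_fun measurableSet_Ioi fun x hx => ?_
    rw [← mul_assoc, ← ENNReal.ofReal_mul hpos.le, condDensity_eq, mul_div_cancel₀ _ hpos.ne']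
  have hYpos : ∀ᵐ y ∂(μ.map Y), 0 < y := by
    rw [hY.2.2.2]
    exact (withDensity_absolutelyContinuous _ _).ae_le (ae_restrict_mem measurableSet_Ioi)
  filter_upwards [hcond, hYpos] with y hy hy0
  rw [hy, hκ, show m y = y from if_pos hy0]

end Conditional

end Hyperbolic

/-! ### The proposition -/

theorem proposition3p1 {Ω : Type*} [MeasurableSpace Ω] (μ : Measure Ω) [IsProbabilityMeasure μ] :
    -- (a) conditional, marginal and quotient densities
    (∀ (X Y : Ω → ℝ) (f : ℝ × ℝ → ℝ), Hyperbolic.HasDensity₂ μ X Y f → Hyperbolic.IsBVHCM f →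
      ((∀ y, 0 < y →
          IsProbabilityMeasure (Hyperbolic.densityMeasure (Hyperbolic.condDensity f y)) ∧
          Hyperbolic.IsHCM (Hyperbolic.condDensity f y)) ∧
        (∀ᵐ y ∂(μ.map Y),
          condDistrib X Y μ y = Hyperbolic.densityMeasure (Hyperbolic.condDensity f y))) ∧
      (Hyperbolic.HasDensity μ X (Hyperbolic.marginalDensity f) ∧
        Hyperbolic.IsHCM (Hyperbolic.marginalDensity f)) ∧
      (Hyperbolic.HasDensity μ (fun ω => X ω / Y ω) (Hyperbolic.quotientDensity f) ∧
        Hyperbolic.IsHCM (Hyperbolic.quotientDensity f))) ∧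
    -- (b) inverses
    (∀ X₁ X₂ : Ω → ℝ, Hyperbolic.IsBVHCMVector μ X₁ X₂ →
      Hyperbolic.IsBVHCMVector μ (fun ω => (X₁ ω)⁻¹) (fun ω => (X₂ ω)⁻¹)) ∧
    -- (c) powers
    (∀ X₁ X₂ : Ω → ℝ, Hyperbolic.IsBVHCMVector μ X₁ X₂ → ∀ q : ℝ, 1 ≤ |q| →
      Hyperbolic.IsBVHCMVector μ (fun ω => X₁ ω ^ q) (fun ω => X₂ ω ^ q)) := by
  have hpow : ∀ X₁ X₂ : Ω → ℝ, Hyperbolic.IsBVHCMVector μ X₁ X₂ → ∀ q : ℝ, 1 ≤ |q| →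
      Hyperbolic.IsBVHCMVector μ (fun ω => X₁ ω ^ q) (fun ω => X₂ ω ^ q) := by
    rintro X₁ X₂ ⟨f, hX, hf⟩ q hq
    have hq0 : q ≠ 0 := abs_pos.1 (one_pos.trans_le hq)
    refine ⟨_, hX.rpow hq0, Hyperbolic.isBVHCM_powDensity hf (inv_ne_zero hq0) ?_⟩
    rw [abs_inv]
    exact inv_le_one_of_one_le₀ hq
  refine ⟨fun X Y f hXY hf => ⟨⟨fun y hy => ⟨hXY.isProbabilityMeasure_condDensity hf hy,
    hXY.isHCM_condDensity hf hy⟩, hXY.condDistrib_ae_eq hf⟩,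
    ⟨hXY.hasDensity_marginalDensity hf, hXY.isHCM_marginalDensity hf⟩, ?_⟩,
    fun X₁ X₂ h => ?_, hpow⟩
  · rw [Hyperbolic.quotientDensity_eq]
    have hq := Hyperbolic.isBVHCM_quotientInvDensity hf
    exact ⟨hXY.div_inv.hasDensity_marginalDensity hq, hXY.div_inv.isHCM_marginalDensity hq⟩
  · simpa only [Real.rpow_neg_one] using hpow X₁ X₂ h (-1) (by norm_num)
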